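/- **Setting.** Let $\gamma\subset\mathbb C$ be a smooth (regular $C^1$) oriented non self-intersecting curve, either closed or parametrized by arc length on a closed interval $J\subseteq\mathbb R$ (compact, a half-line, or $\mathbb R$) and $C^1$ up to its endpoints, if any. If $\gamma$ is unbounded, assume that its unit tangent is a uniformly continuous function of arc length $t$ and that $|t|\le A(1+|\gamma(t)|)^m$ for some constants $A,m$ (so $\gamma$ is closed in $\mathbb C$ and its length inside a disc grows at most polynomially with the radius). Let $W:\gamma\to\mathbb C^{N\times N}$ be a matrix of weights whose entries are Hölder continuous on $\gamma$, i.e. $|W^{(j,k)}(z)-W^{(j,k)}(w)|\le K|z-w|^{\alpha}$ for all $z,w\in\gamma$, with $K\ge 0$ and $0<\alpha\le1$; such that $\int_\gamma |z|^k|W^{(i,j)}(z)|\,|\mathrm dz|<\infty$ for all $k\in\mathbb N=\{0,1,2,\dots\}$ and all $i,j$; and with $W=0$ at the endpoints of $\gamma$, if there are any. Put $W_k=\frac1{2\pi \mathrm i}\int_\gamma z^kW(z)\,\mathrm dz$ and assume that $W$ is regular: $\det[W_{j+k}]_{j,k=0,\dots,n}\neq0$ for all $n\in\mathbb N$. **Orthogonal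 polynomials.** There are unique sequences of monic matrix polynomials $P_n^{\mathsf L}(z)=Iz^n+\cdots$, $P_n^{\mathsf R}(z)=Iz^n+\cdots$ and of nonsingular matrices $C_n$ such that, for $0\le k\le n$, $$\frac1{2\pi \mathrm i}\int_\gamma P_n^{\mathsf L}(z)W(z)z^k\,\mathrm dz=\delta_{n,k}C_n^{-1},\qquad \frac1{2\pi \mathrm i}\int_\gamma z^kW(z)P_n^{\mathsf R}(z)\,\mathrm dz=\delta_{n,k}C_n^{-1}.$$ For $z\in\mathbb C\setminus\gamma$ put $$Q_n^{\mathsf L}(z)=\frac1{2\pi \mathrm i}\int_\gamma \frac{P_n^{\mathsf L}(\zeta)W(\zeta)}{\zeta-z}\,\mathrm d\zeta,\qquad Q_n^{\mathsf R}(z)=\frac1{2\pi \mathrm i}\int_\gamma \frac{W(\zeta)P_n^{\mathsf R}(\zeta)}{\zeta-z}\,\mathrm d\zeta,$$ $$Y_n^{\mathsf L}=\begin{bmatrix}P_n^{\mathsf L}&Q_n^{\mathsf L}\\-C_{n-1}P_{n-1}^{\mathsf L}&-C_{n-1}Q_{n-1}^{\mathsf L}\end{bmatrix},\qquad Y_n^{\mathsf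 R}=\begin{bmatrix}P_n^{\mathsf R}&-P_{n-1}^{\mathsf R}C_{n-1}\\Q_n^{\mathsf R}&-Q_{n-1}^{\mathsf R}C_{n-1}\end{bmatrix},$$ where for $n=0$ the conventions $P_{-1}^{\mathsf L}=P_{-1}^{\mathsf R}=0$, $Q_{-1}^{\mathsf L}=Q_{-1}^{\mathsf R}=-C_{-1}^{-1}$ make the second block row of $Y_0^{\mathsf L}$ equal to $[0,\ I]$ and the second block column of $Y_0^{\mathsf R}$ equal to $[0,\ I]^{\top}$. **Left Riemann–Hilbert problem.** For every $n\in\mathbb N$, $Y_n^{\mathsf L}$ is the unique function $Y:\mathbb C\setminus\gamma\to\mathbb C^{2N\times2N}$ such that 1. $Y$ is holomorphic in $\mathbb C\setminus\gamma$; 2. $Y(z)=\big(I+O(z^{-1})\big)\begin{bmatrix}Iz^n&0\\0&Iz^{-n}\end{bmatrix}$ as $z\to\infty$, $z\notin\gamma$; 3. at every point $z\in\gamma$ that is not an endpoint the boundary values $Y_\pm(z)$ exist and $Y_+(z)=Y_-(z)\begin{bmatrix}I&W(z)\\0&I\end{bmatrix}$; at an endpoint of $\gamma$ (where the jump matrix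 is $I$) the limit of $Y$ exists. **Right Riemann–Hilbert problem.** For every $n\in\mathbb N$, $Y_n^{\mathsf R}$ is the unique function with 1., with $$Y(z)=\begin{bmatrix}Iz^n&0\\0&Iz^{-n}\end{bmatrix}\big(I+O(z^{-1})\big)$$ as $z\to\infty$, $z\notin\gamma$, instead of 2., and with 3. in which the jump condition is replaced by $$Y_+(z)=\begin{bmatrix}I&0\\W(z)&I\end{bmatrix}Y_-(z).$$ Here $Y_+(z_0)$ and $Y_-(z_0)$ are the (unrestricted) limits of $Y$ at $z_0\in\gamma$ from the left and from the right of $\gamma$: with an arc-length parametrization, extended periodically if $\gamma$ is closed, and $z_0=\gamma(t)$, $$Y_\pm(z_0)=\lim_{s\to t,\ \epsilon\to0^{\pm}}Y\big(\gamma(s)+\mathrm i\,\epsilon\,\gamma'(s)\big).$$ -/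

import Mathlib

open scoped Topology Polynomial NNReal

noncomputable section

namespace MatrixRHP

/-- A smooth oriented non self-intersecting curve in the plane, given by an arc-length
parametrisation on a closed parameter interval `dom`, in the direction of increasing parameter.
The interval may be all of `ℝ`, a half-line or a compact interval; in the last case the curve may
be closed, and then the parametrisation is periodic. Beyond the ends of `dom` the map `toFun` only
records that the curve is `C¹` up to its endpoints (extend it along the tangent lines).

The fields `uniformContinuous_deriv` and `growth` restrict the behaviour at infinity only: they
hold for every compact curve. -/
structure SmoothCurve where
  toFun : ℝ → ℂ
  dom : Set ℝ
  isClosed_dom : IsClosed dom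
  ordConnected_dom : dom.OrdConnected
  nonempty_interior_dom : (interior dom).Nonempty
  contDiff : ContDiff ℝ 1 toFun
  unit_speed : ∀ t, ‖deriv toFun t‖ = 1
  simple : Set.InjOn toFun dom ∨
    ∃ L : ℝ, 0 < L ∧ dom = Set.Icc 0 L ∧ Function.Periodic toFun L ∧
      Set.InjOn toFun (Set.Ico 0 L)
  uniformContinuous_deriv : UniformContinuous (deriv toFun)
  growth : ∃ (A : ℝ) (m : ℕ), ∀ t ∈ dom, |t| ≤ A * (1 + ‖toFun t‖) ^ m

namespace SmoothCurve

/-- The curve as a subset of the plane. -/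
def image (γ : SmoothCurve) : Set ℂ := γ.toFun '' γ.dom

/-- Parameters of the endpoints; a closed curve is not injective on `dom`, and has none. -/
def endParams (γ : SmoothCurve) : Set ℝ :=
  {t | t ∈ frontier γ.dom ∧ Set.InjOn γ.toFun γ.dom}

/-- The line integral `∫_γ F(z) dz` of a matrix-valued function, entry by entry. -/
def integral (γ : SmoothCurve) {m n : Type*} (F : ℂ → Matrix m n ℂ) : Matrix m n ℂ :=
  Matrix.of fun i j => ∫ t in γ.dom, deriv γ.toFun t * F (γ.toFun t) i j

/-- `V` is the boundary value at `γ(t)` of `f` from the positive (left) side: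
`f(γ(s) + i ε γ'(s)) → V` as `s → t` and `ε → 0⁺` jointly. Since a point close to `γ(t)` and off
the curve lies on the normal at its nearest point of the curve, this is the unrestricted limit of
`f` from the left of the curve. -/
def PosBoundaryValue (γ : SmoothCurve) {E : Type*} [TopologicalSpace E]
    (f : ℂ → E) (t : ℝ) (V : E) : Prop :=
  Filter.Tendsto
    (fun p : ℝ × ℝ => f (γ.toFun p.1 + (p.2 : ℂ) * Complex.I * deriv γ.toFun p.1))
    (𝓝 t ×ˢ 𝓝[>] (0 : ℝ)) (𝓝 V)

/-- The same from the negative (right) side: `ε → 0⁻`. -/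
def NegBoundaryValue (γ : SmoothCurve) {E : Type*} [TopologicalSpace E]
    (f : ℂ → E) (t : ℝ) (V : E) : Prop :=
  Filter.Tendsto
    (fun p : ℝ × ℝ => f (γ.toFun p.1 + (p.2 : ℂ) * Complex.I * deriv γ.toFun p.1))
    (𝓝 t ×ˢ 𝓝[<] (0 : ℝ)) (𝓝 V)

/-- The filter `z → ∞`, `z ∉ γ`. -/
def atInfinity (γ : SmoothCurve) : Filter ℂ :=
  Bornology.cobounded ℂ ⊓ Filter.principal γ.imageᶜ

end SmoothCurve

variable {N : ℕ}

/-- An `N × N` matrix of weights on `γ`: Hölder continuous entries, finite moments of all orders,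
and value zero at the endpoints of the curve, if there are any. -/
structure IsHolderWeight (γ : SmoothCurve) (W : ℂ → Matrix (Fin N) (Fin N) ℂ) : Prop where
  holder : ∀ i j, ∃ (K α : ℝ≥0), 0 < α ∧ α ≤ 1 ∧
    HolderOnWith K α (fun z => W z i j) γ.image
  integrable : ∀ (k : ℕ) (i j : Fin N),
    MeasureTheory.IntegrableOn
      (fun t => deriv γ.toFun t * (γ.toFun t ^ k * W (γ.toFun t) i j)) γ.dom
  zero_at_ends : ∀ t ∈ γ.endParams, W (γ.toFun t) = 0

/-- The factor `1 / (2 π i)`. -/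
def cauchyConst : ℂ := 1 / (2 * (Real.pi : ℂ) * Complex.I)

/-- The moment `W_k` of order `k`. -/
def moment (γ : SmoothCurve) (W : ℂ → Matrix (Fin N) (Fin N) ℂ) (k : ℕ) :
    Matrix (Fin N) (Fin N) ℂ :=
  cauchyConst • γ.integral fun z => z ^ k • W z

/-- The block Hankel matrix `[W_{j+k}]`, `j, k = 0, …, n`. -/
def hankel (γ : SmoothCurve) (W : ℂ → Matrix (Fin N) (Fin N) ℂ) (n : ℕ) :
    Matrix (Fin (n + 1) × Fin N) (Fin (n + 1) × Fin N) ℂ :=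
  Matrix.of fun p q => moment γ W ((p.1 : ℕ) + (q.1 : ℕ)) p.2 q.2

/-- The matrix of weights is regular. -/
def IsRegular (γ : SmoothCurve) (W : ℂ → Matrix (Fin N) (Fin N) ℂ) : Prop :=
  ∀ n, (hankel γ W n).det ≠ 0

/-- The value at a complex number of a polynomial with matrix coefficients. -/
def evalAt (P : (Matrix (Fin N) (Fin N) ℂ)[X]) (z : ℂ) : Matrix (Fin N) (Fin N) ℂ :=
  P.eval (z • (1 : Matrix (Fin N) (Fin N) ℂ))

/-- `P = I z^n +` terms of lower degree. -/
def IsMonicOfDegree (P : (Matrix (Fin N) (Fin N) ℂ)[X]) (n : ℕ) : Prop :=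
  P.natDegree ≤ n ∧ P.coeff n = 1

/-- `PL` and `PR` are the sequences of monic left and right orthogonal matrix polynomials with
respect to `W`, with nonsingular matrices `C n`. -/
structure IsOrthogonalSystem (γ : SmoothCurve) (W : ℂ → Matrix (Fin N) (Fin N) ℂ)
    (PL PR : ℕ → (Matrix (Fin N) (Fin N) ℂ)[X]) (C : ℕ → Matrix (Fin N) (Fin N) ℂ) : Prop where
  nonsingular : ∀ n, IsUnit (C n)
  monic_left : ∀ n, IsMonicOfDegree (PL n) n
  monic_right : ∀ n, IsMonicOfDegree (PR n) n
  orthogonal_left : ∀ n k, k ≤ n →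
    cauchyConst • γ.integral (fun z => z ^ k • (evalAt (PL n) z * W z)) =
      if n = k then (C n)⁻¹ else 0
  orthogonal_right : ∀ n k, k ≤ n →
    cauchyConst • γ.integral (fun z => z ^ k • (W z * evalAt (PR n) z)) =
      if n = k then (C n)⁻¹ else 0

/-- Second kind function `(1 / 2πi) ∫_γ P(ζ) W(ζ) / (ζ - z) dζ` of a left polynomial. -/
def secondKindLeft (γ : SmoothCurve) (W : ℂ → Matrix (Fin N) (Fin N) ℂ)
    (P : (Matrix (Fin N) (Fin N) ℂ)[X]) (z : ℂ) : Matrix (Fin N) (Fin N) ℂ :=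
  cauchyConst • γ.integral fun ζ => (ζ - z)⁻¹ • (evalAt P ζ * W ζ)

/-- Second kind function `(1 / 2πi) ∫_γ W(ζ) P(ζ) / (ζ - z) dζ` of a right polynomial. -/
def secondKindRight (γ : SmoothCurve) (W : ℂ → Matrix (Fin N) (Fin N) ℂ)
    (P : (Matrix (Fin N) (Fin N) ℂ)[X]) (z : ℂ) : Matrix (Fin N) (Fin N) ℂ :=
  cauchyConst • γ.integral fun ζ => (ζ - z)⁻¹ • (W ζ * evalAt P ζ)

/-- The left fundamental matrix; for `n = 0` the conventions `P₋₁ = 0`, `Q₋₁ = -C₋₁⁻¹` make the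
second block row `[0, I]`. -/
def leftY (γ : SmoothCurve) (W : ℂ → Matrix (Fin N) (Fin N) ℂ)
    (PL : ℕ → (Matrix (Fin N) (Fin N) ℂ)[X]) (C : ℕ → Matrix (Fin N) (Fin N) ℂ) :
    ℕ → ℂ → Matrix (Fin N ⊕ Fin N) (Fin N ⊕ Fin N) ℂ
  | 0, z => Matrix.fromBlocks (evalAt (PL 0) z) (secondKindLeft γ W (PL 0) z) 0 1
  | n + 1, z => Matrix.fromBlocks
      (evalAt (PL (n + 1)) z) (secondKindLeft γ W (PL (n + 1)) z)
      (-(C n * evalAt (PL n) z)) (-(C n * secondKindLeft γ W (PL n) z))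

/-- The right fundamental matrix; for `n = 0` the same conventions make the second block column
`[0, I]`. -/
def rightY (γ : SmoothCurve) (W : ℂ → Matrix (Fin N) (Fin N) ℂ)
    (PR : ℕ → (Matrix (Fin N) (Fin N) ℂ)[X]) (C : ℕ → Matrix (Fin N) (Fin N) ℂ) :
    ℕ → ℂ → Matrix (Fin N ⊕ Fin N) (Fin N ⊕ Fin N) ℂ
  | 0, z => Matrix.fromBlocks (evalAt (PR 0) z) 0 (secondKindRight γ W (PR 0) z) 1
  | n + 1, z => Matrix.fromBlocks
      (evalAt (PR (n + 1)) z) (-(evalAt (PR n) z * C n))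
      (secondKindRight γ W (PR (n + 1)) z) (-(secondKindRight γ W (PR n) z * C n))

/-- The block diagonal matrix `diag(I z^n, I z^{-n})`. -/
def diagPow (n : ℕ) (z : ℂ) : Matrix (Fin N ⊕ Fin N) (Fin N ⊕ Fin N) ℂ :=
  Matrix.fromBlocks (z ^ n • 1) 0 0 ((z ^ n)⁻¹ • 1)

/-- `Y` solves the left Riemann--Hilbert problem of index `n`. At an endpoint of the curve, where
the two sides merge and the jump matrix is the identity, the boundary value is the limit of `Y`. -/
structure SolvesLeftRHP (γ : SmoothCurve) (W : ℂ → Matrix (Fin N) (Fin N) ℂ) (n : ℕ)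
    (Y : ℂ → Matrix (Fin N ⊕ Fin N) (Fin N ⊕ Fin N) ℂ) : Prop where
  holomorphic : ∀ i j, DifferentiableOn ℂ (fun z => Y z i j) γ.imageᶜ
  asymptotics : ∃ E : ℂ → Matrix (Fin N ⊕ Fin N) (Fin N ⊕ Fin N) ℂ,
    (∀ i j, (fun z => E z i j) =O[γ.atInfinity] fun z => z⁻¹) ∧
    ∀ᶠ z in γ.atInfinity, Y z = (1 + E z) * diagPow n z
  jump : ∀ t ∈ γ.dom, t ∉ γ.endParams →
    ∃ Yp Ym, γ.PosBoundaryValue Y t Yp ∧ γ.NegBoundaryValue Y t Ym ∧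
      Yp = Ym * Matrix.fromBlocks 1 (W (γ.toFun t)) 0 1
  endpoint : ∀ t ∈ γ.endParams, ∃ V, Filter.Tendsto Y (𝓝[γ.imageᶜ] (γ.toFun t)) (𝓝 V)

/-- `Y` solves the right Riemann--Hilbert problem of index `n`. -/
structure SolvesRightRHP (γ : SmoothCurve) (W : ℂ → Matrix (Fin N) (Fin N) ℂ) (n : ℕ)
    (Y : ℂ → Matrix (Fin N ⊕ Fin N) (Fin N ⊕ Fin N) ℂ) : Prop where
  holomorphic : ∀ i j, DifferentiableOn ℂ (fun z => Y z i j) γ.imageᶜ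
  asymptotics : ∃ E : ℂ → Matrix (Fin N ⊕ Fin N) (Fin N ⊕ Fin N) ℂ,
    (∀ i j, (fun z => E z i j) =O[γ.atInfinity] fun z => z⁻¹) ∧
    ∀ᶠ z in γ.atInfinity, Y z = diagPow n z * (1 + E z)
  jump : ∀ t ∈ γ.dom, t ∉ γ.endParams →
    ∃ Yp Ym, γ.PosBoundaryValue Y t Yp ∧ γ.NegBoundaryValue Y t Ym ∧
      Yp = Matrix.fromBlocks 1 0 (W (γ.toFun t)) 1 * Ym
  endpoint : ∀ t ∈ γ.endParams, ∃ V, Filter.Tendsto Y (𝓝[γ.imageᶜ] (γ.toFun t)) (𝓝 V)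

end MatrixRHP

end

/-! Everything rests on the scalar Cauchy transform of a Hölder density `f` on the curve, and on
three facts about it.

(a) Plemelj (`IsChart.exists_boundaryValue`). Near a point of the curve write `z` in normal
coordinates, with foot `γ(s)` and signed height `ε`, and split off the value of the density at the
foot. The remainder has an integrable singularity and is continuous in `(s, ε)` up to the curve. The
rest is `f(γ(s))` times the integral of `dζ / (ζ - z)` over a short arc, a difference of logarithms
whose limits from the two sides differ by `2πi`. At an endpoint the logarithm stays bounded and the
density vanishes, so the limit exists.

(b) Behaviour at infinity. From `z / (ζ - z) = -1 + ζ / (ζ - z)`, multiplication by `z` turns the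
transform of `f` into that of `ζ f` minus a moment. Orthogonality therefore gives the required
decay, as soon as transforms are bounded near infinity off the curve. On an unbounded curve this is
a real issue, since `z` may approach the curve while tending to infinity. It is settled by
`SmoothCurve.exists_norm_cauchyIntegral_le`: Hölder continuity together with finite moments forces
rapid decrease, the uniformly continuous tangent gives one length scale for the whole curve, and the
bounds for short arcs are integrable along the curve.

(c) Liouville across the curve (`SmoothCurve.eq_of_tendsto`). A function holomorphic off the curve
with limits at all its points extends continuously, hence holomorphically, and is constant if it
converges at infinity.

With (a) and (b), `leftY` and `rightY` solve their problems: the polynomial blocks are entire, the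
second kind blocks have the additive jump, and the normalisation `C n` gives the corner block the
limit `I`.

Uniqueness needs neither determinants nor inverses of solutions. Put `J = [0, I; -I, 0]`. If `Z`
solves the left problem and `Y` the right one, then `Z J Y J⁻¹` has no jump, because `[I, W; 0, I] J
[I, 0; W, I] = J`, and tends to `I` at infinity, because `D J D = J` for `D = diag(z^n, z^{-n})`. By
(c) it is `I`. So the existence of a right solution determines the left one, and conversely.

Existence and uniqueness of the orthogonal polynomials is linear algebra: their coefficients solve a
block Hankel system, the right case is the transpose of the left one, and evaluating a double sum in
two orders shows that both sides share the same `C n`. -/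

namespace MatrixRHP

open Set Filter MeasureTheory Complex

/-! ### Geometry at a uniform scale: chords, tangents and normal coordinates. -/

namespace SmoothCurve

variable (γ : SmoothCurve)

/-- The point at signed distance `ε` to the left of `γ(s)` on the normal of the curve. -/
noncomputable def normalPoint (s ε : ℝ) : ℂ := γ.toFun s + (ε : ℂ) * I * deriv γ.toFun s

/-- On parameter intervals of radius `δ` the tangent turns by at most `1 / 10`. -/
structure IsScale (δ : ℝ) : Prop where
  pos : 0 < δ
  le_one : δ ≤ 1
  norm_deriv_sub_le : ∀ s u : ℝ, |u - s| ≤ δ → ‖deriv γ.toFun u - deriv γ.toFun s‖ ≤ 1 / 10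

theorem exists_isScale : ∃ δ, γ.IsScale δ := by
  obtain ⟨δ, hδ, h⟩ := Metric.uniformContinuous_iff.1 γ.uniformContinuous_deriv (1 / 10)
    (by norm_num)
  refine ⟨min (δ / 2) 1, by positivity, min_le_right _ _, fun s u hu => ?_⟩
  have h1 : dist u s < δ := by
    rw [Real.dist_eq]
    have := hu.trans (min_le_left _ _)
    linarith
  have := h h1
  rw [dist_eq_norm] at this
  exact this.le

theorem IsScale.mono {γ : SmoothCurve} {δ ρ : ℝ} (h : γ.IsScale δ) (hρ : 0 < ρ) (hle : ρ ≤ δ) :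
    γ.IsScale ρ :=
  ⟨hρ, hle.trans h.le_one, fun s u hu => h.norm_deriv_sub_le s u (hu.trans hle)⟩

theorem differentiable_toFun : Differentiable ℝ γ.toFun := γ.contDiff.differentiable (by norm_num)

theorem continuous_toFun : Continuous γ.toFun := γ.contDiff.continuous

theorem continuous_deriv : Continuous (deriv γ.toFun) := γ.uniformContinuous_deriv.continuous

theorem hasDerivAt (t : ℝ) : HasDerivAt γ.toFun (deriv γ.toFun t) t :=
  (γ.differentiable_toFun t).hasDerivAt

theorem deriv_ne_zero (t : ℝ) : deriv γ.toFun t ≠ 0 := by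
  rw [← norm_ne_zero_iff, γ.unit_speed]
  exact one_ne_zero

theorem norm_toFun_sub_le (t s : ℝ) : ‖γ.toFun t - γ.toFun s‖ ≤ |t - s| := by
  have := Convex.norm_image_sub_le_of_norm_deriv_le (f := γ.toFun) (s := Set.univ) (C := 1)
    (fun x _ => γ.differentiable_toFun x) (fun x _ => (γ.unit_speed x).le) convex_univ
    (mem_univ s) (mem_univ t)
  simpa using this

theorem continuous_normalPoint : Continuous fun p : ℝ × ℝ => γ.normalPoint p.1 p.2 := by
  unfold normalPoint
  have := γ.continuous_toFun
  have := γ.continuous_deriv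
  fun_prop

@[simp]
theorem normalPoint_zero (s : ℝ) : γ.normalPoint s 0 = γ.toFun s := by simp [normalPoint]

variable {γ} {δ : ℝ}

/-- Mean value inequality for `γ(t) - t γ'(c)`, whose derivative has norm at most `1 / 10` on the
interval. -/
theorem IsScale.norm_sub_sub_le (h : γ.IsScale δ) {c x y : ℝ} (hx : |x - c| ≤ δ)
    (hy : |y - c| ≤ δ) :
    ‖γ.toFun x - γ.toFun y - ((x - y : ℝ) : ℂ) * deriv γ.toFun c‖ ≤ |x - y| / 10 := by
  have hd : ∀ t, HasDerivAt (fun t : ℝ => γ.toFun t - (t : ℂ) * deriv γ.toFun c)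
      (deriv γ.toFun t - deriv γ.toFun c) t := fun t => by
    have := (γ.hasDerivAt t).sub ((HasDerivAt.ofReal_comp (hasDerivAt_id t)).mul_const
      (deriv γ.toFun c))
    rw [ofReal_one, one_mul] at this
    exact this
  have := Convex.norm_image_sub_le_of_norm_hasDerivWithin_le (C := 1 / 10)
    (s := Metric.closedBall c δ) (x := y) (y := x)
    (fun t _ => (hd t).hasDerivWithinAt)
    (fun t ht => h.norm_deriv_sub_le c t (by simpa [Real.dist_eq] using ht))
    (convex_closedBall c δ) (by simpa [Real.dist_eq] using hy) (by simpa [Real.dist_eq] using hx)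
  calc _ = _ := by congr 1; push_cast; ring
    _ ≤ _ := this
    _ = _ := by rw [Real.norm_eq_abs]; ring

theorem norm_ofReal_add_mul_I (x y : ℝ) : |x| ≤ ‖(x : ℂ) + y * I‖ ∧ |y| ≤ ‖(x : ℂ) + y * I‖ := by
  constructor
  · simpa using abs_re_le_norm ((x : ℂ) + y * I)
  · simpa using abs_im_le_norm ((x : ℂ) + y * I)

/-- The chord is nearly tangential, so a displacement along the normal cannot cancel it. The loss
`|x - y| / 10` is at most a tenth of the length of the ideal vector. All lower bounds with `9 / 10`
come from here. -/
theorem IsScale.le_norm_sub_add (h : γ.IsScale δ) {c x y : ℝ} (hx : |x - c| ≤ δ)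
    (hy : |y - c| ≤ δ) (v : ℝ) :
    9 / 10 * ‖((x - y : ℝ) : ℂ) + v * I‖ ≤
      ‖γ.toFun x - γ.toFun y + v * I * deriv γ.toFun c‖ := by
  have h1 := h.norm_sub_sub_le hx hy
  have h2 := (norm_ofReal_add_mul_I (x - y) v).1
  have h3 : ‖(((x - y : ℝ) : ℂ) + v * I) * deriv γ.toFun c‖ = ‖((x - y : ℝ) : ℂ) + v * I‖ := by
    rw [norm_mul, γ.unit_speed, mul_one]
  have h4 : (((x - y : ℝ) : ℂ) + v * I) * deriv γ.toFun c =
      (γ.toFun x - γ.toFun y + v * I * deriv γ.toFun c) -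
      (γ.toFun x - γ.toFun y - ((x - y : ℝ) : ℂ) * deriv γ.toFun c) := by ring
  rw [← h3] at h2 ⊢
  have h5 := norm_sub_le (γ.toFun x - γ.toFun y + v * I * deriv γ.toFun c)
      (γ.toFun x - γ.toFun y - ((x - y : ℝ) : ℂ) * deriv γ.toFun c)
  rw [← h4] at h5
  linarith

theorem IsScale.le_norm_sub_normalPoint (h : γ.IsScale δ) {s t : ℝ} (ht : |t - s| ≤ δ) (ε : ℝ) :
    9 / 10 * ‖((t - s : ℝ) : ℂ) - ε * I‖ ≤ ‖γ.toFun t - γ.normalPoint s ε‖ := by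
  have := h.le_norm_sub_add ht (y := s) (by simpa using h.pos.le) (-ε)
  convert this using 2
  · congr 1; push_cast; ring
  · simp only [normalPoint]; push_cast; ring

theorem IsScale.abs_le_norm_sub_normalPoint (h : γ.IsScale δ) {s t : ℝ} (ht : |t - s| ≤ δ)
    (ε : ℝ) : 9 / 10 * |t - s| ≤ ‖γ.toFun t - γ.normalPoint s ε‖ ∧
      9 / 10 * |ε| ≤ ‖γ.toFun t - γ.normalPoint s ε‖ := by
  have h1 := h.le_norm_sub_normalPoint ht ε
  have h2 := norm_ofReal_add_mul_I (t - s) (-ε)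
  rw [abs_neg] at h2
  have h3 : ((t - s : ℝ) : ℂ) + (-ε : ℝ) * I = ((t - s : ℝ) : ℂ) - ε * I := by push_cast; ring
  rw [h3] at h2
  constructor <;> linarith [h2.1, h2.2]

/-- Points near `γ(t)` lie on a line through a nearby point of the curve in a direction `i n`,
where `n` is a continuous unit vector field close to the tangent. -/
theorem IsScale.exists_eq_add_mul_I (h : γ.IsScale δ) {n : ℝ → ℂ} (hn : Continuous n)
    (hn1 : ∀ s, ‖n s‖ = 1) {t : ℝ} {z : ℂ}
    (hpos : 0 < ((γ.toFun (t + δ) - γ.toFun t) * (starRingEnd ℂ) (n (t + δ))).re - 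
      ‖z - γ.toFun t‖)
    (hneg : ((γ.toFun (t - δ) - γ.toFun t) * (starRingEnd ℂ) (n (t - δ))).re + 
      ‖z - γ.toFun t‖ < 0) :
    ∃ s v : ℝ, |s - t| ≤ δ ∧ z = γ.toFun s + v * I * n s := by
  -- The component of `γ(s) - z` along `n(s)` changes sign between `t - δ` and `t + δ`. At a zero,
  -- `z - γ(s)` is a real multiple of `i n(s)`.
  have hc : Continuous fun s => ((γ.toFun s - z) * (starRingEnd ℂ) (n s)).re := by
    have := γ.continuous_toFun
    fun_prop
  have hb : ∀ s, |((γ.toFun s - z) * (starRingEnd ℂ) (n s)).re -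
      ((γ.toFun s - γ.toFun t) * (starRingEnd ℂ) (n s)).re| ≤ ‖z - γ.toFun t‖ := fun s => by
    rw [← sub_re, ← sub_mul]
    refine (abs_re_le_norm _).trans ?_
    rw [norm_mul, RCLike.norm_conj, hn1, mul_one, ← norm_neg]
    apply le_of_eq; congr 1; ring
  have h1 := abs_le.1 (hb (t + δ))
  have h2 := abs_le.1 (hb (t - δ))
  obtain ⟨s, hs, hs0⟩ := intermediate_value_Icc (a := t - δ) (b := t + δ) (by linarith [h.pos])
    hc.continuousOn (show (0 : ℝ) ∈ Icc _ _ from ⟨by linarith, by linarith⟩)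
  refine ⟨s, -((γ.toFun s - z) * (starRingEnd ℂ) (n s)).im, ?_, ?_⟩
  · rw [abs_le]; constructor <;> linarith [hs.1, hs.2]
  · have h3 : (γ.toFun s - z) * (starRingEnd ℂ) (n s) =
        ((γ.toFun s - z) * (starRingEnd ℂ) (n s)).im * I := by
      apply Complex.ext
      · simp only [hs0]; simp
      · simp
    have h4 : (starRingEnd ℂ) (n s) * n s = 1 := by
      rw [mul_comm, mul_conj, normSq_eq_norm_sq, hn1]; simp
    have h5 : γ.toFun s - z = ((γ.toFun s - z) * (starRingEnd ℂ) (n s)).im * I * n s := by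
      rw [← h3, mul_assoc, h4, mul_one]
    push_cast
    linear_combination (-1 : ℂ) * h5

theorem re_mul_conj_ge {w n : ℂ} (r : ℝ) (hn : ‖n‖ = 1) :
    |(w * (starRingEnd ℂ) n).re - r| ≤ ‖w - r * n‖ := by
  have h4 : n * (starRingEnd ℂ) n = 1 := by
    rw [mul_conj, normSq_eq_norm_sq, hn]; simp
  have : (w * (starRingEnd ℂ) n).re - r = ((w - r * n) * (starRingEnd ℂ) n).re := by
    rw [sub_mul, mul_assoc, h4]; simp
  rw [this]
  refine (abs_re_le_norm _).trans ?_
  rw [norm_mul, RCLike.norm_conj, hn, mul_one]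

/-- Normal coordinates near a point of the curve. -/
theorem IsScale.exists_eq_normalPoint (h : γ.IsScale δ) {t : ℝ} {z : ℂ}
    (hz : ‖z - γ.toFun t‖ < 9 / 10 * δ) :
    ∃ s ε : ℝ, z = γ.normalPoint s ε ∧ 9 / 10 * |s - t| ≤ ‖z - γ.toFun t‖ ∧
      9 / 10 * |ε| ≤ ‖z - γ.toFun t‖ := by
  have hp := h.pos
  obtain ⟨s, v, hs, rfl⟩ := h.exists_eq_add_mul_I γ.continuous_deriv γ.unit_speed (t := t) (z := z)
    (by
      have h1 := h.norm_sub_sub_le (c := t + δ) (x := t + δ) (y := t) (by simpa using hp.le)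
        (by simp [abs_of_pos hp])
      have h2 := abs_le.1 ((re_mul_conj_ge (t + δ - t) (γ.unit_speed (t + δ))).trans h1)
      rw [add_sub_cancel_left, abs_of_pos hp] at h2
      linarith [h2.1])
    (by
      have h1 := h.norm_sub_sub_le (c := t - δ) (x := t - δ) (y := t) (by simpa using hp.le)
        (by simp [abs_of_pos hp])
      have h2 := abs_le.1 ((re_mul_conj_ge (t - δ - t) (γ.unit_speed (t - δ))).trans h1)
      rw [sub_sub_cancel_left, abs_neg, abs_of_pos hp] at h2
      linarith [h2.2])
  have h3 := h.abs_le_norm_sub_normalPoint (s := s) (t := t) (by rwa [abs_sub_comm]) v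
  refine ⟨s, v, rfl, ?_, ?_⟩
  · rw [norm_sub_rev, abs_sub_comm]; exact h3.1
  · rw [norm_sub_rev]; exact h3.2

/-! ### Closedness of the curve, and charts in which a given point has one parameter. -/

variable (γ)

/-- Along a convergent sequence of points the growth bound confines the parameters to a compact set,
so a subsequence of them converges. -/
theorem isClosed_image_of_growth {S : Set ℝ} (hS : IsClosed S) {A : ℝ} {m : ℕ}
    (hg : ∀ t ∈ S, |t| ≤ A * (1 + ‖γ.toFun t‖) ^ m) : IsClosed (γ.toFun '' S) := by
  rw [← isSeqClosed_iff_isClosed]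
  intro x z hx hz
  choose t ht using hx
  obtain ⟨R, hR⟩ := (Metric.isBounded_range_of_tendsto x hz).exists_norm_le
  have hR0 : 0 ≤ R := (norm_nonneg _).trans (hR (x 0) (mem_range_self 0))
  have hb : ∀ k, t k ∈ Metric.closedBall (0 : ℝ) (|A| * (1 + R) ^ m) := fun k => by
    rw [mem_closedBall_zero_iff, Real.norm_eq_abs]
    have h1 : ‖γ.toFun (t k)‖ ≤ R := by rw [(ht k).2]; exact hR _ (mem_range_self k)
    calc |t k| ≤ A * (1 + ‖γ.toFun (t k)‖) ^ m := hg _ (ht k).1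
      _ ≤ |A| * (1 + R) ^ m := by
        gcongr
        exact le_abs_self A
  obtain ⟨a, -, φ, hφ, hlim⟩ := (isCompact_closedBall (0 : ℝ) _).tendsto_subseq hb
  refine ⟨a, hS.mem_of_tendsto hlim (Eventually.of_forall fun k => (ht _).1), ?_⟩
  have h1 : Tendsto (fun k => γ.toFun (t (φ k))) atTop (𝓝 (γ.toFun a)) :=
    (γ.continuous_toFun.tendsto a).comp hlim
  have h2 : Tendsto (fun k => γ.toFun (t (φ k))) atTop (𝓝 z) := by
    simp_rw [fun k => (ht (φ k)).2]
    exact hz.comp hφ.tendsto_atTop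
  exact tendsto_nhds_unique h1 h2

theorem isClosed_image : IsClosed γ.image := by
  obtain ⟨A, m, h⟩ := γ.growth
  exact γ.isClosed_image_of_growth γ.isClosed_dom h

/-- A `C¹` image of the line cannot fill an open subset of the plane. This permits extension by
continuity from the complement of the curve. -/
theorem dense_compl_image : Dense γ.imageᶜ := by
  refine (ContDiff.dense_compl_range_of_finrank_lt_finrank γ.contDiff (by simp)).mono ?_
  exact compl_subset_compl.2 (image_subset_range _ _)

/-- A closed set `D` of parameters covering the curve, in which `t` is the only parameter
of the point `γ(t)`. -/
structure IsChart (t : ℝ) (D : Set ℝ) : Prop where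
  isClosed : IsClosed D
  mem : t ∈ D
  image_eq : γ.toFun '' D = γ.image
  eq_of_eq : ∀ s ∈ D, γ.toFun s = γ.toFun t → s = t
  growth : ∃ (A : ℝ) (m : ℕ), ∀ t ∈ D, |t| ≤ A * (1 + ‖γ.toFun t‖) ^ m
  setIntegral_eq : ∀ F : ℂ → ℂ, ∫ s in γ.dom, deriv γ.toFun s * F (γ.toFun s) =
    ∫ s in D, deriv γ.toFun s * F (γ.toFun s)
  integrableOn_iff : ∀ F : ℂ → ℂ, IntegrableOn (fun s => deriv γ.toFun s * F (γ.toFun s)) γ.dom ↔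
    IntegrableOn (fun s => deriv γ.toFun s * F (γ.toFun s)) D
  nhds : t ∉ γ.endParams → D ∈ 𝓝 t
  eq_dom : t ∈ γ.endParams → D = γ.dom

variable {γ}

theorem isChart_dom (hinj : InjOn γ.toFun γ.dom) {t : ℝ} (ht : t ∈ γ.dom) :
    γ.IsChart t γ.dom where
  isClosed := γ.isClosed_dom
  mem := ht
  image_eq := rfl
  eq_of_eq := fun _ hs h => hinj hs ht h
  growth := γ.growth
  setIntegral_eq := fun _ => rfl
  integrableOn_iff := fun _ => Iff.rfl
  nhds := fun h => by
    have h1 : t ∉ frontier γ.dom := fun h' => h ⟨h', hinj⟩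
    rw [γ.isClosed_dom.frontier_eq] at h1
    exact mem_interior_iff_mem_nhds.1 (by_contra fun h' => h1 ⟨ht, h'⟩)
  eq_dom := fun _ => rfl

theorem not_injOn_of_periodic {L : ℝ} (hL : 0 < L) (hdom : γ.dom = Icc 0 L)
    (hper : Function.Periodic γ.toFun L) : ¬ InjOn γ.toFun γ.dom := fun h => by
  rw [hdom] at h
  have := h (left_mem_Icc.2 hL.le) (right_mem_Icc.2 hL.le) (by simpa using (hper 0).symm)
  exact hL.ne this

theorem periodic_deriv {L : ℝ} (hper : Function.Periodic γ.toFun L) :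
    Function.Periodic (deriv γ.toFun) L := fun x => by
  have : (fun y => γ.toFun (y + L)) = γ.toFun := funext hper
  rw [← deriv_comp_add_const, this]

theorem exists_sub_mem_Ico {L : ℝ} (hL : 0 < L) (a s : ℝ) (hper : Function.Periodic γ.toFun L) :
    ∃ k : ℤ, s - k * L ∈ Ico a (a + L) ∧ γ.toFun (s - k * L) = γ.toFun s := by
  refine ⟨toIcoDiv hL a s, by
    have := toIcoMod_mem_Ico hL a s
    rwa [toIcoMod, zsmul_eq_mul] at this, ?_⟩
  simpa using hper.sub_zsmul_eq (x := s) (toIcoDiv hL a s)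

/-- On a closed curve any window of one period represents the same integrals. Centring it at `t`
moves the repeated point to distance `L / 2` from `t`, so every point of the curve, `γ(0)` included,
is treated as an interior one. -/
theorem isChart_periodic {L : ℝ} (hL : 0 < L) (hdom : γ.dom = Icc 0 L)
    (hper : Function.Periodic γ.toFun L) (hinj : InjOn γ.toFun (Ico 0 L)) {t : ℝ} :
    γ.IsChart t (Icc (t - L / 2) (t - L / 2 + L)) where
  isClosed := isClosed_Icc
  mem := ⟨by linarith, by linarith⟩
  image_eq := by
    apply subset_antisymm
    · rintro _ ⟨s, -, rfl⟩
      obtain ⟨k, hk, h⟩ := exists_sub_mem_Ico hL 0 s hper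
      rw [image, hdom, ← h]
      exact mem_image_of_mem _ (by simpa using Ico_subset_Icc_self hk)
    · rintro _ ⟨s, -, rfl⟩
      obtain ⟨k, hk, h⟩ := exists_sub_mem_Ico hL (t - L / 2) s hper
      rw [← h]
      exact mem_image_of_mem _ (Ico_subset_Icc_self hk)
  eq_of_eq := fun s hs h => by
    obtain ⟨k, hk, hk'⟩ := exists_sub_mem_Ico hL 0 s hper
    obtain ⟨l, hl, hl'⟩ := exists_sub_mem_Ico hL 0 t hper
    rw [zero_add] at hk hl
    have h1 := hinj hk hl (by rw [hk', hl', h])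
    have h2 : s - t = ((k - l : ℤ) : ℝ) * L := by push_cast; linarith
    have h3 : |((k - l : ℤ) : ℝ)| < 1 := by
      rw [← mul_lt_mul_iff_left₀ hL, ← abs_of_pos hL, ← abs_mul, abs_of_pos hL, ← h2, abs_lt]
      constructor <;> linarith [hs.1, hs.2]
    have h4 : k - l = 0 := by
      rw [← Int.cast_abs] at h3
      exact Int.abs_lt_one_iff.1 (by exact_mod_cast h3)
    rw [h4] at h2
    simp at h2
    linarith
  growth := by
    refine ⟨|t| + L, 0, fun s hs => ?_⟩
    have : |s| ≤ |t| + L := by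
      have := abs_le.1 (le_refl |t|)
      rw [abs_le]; constructor <;> linarith [hs.1, hs.2]
    simpa using this
  setIntegral_eq := fun F => by
    have hp : Function.Periodic (fun s => deriv γ.toFun s * F (γ.toFun s)) L := fun s => by
      simp only [hper s, periodic_deriv hper s]
    rw [hdom, integral_Icc_eq_integral_Ioc, integral_Icc_eq_integral_Ioc,
      ← intervalIntegral.integral_of_le hL.le, ← intervalIntegral.integral_of_le (by linarith)]
    simpa using hp.intervalIntegral_add_eq 0 (t - L / 2)
  integrableOn_iff := fun F => by
    have hp : Function.Periodic (fun s => deriv γ.toFun s * F (γ.toFun s)) L := fun s => by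
      simp only [hper s, periodic_deriv hper s]
    rw [hdom, ← intervalIntegrable_iff_integrableOn_Icc_of_le hL.le,
      ← intervalIntegrable_iff_integrableOn_Icc_of_le (by linarith)]
    constructor
    · exact fun h => hp.intervalIntegrable (t := 0) hL.ne' (by simpa using h) _ _
    · exact fun h => hp.intervalIntegrable (t := t - L / 2) hL.ne' h _ _
  nhds := fun _ => Icc_mem_nhds (by linarith) (by linarith)
  eq_dom := fun h => absurd h.2 (not_injOn_of_periodic hL hdom hper)

theorem exists_isChart {t : ℝ} (ht : t ∈ γ.dom) : ∃ D, γ.IsChart t D := by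
  rcases γ.simple with h | ⟨L, hL, hdom, hper, hinj⟩
  · exact ⟨_, isChart_dom h ht⟩
  · exact ⟨_, isChart_periodic hL hdom hper hinj⟩

/-- The rest of the curve is closed, by the growth bound, and misses `γ(t)`, by simplicity. Hence it
cannot return near `γ(t)`, not even from infinity. -/
theorem IsChart.exists_le_norm_sub {t : ℝ} {D : Set ℝ} (hD : γ.IsChart t D) {η : ℝ} (hη : 0 < η) :
    ∃ c > 0, ∀ s ∈ D, η ≤ |s - t| → c ≤ ‖γ.toFun s - γ.toFun t‖ := by
  obtain ⟨A, m, hg⟩ := hD.growth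
  have hcl : IsClosed (γ.toFun '' (D ∩ {s | η ≤ |s - t|})) :=
    γ.isClosed_image_of_growth (hD.isClosed.inter (isClosed_le continuous_const (by fun_prop)))
      (fun s hs => hg s hs.1)
  have hnot : γ.toFun t ∈ (γ.toFun '' (D ∩ {s | η ≤ |s - t|}))ᶜ := by
    rintro ⟨s, hs, h⟩
    have h1 := hs.2
    rw [hD.eq_of_eq s hs.1 h] at h1
    simp at h1
    linarith
  obtain ⟨c, hc, hsub⟩ := Metric.isOpen_iff.1 hcl.isOpen_compl _ hnot
  refine ⟨c, hc, fun s hs hst => not_lt.1 fun hlt => ?_⟩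
  exact hsub (by rwa [Metric.mem_ball, dist_eq_norm]) (mem_image_of_mem _ ⟨hs, hst⟩)

theorem IsChart.setIntegral_add_eq {t : ℝ} {D : Set ℝ} (hD : γ.IsChart t D) (F : ℂ → ℂ) :
    ∫ s in γ.dom, deriv γ.toFun s * F (γ.toFun s) =
    ∫ s, deriv γ.toFun s * D.indicator (fun s => F (γ.toFun s)) s := by
  rw [hD.setIntegral_eq, ← integral_indicator hD.isClosed.measurableSet]
  congr 1
  ext s
  by_cases h : s ∈ D <;> simp [h]

end SmoothCurve

/-! ### Weakly singular powers and local Hölder continuity. -/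

theorem intervalIntegrable_abs_rpow {r : ℝ} (hr : -1 < r) (ρ : ℝ) :
    IntervalIntegrable (fun u : ℝ => |u| ^ r) volume (-ρ) ρ := by
  have h : ∀ ρ : ℝ, 0 ≤ ρ → IntervalIntegrable (fun u : ℝ => |u| ^ r) volume 0 ρ := fun ρ hρ =>
    (intervalIntegral.intervalIntegrable_rpow' hr).congr fun u hu => by
      rw [uIoc_of_le hρ] at hu
      simp [abs_of_pos hu.1]
  have h' : ∀ ρ : ℝ, 0 ≤ ρ → IntervalIntegrable (fun u : ℝ => |u| ^ r) volume (-ρ) 0 :=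
    fun ρ hρ => by
      have := (h ρ hρ).comp_sub_left 0
      simpa using this.symm
  rcases le_total 0 ρ with hρ | hρ
  · exact (h' ρ hρ).trans (h ρ hρ)
  · simpa using ((h' (-ρ) (by linarith)).trans (h (-ρ) (by linarith))).symm

/-- Hölder continuity near a point of the line, with an unspecified exponent. -/
def HolderNear (g : ℝ → ℂ) (t₀ : ℝ) : Prop :=
  ∃ α > 0, ∃ C ≥ 0, ∃ η > 0, ∀ s t : ℝ, |s - t₀| ≤ η → |t - t₀| ≤ η →
    ‖g s - g t‖ ≤ C * |s - t| ^ (α : ℝ)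

theorem HolderNear.continuousAt {g : ℝ → ℂ} {t₀ : ℝ} (h : HolderNear g t₀) :
    ∃ η > 0, ∀ t, |t - t₀| < η → ContinuousAt g t := by
  obtain ⟨α, hα, C, hC, η, hη, h⟩ := h
  refine ⟨η, hη, fun t ht => ?_⟩
  rw [ContinuousAt, tendsto_iff_norm_sub_tendsto_zero]
  have h1 : Tendsto (fun s => C * |s - t| ^ α) (𝓝 t) (𝓝 0) := by
    have : Continuous fun s : ℝ => C * |s - t| ^ α := by
      have := Real.continuous_rpow_const hα.le
      fun_prop
    simpa [Real.zero_rpow hα.ne'] using this.tendsto t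
  refine squeeze_zero' (Eventually.of_forall fun _ => norm_nonneg _) ?_ h1
  have : ∀ᶠ s in 𝓝 t, |s - t₀| < η :=
    (show ContinuousAt (fun s : ℝ => |s - t₀|) t by fun_prop).eventually_lt
      continuousAt_const ht
  filter_upwards [this] with s hs
  exact h s t hs.le ht.le

/-! ### The logarithmic kernel of a short arc and its jump. -/

namespace SmoothCurve

variable (γ : SmoothCurve) {δ : ℝ}

/-- The integral of `dζ / (ζ - z)` over the arc of radius `ρ` about `γ(s)`, at a point `z` of the
normal. -/
noncomputable def logKernel (ρ s ε : ℝ) : ℂ :=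
  ∫ u in -ρ..ρ, deriv γ.toFun (s + u) * (γ.toFun (s + u) - γ.normalPoint s ε)⁻¹

/-- The chord from `γ(s)` to `γ(s + u)` in the frame of the right normal at `γ(s)`. -/
noncomputable def chord (u s : ℝ) : ℂ := I * ((γ.toFun (s + u) - γ.toFun s) / deriv γ.toFun s)

theorem continuous_chord (u : ℝ) : Continuous (γ.chord u) := by
  unfold chord
  have h1 := γ.continuous_toFun
  have h2 := γ.continuous_deriv
  have h3 := γ.deriv_ne_zero
  fun_prop (disch := assumption)

theorem chord_zero (s : ℝ) : γ.chord 0 s = 0 := by simp [chord]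

theorem hasDerivAt_chord (u s : ℝ) :
    HasDerivAt (fun u => γ.chord u s) (I * (deriv γ.toFun (s + u) / deriv γ.toFun s)) u := by
  unfold chord
  have := (γ.hasDerivAt (s + u)).comp_const_add s u
  exact ((this.sub_const _).div_const _).const_mul _

variable {γ}

theorem IsScale.norm_chord_sub_le (h : γ.IsScale δ) {u : ℝ} (hu : |u| ≤ δ) (s : ℝ) :
    ‖γ.chord u s - u * I‖ ≤ |u| / 10 := by
  have h1 := h.norm_sub_sub_le (c := s) (x := s + u) (y := s) (by simpa) (by simpa using h.pos.le)
  rw [add_sub_cancel_left] at h1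
  have h2 := γ.deriv_ne_zero s
  have h3 : γ.chord u s - u * I = I * ((γ.toFun (s + u) - γ.toFun s - u * deriv γ.toFun s) /
      deriv γ.toFun s) := by
    unfold chord; field_simp
  rw [h3, norm_mul, norm_div, γ.unit_speed, norm_I]
  simpa using h1

theorem IsScale.abs_im_chord_sub_le (h : γ.IsScale δ) {u : ℝ} (hu : |u| ≤ δ) (s : ℝ) :
    |(γ.chord u s).im - u| ≤ |u| / 10 := by
  have := (abs_im_le_norm _).trans (h.norm_chord_sub_le hu s)
  simpa using this

theorem IsScale.im_chord_pos (h : γ.IsScale δ) {u : ℝ} (hu : |u| ≤ δ) (hu0 : 0 < u) (s : ℝ) :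
    9 / 10 * u ≤ (γ.chord u s).im := by
  have := abs_le.1 (h.abs_im_chord_sub_le hu s)
  rw [abs_of_pos hu0] at this
  linarith [this.1]

theorem IsScale.im_chord_neg (h : γ.IsScale δ) {u : ℝ} (hu : |u| ≤ δ) (hu0 : u < 0) (s : ℝ) :
    (γ.chord u s).im ≤ 9 / 10 * u := by
  have := abs_le.1 (h.abs_im_chord_sub_le hu s)
  rw [abs_of_neg hu0] at this
  linarith [this.2]

theorem norm_chord_le (u s : ℝ) : ‖γ.chord u s‖ ≤ |u| := by
  rw [chord, norm_mul, norm_div, γ.unit_speed, norm_I]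
  simpa using γ.norm_toFun_sub_le (s + u) s

theorem chord_add_eq (s ε u : ℝ) : ε + γ.chord u s =
    I / deriv γ.toFun s * (γ.toFun (s + u) - γ.normalPoint s ε) := by
  have := γ.deriv_ne_zero s
  unfold chord normalPoint
  field_simp
  ring_nf
  rw [I_sq]
  ring

/-- The path `ε + chord` crosses the real axis only at `u = 0`, where it equals `ε`. Taking `κ` with
the sign of `ε` makes that crossing positive, so the principal logarithm is smooth along the whole
arc. -/
theorem IsScale.mem_slitPlane (h : γ.IsScale δ) {κ s ε u : ℝ} (hε : 0 < κ * ε) (hu : |u| ≤ δ) :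
    (κ : ℂ) * (ε + γ.chord u s) ∈ slitPlane := by
  have hκ : κ ≠ 0 := fun h0 => by simp [h0] at hε
  rcases lt_trichotomy u 0 with h0 | rfl | h0
  · refine Or.inr ?_
    have := h.im_chord_neg hu h0 s
    have h1 : (γ.chord u s).im ≠ 0 := by linarith
    simp [hκ, h1]
  · left
    simpa [chord_zero] using hε
  · refine Or.inr ?_
    have := h.im_chord_pos hu h0 s
    have h1 : (γ.chord u s).im ≠ 0 := by linarith
    simp [hκ, h1]

/-- Rotating by `I / γ'(s)` and scaling by `κ` does not change the logarithmic derivative, so the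
principal logarithm is a primitive. The side of the curve enters only through the sign `κ`. -/
theorem IsScale.logKernel_eq (h : γ.IsScale δ) {κ s ε : ℝ} (hε : 0 < κ * ε) :
    γ.logKernel δ s ε = log (κ * (ε + γ.chord δ s)) - log (κ * (ε + γ.chord (-δ) s)) := by
  have hκ : (κ : ℂ) ≠ 0 := fun h0 => by
    rw [ofReal_eq_zero] at h0
    simp [h0] at hε
  have hmem : ∀ u ∈ uIcc (-δ) δ, |u| ≤ δ := fun u hu => by
    rw [uIcc_of_le (by linarith [h.pos])] at hu
    exact abs_le.2 hu
  have hne : ∀ u ∈ uIcc (-δ) δ, γ.toFun (s + u) - γ.normalPoint s ε ≠ 0 := fun u hu h0 => by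
    have h1 := slitPlane_ne_zero (h.mem_slitPlane (s := s) hε (hmem u hu))
    rw [chord_add_eq, h0] at h1
    simp at h1
  rw [logKernel, ← intervalIntegral.integral_eq_sub_of_hasDerivAt
    (f := fun u => log (κ * (ε + γ.chord u s)))]
  · intro u hu
    have h1 := (((γ.hasDerivAt_chord u s).const_add (ε : ℂ)).const_mul (κ : ℂ)).clog_real
      (h.mem_slitPlane hε (hmem u hu))
    refine h1.congr_deriv ?_
    symm
    rw [chord_add_eq]
    have := γ.deriv_ne_zero s
    have := hne u hu
    have := I_ne_zero
    field_simp
  · refine ContinuousOn.intervalIntegrable ?_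
    have h1 := γ.continuous_toFun
    have h2 := γ.continuous_deriv
    exact (by fun_prop : Continuous fun u => deriv γ.toFun (s + u)).continuousOn.mul
      (ContinuousOn.inv₀ (by fun_prop) hne)

theorem norm_log_le_of_mem {w : ℂ} {a b : ℝ} (ha : 0 < a) (h1 : a ≤ ‖w‖) (h2 : ‖w‖ ≤ b) :
    ‖log w‖ ≤ |Real.log a| + |Real.log b| + Real.pi := by
  refine (norm_le_abs_re_add_abs_im _).trans ?_
  rw [log_re, log_im]
  have h3 := abs_arg_le_pi w
  have h4 : |Real.log ‖w‖| ≤ |Real.log a| + |Real.log b| := by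
    have h5 := Real.log_le_log ha h1
    have h6 := Real.log_le_log (ha.trans_le h1) h2
    rw [abs_le]
    constructor <;> linarith [neg_abs_le (Real.log a), le_abs_self (Real.log b),
      abs_nonneg (Real.log a), abs_nonneg (Real.log b)]
  linarith

/-- The two logarithms are taken at the ends of the arc, where the modulus lies between `9 δ / 10`
and `2` whatever `s` and `ε` are. The bound thus holds uniformly along an unbounded curve. -/
theorem IsScale.exists_norm_logKernel_le (h : γ.IsScale δ) :
    ∃ B, ∀ s ε : ℝ, ε ≠ 0 → |ε| ≤ 1 → ‖γ.logKernel δ s ε‖ ≤ B := by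
  refine ⟨2 * (|Real.log (9 / 10 * δ)| + |Real.log 2| + Real.pi), fun s ε hε hε1 => ?_⟩
  obtain ⟨κ, hκ, hκε⟩ : ∃ κ : ℝ, |κ| = 1 ∧ 0 < κ * ε := by
    rcases lt_or_gt_of_ne hε with h0 | h0
    · exact ⟨-1, by simp, by linarith⟩
    · exact ⟨1, by simp, by linarith⟩
  rw [h.logKernel_eq hκε, two_mul]
  have hp := h.pos
  have key : ∀ u : ℝ, |u| = δ → ‖log (κ * (ε + γ.chord u s))‖ ≤
      |Real.log (9 / 10 * δ)| + |Real.log 2| + Real.pi := fun u hu => by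
    have hn : ‖(κ : ℂ) * (ε + γ.chord u s)‖ = ‖ε + γ.chord u s‖ := by
      rw [norm_mul, norm_real, Real.norm_eq_abs, hκ, one_mul]
    refine norm_log_le_of_mem (by positivity) ?_ ?_ <;> rw [hn]
    · refine le_trans ?_ (abs_im_le_norm _)
      have h1 := abs_le.1 (h.abs_im_chord_sub_le hu.le s)
      simp only [add_im, ofReal_im, zero_add]
      rcases abs_eq hp.le |>.1 hu with rfl | rfl
      · rw [abs_of_pos hp] at h1
        exact le_trans (by linarith) (le_abs_self _)
      · rw [abs_neg, abs_of_pos hp] at h1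
        exact le_trans (by linarith) (neg_le_abs _)
    · refine (norm_add_le _ _).trans ?_
      have := norm_chord_le (γ := γ) u s
      rw [norm_real, Real.norm_eq_abs]
      linarith [h.le_one]
  refine (norm_sub_le _ _).trans (add_le_add (key _ (abs_of_pos hp)) (key _ ?_))
  rw [abs_neg, abs_of_pos hp]

theorem IsScale.tendsto_log_chord (h : γ.IsScale δ) {κ u t : ℝ} (hκ : κ ≠ 0) (hu : |u| = δ)
    {l : Filter ℝ} (hl : l ≤ 𝓝 0) :
    Tendsto (fun p : ℝ × ℝ => log (κ * (p.2 + γ.chord u p.1))) (𝓝 t ×ˢ l)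
      (𝓝 (log (κ * γ.chord u t))) := by
  have hp := h.pos
  have hc : ContinuousAt (fun p : ℝ × ℝ => log (κ * (p.2 + γ.chord u p.1))) (t, 0) := by
    refine ContinuousAt.clog ?_ ?_
    · have := γ.continuous_chord u
      fun_prop
    · right
      have h0 : (γ.chord u t).im ≠ 0 := by
        rcases abs_eq hp.le |>.1 hu with rfl | rfl
        · have := h.im_chord_pos hu.le hp t
          linarith
        · have := h.im_chord_neg hu.le (by linarith) t
          linarith
      simp [hκ, h0]
  have := hc.tendsto.mono_left (show 𝓝 t ×ˢ l ≤ 𝓝 (t, 0) by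
    rw [nhds_prod_eq]; exact prod_mono le_rfl hl)
  simpa using this

theorem IsScale.tendsto_logKernel (h : γ.IsScale δ) {κ t : ℝ} {l : Filter ℝ} (hl : l ≤ 𝓝 0)
    (hκ : ∀ᶠ ε in l, 0 < κ * ε) (hκ0 : κ ≠ 0) :
    Tendsto (fun p : ℝ × ℝ => γ.logKernel δ p.1 p.2) (𝓝 t ×ˢ l)
      (𝓝 (log (κ * γ.chord δ t) - log (κ * γ.chord (-δ) t))) := by
  refine ((h.tendsto_log_chord hκ0 (abs_of_pos h.pos) hl).sub
    (h.tendsto_log_chord hκ0 (by rw [abs_neg, abs_of_pos h.pos]) hl)).congr' ?_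
  filter_upwards [hκ.prod_inr (𝓝 t)] with p hp
  exact (h.logKernel_eq hp).symm

theorem log_sub_log_neg_of_im_pos {w : ℂ} (hw : 0 < w.im) : log w - log (-w) = Real.pi * I := by
  rw [log, log, norm_neg, arg_neg_eq_arg_sub_pi_of_im_pos hw]
  push_cast
  ring

/-- The logarithmic kernel jumps by `2πi` across the curve. -/
theorem IsScale.log_chord_jump (h : γ.IsScale δ) (t : ℝ) :
    (log (γ.chord δ t) - log (γ.chord (-δ) t)) -
      (log (-γ.chord δ t) - log (-γ.chord (-δ) t)) = 2 * Real.pi * I := by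
  have hp := h.pos
  have h1 := log_sub_log_neg_of_im_pos (w := γ.chord δ t)
    (by have := h.im_chord_pos (abs_of_pos hp).le hp t; linarith)
  have h2 := log_sub_log_neg_of_im_pos (w := -γ.chord (-δ) t) (by
    have := h.im_chord_neg (u := -δ) (by rw [abs_neg, abs_of_pos hp]) (by linarith) t
    rw [neg_im]; linarith)
  rw [neg_neg] at h2
  linear_combination h1 + h2

end SmoothCurve

/-! ### Boundary values of Cauchy integrals: near part, far part, logarithm. -/

namespace SmoothCurve

variable (γ : SmoothCurve) {δ : ℝ}

/-- The Cauchy integral `∫ g(t) dγ(t) / (γ(t) - z)` of a density on the parameter line. -/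
noncomputable def cauchyIntegral (g : ℝ → ℂ) (z : ℂ) : ℂ :=
  ∫ t, deriv γ.toFun t * ((γ.toFun t - z)⁻¹ * g t)

/-- The part of the Cauchy integral at a point of the normal at `γ(s)` that stays regular. -/
noncomputable def nearPart (g : ℝ → ℂ) (ρ : ℝ) (p : ℝ × ℝ) : ℂ :=
  ∫ u in -ρ..ρ, deriv γ.toFun (p.1 + u) *
    ((γ.toFun (p.1 + u) - γ.normalPoint p.1 p.2)⁻¹ * (g (p.1 + u) - g p.1))

/-- The part of the Cauchy integral away from the foot of the normal. -/
noncomputable def farPart (g : ℝ → ℂ) (ρ : ℝ) (p : ℝ × ℝ) : ℂ :=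
  ∫ t, {t | ρ < |t - p.1|}.indicator (fun t => deriv γ.toFun t *
    ((γ.toFun t - γ.normalPoint p.1 p.2)⁻¹ * g t)) t

variable {γ}

theorem IsScale.norm_near_integrand_le (h : γ.IsScale δ) {g : ℝ → ℂ} {s : ℝ} {α C : ℝ}
    (hC : 0 ≤ C) {u : ℝ} (hu : |u| ≤ δ)
    (hg : ‖g (s + u) - g s‖ ≤ C * |u| ^ α) (ε : ℝ) :
    ‖deriv γ.toFun (s + u) *
      ((γ.toFun (s + u) - γ.normalPoint s ε)⁻¹ * (g (s + u) - g s))‖ ≤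
      10 / 9 * C * |u| ^ (α - 1) := by
  rw [norm_mul, γ.unit_speed, one_mul, norm_mul, norm_inv]
  rcases eq_or_ne u 0 with rfl | hu0
  · simp only [add_zero, sub_self, norm_zero, mul_zero]
    positivity
  · have h1 := (h.abs_le_norm_sub_normalPoint (s := s) (t := s + u) (by simpa using hu) ε).1
    rw [add_sub_cancel_left] at h1
    have h2 : 0 < |u| := abs_pos.2 hu0
    rw [Real.rpow_sub_one h2.ne']
    calc _ ≤ (9 / 10 * |u|)⁻¹ * (C * |u| ^ α) := by gcongr
      _ = _ := by field_simp

theorem measurable_inv_sub (z : ℂ) : Measurable fun t => (γ.toFun t - z)⁻¹ :=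
  (γ.continuous_toFun.measurable.sub_const z).inv

theorem aestronglyMeasurable_integrand {g : ℝ → ℂ} {μ : Measure ℝ}
    (hg : AEStronglyMeasurable g μ) (z : ℂ) :
    AEStronglyMeasurable (fun t => deriv γ.toFun t * ((γ.toFun t - z)⁻¹ * g t)) μ :=
  γ.continuous_deriv.aestronglyMeasurable.mul
    ((measurable_inv_sub z).aestronglyMeasurable.mul hg)

theorem aestronglyMeasurable_near {g : ℝ → ℂ} (hg : Integrable g) (s : ℝ) (z : ℂ) (S : Set ℝ) :
    AEStronglyMeasurable (fun u => deriv γ.toFun (s + u) *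
      ((γ.toFun (s + u) - z)⁻¹ * (g (s + u) - g s))) (volume.restrict S) := by
  have h1 : Continuous fun u => deriv γ.toFun (s + u) := by
    have := γ.continuous_deriv
    fun_prop
  refine h1.aestronglyMeasurable.mul (AEStronglyMeasurable.mul ?_ ?_)
  · exact ((measurable_inv_sub z).comp (measurable_const_add s)).aestronglyMeasurable
  · exact ((hg.comp_add_left s).aestronglyMeasurable.restrict).sub aestronglyMeasurable_const

/-- Dominated convergence: the Hölder condition cancels the pole down to `|u| ^ (α - 1)`, integrable
and independent of the height `ε`. The margin `2 δ < η` keeps both `s` and `s + u` in the Hölder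
neighbourhood for `|s - t₀| < δ`. -/
theorem IsScale.continuousAt_nearPart (h : γ.IsScale δ) {g : ℝ → ℂ} (hg : Integrable g)
    {t₀ α C η : ℝ} (hα : 0 < α) (hC : 0 ≤ C) (hη : 2 * δ < η)
    (hloc : ∀ s t : ℝ, |s - t₀| ≤ η → |t - t₀| ≤ η → ‖g s - g t‖ ≤ C * |s - t| ^ α)
    (hcont : ∀ t, |t - t₀| < η → ContinuousAt g t) :
    ContinuousAt (γ.nearPart g δ) (t₀, 0) := by
  have hp := h.pos
  have hmem : ∀ u ∈ uIoc (-δ) δ, |u| ≤ δ := fun u hu => by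
    rw [uIoc_of_le (by linarith)] at hu
    exact abs_le.2 ⟨hu.1.le, hu.2⟩
  refine intervalIntegral.tendsto_integral_filter_of_dominated_convergence
    (fun u => 10 / 9 * C * |u| ^ (α - 1)) ?_ ?_ ?_ ?_
  · exact Eventually.of_forall fun p => aestronglyMeasurable_near hg _ _ _
  · have : ∀ᶠ p : ℝ × ℝ in 𝓝 (t₀, 0), |p.1 - t₀| < δ :=
      (show ContinuousAt (fun p : ℝ × ℝ => |p.1 - t₀|) (t₀, 0) by fun_prop).eventually_lt
        continuousAt_const (by simpa using hp)
    filter_upwards [this] with p hp'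
    refine Eventually.of_forall fun u hu => h.norm_near_integrand_le hC (hmem u hu) ?_ _
    have h1 := abs_le.1 hp'.le
    have h2 := abs_le.1 (hmem u hu)
    have := hloc (p.1 + u) p.1 (abs_le.2 ⟨by linarith, by linarith⟩)
      (abs_le.2 ⟨by linarith, by linarith⟩)
    simpa using this
  · exact (intervalIntegrable_abs_rpow (by linarith) δ).const_mul _
  · refine Eventually.of_forall fun u hu => ?_
    rcases eq_or_ne u 0 with rfl | hu0
    · simp
    have hu' := hmem u hu
    have h1 : ContinuousAt g (t₀ + u) := hcont _ (by rw [add_sub_cancel_left]; linarith)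
    have h2 : ContinuousAt g t₀ := hcont _ (by simp; linarith)
    have h3 : γ.toFun (t₀ + u) - γ.normalPoint t₀ 0 ≠ 0 := fun h0 => by
      have h4 := (h.abs_le_norm_sub_normalPoint (s := t₀) (t := t₀ + u) (by simpa using hu') 0).1
      rw [h0, norm_zero, add_sub_cancel_left] at h4
      have := abs_pos.2 hu0
      linarith
    have hd := γ.continuous_deriv
    have hf := γ.continuous_toFun
    have hn := γ.continuous_normalPoint
    have hfst : Tendsto (fun p : ℝ × ℝ => p.1 + u) (𝓝 (t₀, 0)) (𝓝 (t₀ + u)) :=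
      (continuous_fst.add_const u).tendsto (t₀, (0 : ℝ))
    refine ((hd.tendsto _).comp hfst).mul (Tendsto.mul (Tendsto.inv₀ ?_ h3) (Tendsto.sub ?_ ?_))
    · exact ((hf.tendsto _).comp hfst).sub (hn.tendsto (t₀, 0))
    · exact h1.tendsto.comp hfst
    · exact h2.tendsto.comp (continuous_fst.tendsto (t₀, (0 : ℝ)))

theorem IsChart.eventually_le_norm_sub {t₀ : ℝ} {D : Set ℝ} (hD : γ.IsChart t₀ D) (hδ : 0 < δ) :
    ∃ c > 0, ∀ᶠ p : ℝ × ℝ in 𝓝 (t₀, 0), ∀ t ∈ D, δ < |t - p.1| →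
      c ≤ ‖γ.toFun t - γ.normalPoint p.1 p.2‖ := by
  obtain ⟨c, hc, h⟩ := hD.exists_le_norm_sub (half_pos hδ)
  refine ⟨c / 2, half_pos hc, ?_⟩
  have h1 : ∀ᶠ p : ℝ × ℝ in 𝓝 (t₀, 0), |p.1 - t₀| < δ / 2 :=
    (show ContinuousAt (fun p : ℝ × ℝ => |p.1 - t₀|) (t₀, 0) by fun_prop).eventually_lt
      continuousAt_const (by simpa using hδ)
  have h2 : ∀ᶠ p : ℝ × ℝ in 𝓝 (t₀, 0), ‖γ.normalPoint p.1 p.2 - γ.toFun t₀‖ < c / 2 := by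
    have := γ.continuous_normalPoint
    exact (show ContinuousAt (fun p : ℝ × ℝ => ‖γ.normalPoint p.1 p.2 - γ.toFun t₀‖) (t₀, 0) by
      fun_prop).eventually_lt continuousAt_const (by simpa using hc)
  filter_upwards [h1, h2] with p hp1 hp2 t ht htp
  have h3 := h t ht (by have := abs_sub_le t t₀ p.1; rw [abs_sub_comm t₀] at this; linarith)
  have h4 := norm_sub_le_norm_sub_add_norm_sub (γ.toFun t) (γ.normalPoint p.1 p.2) (γ.toFun t₀)
  linarith

/-- Away from the foot the kernel is bounded by simplicity of the curve, so a multiple of `‖g‖`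
dominates. -/
theorem IsChart.continuousAt_farPart {t₀ : ℝ} {D : Set ℝ} (hD : γ.IsChart t₀ D) (hδ : 0 < δ)
    {g : ℝ → ℂ} (hg : Integrable g) (hsupp : ∀ t ∉ D, g t = 0) :
    ContinuousAt (γ.farPart g δ) (t₀, 0) := by
  obtain ⟨c, hc, hev⟩ := hD.eventually_le_norm_sub hδ
  have hms : ∀ s : ℝ, MeasurableSet {t : ℝ | δ < |t - s|} := fun s =>
    (isOpen_lt continuous_const (by fun_prop)).measurableSet
  refine tendsto_integral_filter_of_dominated_convergence (fun t => c⁻¹ * ‖g t‖) ?_ ?_ ?_ ?_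
  · exact Eventually.of_forall fun p =>
      (aestronglyMeasurable_integrand hg.aestronglyMeasurable _).indicator (hms _)
  · filter_upwards [hev] with p hp
    refine Eventually.of_forall fun t => ?_
    by_cases ht : t ∈ {t : ℝ | δ < |t - p.1|}
    · rw [indicator_of_mem ht, norm_mul, γ.unit_speed, one_mul, norm_mul, norm_inv]
      by_cases htD : t ∈ D
      · have := hp t htD ht
        gcongr
      · simp [hsupp t htD]
    · rw [indicator_of_notMem ht, norm_zero]
      positivity
  · exact hg.norm.const_mul _
  -- The cut-off moves with the foot. Only at the two cut parameters can the integrand fail to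
  -- converge.
  · have hae : ∀ᵐ t : ℝ, t ∉ ({t₀ + δ, t₀ - δ} : Set ℝ) :=
      measure_eq_zero_iff_ae_notMem.1 ((toFinite _).measure_zero _)
    filter_upwards [hae] with t ht
    have hne : |t - t₀| ≠ δ := fun h0 => ht <| by
      rcases abs_eq hδ.le |>.1 h0 with h1 | h1
      · left; linarith
      · right; rw [mem_singleton_iff]; linarith
    have hca : ContinuousAt (fun p : ℝ × ℝ => |t - p.1|) (t₀, 0) := by fun_prop
    rcases lt_or_gt_of_ne hne with hlt | hlt
    · rw [indicator_of_notMem (by simpa using hlt.le)]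
      refine tendsto_const_nhds.congr' ?_
      filter_upwards [hca.eventually_lt continuousAt_const hlt] with p hp
      rw [indicator_of_notMem (by simpa using hp.le)]
    · rw [indicator_of_mem (by simpa using hlt)]
      have hev' : (fun p : ℝ × ℝ => deriv γ.toFun t *
          ((γ.toFun t - γ.normalPoint p.1 p.2)⁻¹ * g t)) =ᶠ[𝓝 (t₀, 0)]
          fun p => {t | δ < |t - p.1|}.indicator (fun t => deriv γ.toFun t *
            ((γ.toFun t - γ.normalPoint p.1 p.2)⁻¹ * g t)) t := by
        filter_upwards [continuousAt_const.eventually_lt hca hlt] with p hp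
        rw [indicator_of_mem (by simpa using hp)]
      refine Tendsto.congr' hev' ?_
      by_cases htD : t ∈ D
      · have h3 : γ.toFun t - γ.normalPoint t₀ 0 ≠ 0 := fun h0 => by
          rw [normalPoint_zero] at h0
          rw [hD.eq_of_eq t htD (sub_eq_zero.1 h0)] at hlt
          simp at hlt
          linarith
        exact tendsto_const_nhds.mul ((Tendsto.inv₀ (tendsto_const_nhds.sub
          (γ.continuous_normalPoint.tendsto (t₀, 0))) h3).mul tendsto_const_nhds)
      · simp [hsupp t htD]

/-- On the arc within `δ` of the foot, `g(s + u)` is split as `(g(s + u) - g(s)) + g(s)`. The second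
summand is integrable when `z` is off the arc (`ε ≠ 0`), or trivially when `g(s) = 0`. The latter
case covers prolongations of the curve beyond an endpoint. -/
theorem IsScale.cauchyIntegral_eq (h : γ.IsScale δ) {g : ℝ → ℂ} (hg : Integrable g)
    {s ε : ℝ} {D : Set ℝ} (hsupp : ∀ t ∉ D, g t = 0) {c : ℝ} (hc : 0 < c)
    (hfar : ∀ t ∈ D, δ < |t - s| → c ≤ ‖γ.toFun t - γ.normalPoint s ε‖)
    {α C : ℝ} (hα : 0 < α) (hC : 0 ≤ C) (hloc : ∀ u : ℝ, |u| ≤ δ → ‖g (s + u) - g s‖ ≤ C * |u| ^ α)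
    (hε : ε ≠ 0 ∨ g s = 0) :
    γ.cauchyIntegral g (γ.normalPoint s ε) =
      γ.nearPart g δ (s, ε) + γ.farPart g δ (s, ε) + g s * γ.logKernel δ s ε := by
  have hp := h.pos
  have hle : -δ ≤ δ := by linarith
  set z := γ.normalPoint s ε with hz
  set G : ℝ → ℂ := fun t => deriv γ.toFun t * ((γ.toFun t - z)⁻¹ * g t) with hG
  have hmem : ∀ u ∈ uIoc (-δ) δ, |u| ≤ δ := fun u hu => by
    rw [uIoc_of_le hle] at hu
    exact abs_le.2 ⟨hu.1.le, hu.2⟩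
  have i1 : IntervalIntegrable (fun u => deriv γ.toFun (s + u) *
      ((γ.toFun (s + u) - z)⁻¹ * (g (s + u) - g s))) volume (-δ) δ := by
    refine IntervalIntegrable.mono_fun'
      ((intervalIntegrable_abs_rpow (r := α - 1) (by linarith) δ).const_mul (10 / 9 * C))
      (aestronglyMeasurable_near hg _ _ _) ?_
    refine (ae_restrict_iff' measurableSet_uIoc).2 (Eventually.of_forall fun u hu => ?_)
    exact h.norm_near_integrand_le hC (hmem u hu) (hloc u (hmem u hu)) ε
  have i2 : IntervalIntegrable (fun u => g s * (deriv γ.toFun (s + u) *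
      (γ.toFun (s + u) - z)⁻¹)) volume (-δ) δ := by
    rcases hε with hε | hε
    · refine (ContinuousOn.intervalIntegrable ?_).const_mul _
      have h1 := γ.continuous_toFun
      have h2 := γ.continuous_deriv
      refine (by fun_prop : Continuous fun u => deriv γ.toFun (s + u)).continuousOn.mul
        (ContinuousOn.inv₀ (by fun_prop) fun u hu h0 => ?_)
      rw [uIcc_of_le hle] at hu
      have h4 := (h.abs_le_norm_sub_normalPoint (s := s) (t := s + u)
        (by simpa using abs_le.2 hu) ε).2
      rw [← hz, h0, norm_zero] at h4
      have := abs_pos.2 hε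
      linarith
    · simp [hε]
  have hsum : ∀ u, G (s + u) = deriv γ.toFun (s + u) *
      ((γ.toFun (s + u) - z)⁻¹ * (g (s + u) - g s)) + g s * (deriv γ.toFun (s + u) *
      (γ.toFun (s + u) - z)⁻¹) := fun u => by rw [hG]; ring
  have i3 : IntervalIntegrable (fun u => G (s + u)) volume (-δ) δ := by
    simp_rw [hsum]
    exact i1.add i2
  have i4 : IntervalIntegrable G volume (s - δ) (s + δ) := by
    have := i3.comp_sub_right s
    simp only [add_sub_cancel] at this
    convert this using 1 <;> ring
  have hset : {t : ℝ | δ < |t - s|}ᶜ = Icc (s - δ) (s + δ) := by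
    ext t
    simp only [mem_compl_iff, mem_ofPred_eq, not_lt, mem_Icc, abs_le]
    constructor <;> intro h <;> constructor <;> linarith [h.1, h.2]
  have hms : MeasurableSet {t : ℝ | δ < |t - s|} :=
    (isOpen_lt continuous_const (by fun_prop)).measurableSet
  have i5 : IntegrableOn G {t : ℝ | δ < |t - s|} := by
    refine Integrable.mono' (hg.norm.const_mul c⁻¹).integrableOn
      (aestronglyMeasurable_integrand hg.aestronglyMeasurable _).restrict ?_
    refine (ae_restrict_iff' hms).2 (Eventually.of_forall fun t ht => ?_)
    rw [hG, norm_mul, γ.unit_speed, one_mul, norm_mul, norm_inv]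
    by_cases htD : t ∈ D
    · have := hfar t htD ht
      gcongr
    · simp [hsupp t htD]
  have i6 : IntegrableOn G {t : ℝ | δ < |t - s|}ᶜ := by
    rw [hset]
    exact (intervalIntegrable_iff_integrableOn_Icc_of_le (by linarith)).1 i4
  have i7 : Integrable G := by
    rw [← integrableOn_univ, ← union_compl_self {t : ℝ | δ < |t - s|}]
    exact i5.union i6
  have e1 : ∫ t in {t : ℝ | δ < |t - s|}ᶜ, G t =
      γ.nearPart g δ (s, ε) + g s * γ.logKernel δ s ε := by
    rw [hset, integral_Icc_eq_integral_Ioc, ← intervalIntegral.integral_of_le (by linarith),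
      sub_eq_add_neg, ← intervalIntegral.integral_comp_add_left, nearPart, logKernel,
      ← intervalIntegral.integral_const_mul, ← intervalIntegral.integral_add i1 i2]
    simp_rw [hsum]
  have e2 : ∫ t in {t : ℝ | δ < |t - s|}, G t = γ.farPart g δ (s, ε) := by
    rw [← integral_indicator hms]; rfl
  rw [cauchyIntegral, ← integral_add_compl hms i7, e1, e2]
  ring

/-- Decomposition of the Cauchy integral near a point of the curve. -/
theorem IsChart.exists_regularPart {t₀ : ℝ} {D : Set ℝ} (hD : γ.IsChart t₀ D)
    {g : ℝ → ℂ} (hg : Integrable g) (hsupp : ∀ t ∉ D, g t = 0) (hloc : HolderNear g t₀) :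
    ∃ (ρ : ℝ) (R : ℝ × ℝ → ℂ), γ.IsScale ρ ∧ ContinuousAt R (t₀, 0) ∧
      ∀ᶠ p : ℝ × ℝ in 𝓝 (t₀, 0), (p.2 ≠ 0 ∨ g p.1 = 0) →
        γ.cauchyIntegral g (γ.normalPoint p.1 p.2) = R p + g p.1 * γ.logKernel ρ p.1 p.2 := by
  obtain ⟨η', hη', hcont⟩ := hloc.continuousAt
  obtain ⟨α, hα, C, hC, η, hη, hloc⟩ := hloc
  obtain ⟨δ, hδ⟩ := γ.exists_isScale
  have hδ0 := hδ.pos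
  set η'' := min η η' with hη''
  have hpos : 0 < min δ (η'' / 3) := by positivity
  have hρ := hδ.mono hpos (min_le_left _ _)
  set ρ := min δ (η'' / 3)
  have h2ρ : 2 * ρ < η'' := by
    have : ρ ≤ η'' / 3 := min_le_right _ _
    have : 0 < η'' := by positivity
    linarith
  have hloc' : ∀ s t : ℝ, |s - t₀| ≤ η'' → |t - t₀| ≤ η'' → ‖g s - g t‖ ≤ C * |s - t| ^ α :=
    fun s t hs ht => hloc s t (hs.trans (min_le_left _ _)) (ht.trans (min_le_left _ _))
  obtain ⟨c, hc, hfar⟩ := hD.eventually_le_norm_sub hpos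
  refine ⟨ρ, fun p => γ.nearPart g ρ p + γ.farPart g ρ p, hρ, ?_, ?_⟩
  · exact (hρ.continuousAt_nearPart hg hα hC h2ρ hloc'
      fun t ht => hcont t (ht.trans_le (min_le_right _ _))).add
      (hD.continuousAt_farPart hpos hg hsupp)
  · have : ∀ᶠ p : ℝ × ℝ in 𝓝 (t₀, 0), |p.1 - t₀| < ρ :=
      (show ContinuousAt (fun p : ℝ × ℝ => |p.1 - t₀|) (t₀, 0) by fun_prop).eventually_lt
        continuousAt_const (by simpa using hpos)
    filter_upwards [this, hfar] with p hp1 hp2 hp3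
    refine hρ.cauchyIntegral_eq hg hsupp hc hp2 hα hC (fun u hu => ?_) hp3
    have h1 := abs_le.1 hp1.le
    have h2 := abs_le.1 hu
    have := hloc' (p.1 + u) p.1 (abs_le.2 ⟨by linarith, by linarith⟩)
      (abs_le.2 ⟨by linarith, by linarith⟩)
    simpa using this

/-- The Sokhotski--Plemelj formula. -/
theorem IsChart.exists_boundaryValue {t₀ : ℝ} {D : Set ℝ} (hD : γ.IsChart t₀ D)
    {g : ℝ → ℂ} (hg : Integrable g) (hsupp : ∀ t ∉ D, g t = 0) (hloc : HolderNear g t₀) :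
    ∃ Vp Vm, γ.PosBoundaryValue (γ.cauchyIntegral g) t₀ Vp ∧
      γ.NegBoundaryValue (γ.cauchyIntegral g) t₀ Vm ∧ Vp = Vm + 2 * Real.pi * I * g t₀ := by
  obtain ⟨η, hη, hcont⟩ := hloc.continuousAt
  obtain ⟨ρ, R, hρ, hR, hev⟩ := hD.exists_regularPart hg hsupp hloc
  have hg0 : ContinuousAt g t₀ := hcont t₀ (by simpa using hη)
  -- Both sides at once: `κ = 1` for `ε → 0⁺` and `κ = -1` for `ε → 0⁻`. The regular part has the
  -- same limit in both, so only the logarithms contribute to the jump.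
  have key : ∀ (κ : ℝ) (l : Filter ℝ), l ≤ 𝓝 0 → (∀ᶠ ε in l, 0 < κ * ε) → κ ≠ 0 →
      Tendsto (fun p : ℝ × ℝ => γ.cauchyIntegral g (γ.normalPoint p.1 p.2)) (𝓝 t₀ ×ˢ l)
      (𝓝 (R (t₀, 0) + g t₀ * (log (κ * γ.chord ρ t₀) - log (κ * γ.chord (-ρ) t₀)))) := by
    intro κ l hl hκ hκ0
    have hle : 𝓝 t₀ ×ˢ l ≤ 𝓝 (t₀, 0) := by
      rw [nhds_prod_eq]; exact prod_mono le_rfl hl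
    refine ((hR.tendsto.mono_left hle).add ((hg0.tendsto.comp tendsto_fst).mul
      (hρ.tendsto_logKernel hl hκ hκ0))).congr' ?_
    filter_upwards [hle hev, hκ.prod_inr (𝓝 t₀)] with p hp1 hp2
    exact (hp1 (Or.inl fun h0 => by simp [h0] at hp2)).symm
  refine ⟨_, _, key 1 (𝓝[>] 0) nhdsWithin_le_nhds ?_ one_ne_zero,
    key (-1) (𝓝[<] 0) nhdsWithin_le_nhds ?_ (by norm_num), ?_⟩
  · filter_upwards [self_mem_nhdsWithin] with ε hε
    simpa using hε
  · filter_upwards [self_mem_nhdsWithin] with ε hε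
    simpa using hε
  · have := hρ.log_chord_jump t₀
    push_cast
    simp only [one_mul, neg_mul]
    linear_combination g t₀ * this

/-- Points off the curve near `γ(t₀)` have normal coordinates near `(t₀, 0)`. -/
theorem le_map_normalPoint (t₀ : ℝ) :
    𝓝 (γ.toFun t₀) ≤ Filter.map (fun p : ℝ × ℝ => γ.normalPoint p.1 p.2) (𝓝 (t₀, 0)) := by
  intro S hS
  rw [Filter.mem_map, Metric.mem_nhds_iff] at hS
  obtain ⟨r, hr, hsub⟩ := hS
  obtain ⟨δ, hδ⟩ := γ.exists_isScale
  have hδ0 := hδ.pos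
  have hball := Metric.ball_mem_nhds (γ.toFun t₀) (ε := min (9 / 10 * δ) (9 / 10 * r)) (by positivity)
  filter_upwards [hball] with z hz
  rw [Metric.mem_ball, dist_eq_norm, lt_min_iff] at hz
  obtain ⟨s, ε, rfl, h1, h2⟩ := hδ.exists_eq_normalPoint hz.1
  have : ((s, ε) : ℝ × ℝ) ∈ Metric.ball (t₀, (0 : ℝ)) r := by
    rw [Metric.mem_ball, Prod.dist_eq, max_lt_iff, Real.dist_eq, Real.dist_eq, sub_zero]
    constructor <;> linarith
  exact hsub this

/-- At a point where the density vanishes its Cauchy integral extends continuously. -/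
theorem IsChart.exists_tendsto {t₀ : ℝ} {D : Set ℝ} (hD : γ.IsChart t₀ D)
    {g : ℝ → ℂ} (hg : Integrable g) (hsupp : ∀ t ∉ D, g t = 0) (hloc : HolderNear g t₀)
    (h0 : g t₀ = 0) : ∃ V, Tendsto (γ.cauchyIntegral g) (𝓝[γ.imageᶜ] (γ.toFun t₀)) (𝓝 V) := by
  obtain ⟨η, hη, hcont⟩ := hloc.continuousAt
  obtain ⟨ρ, R, hρ, hR, hev⟩ := hD.exists_regularPart hg hsupp hloc
  have hg0 : ContinuousAt g t₀ := hcont t₀ (by simpa using hη)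
  obtain ⟨B, hB⟩ := hρ.exists_norm_logKernel_le
  refine ⟨R (t₀, 0), fun S hS => ?_⟩
  -- A factor tending to zero times a bounded one. The bound on the kernel is available only for `ε
  -- ≠ 0`, so the product is set to zero at `ε = 0`.
  have hgL : Tendsto (fun p : ℝ × ℝ => if p.2 = 0 then 0 else g p.1 * γ.logKernel ρ p.1 p.2)
      (𝓝 (t₀, 0)) (𝓝 0) := by
    have h1 : Tendsto (fun p : ℝ × ℝ => ‖g p.1‖ * |B|) (𝓝 (t₀, 0)) (𝓝 0) := by
      have := (hg0.tendsto.comp (continuous_fst.tendsto (t₀, (0 : ℝ)))).norm.mul_const |B|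
      simpa [h0] using this
    refine squeeze_zero_norm' ?_ h1
    have : ∀ᶠ p : ℝ × ℝ in 𝓝 (t₀, 0), |p.2| < 1 :=
      (show ContinuousAt (fun p : ℝ × ℝ => |p.2|) (t₀, 0) by fun_prop).eventually_lt
        continuousAt_const (by simp)
    filter_upwards [this] with p hp
    split_ifs with hp0
    · simp; positivity
    · rw [norm_mul]
      gcongr
      exact (hB p.1 p.2 hp0 hp.le).trans (le_abs_self B)
  have h2 := hR.tendsto.add hgL
  rw [add_zero] at h2
  have h3 : ∀ᶠ p : ℝ × ℝ in 𝓝 (t₀, 0), γ.normalPoint p.1 p.2 ∈ γ.imageᶜ →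
      γ.cauchyIntegral g (γ.normalPoint p.1 p.2) ∈ S := by
    filter_upwards [hev, h2 hS] with p hp1 hp2 hp3
    rcases eq_or_ne p.2 0 with hp0 | hp0
    -- Height zero for a point off the curve means that the foot is a parameter outside `D`, where
    -- the density is zero.
    · have hgp : g p.1 = 0 := hsupp _ fun hmem => hp3 <| by
        rw [hp0, normalPoint_zero, ← hD.image_eq]
        exact mem_image_of_mem _ hmem
      rw [hp1 (Or.inr hgp), hgp, zero_mul]
      simpa [hp0] using hp2
    · rw [hp1 (Or.inl hp0)]
      simpa [hp0] using hp2
  exact mem_nhdsWithin_iff_eventually.2 (le_map_normalPoint t₀ h3)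

end SmoothCurve

/-! ### A uniform bound for densities supported on a short arc. -/

namespace SmoothCurve

variable {γ : SmoothCurve} {δ : ℝ}

/-- A Cauchy integral over a short arc is bounded by the Hölder norm of the density. -/
theorem IsScale.exists_norm_cauchyIntegral_le (h : γ.IsScale δ) {α : ℝ} (hα : 0 < α) :
    ∃ B ≥ 0, ∀ (g : ℝ → ℂ) (c K : ℝ) (z : ℂ), Integrable g → 0 ≤ K →
      (∀ t, t ∉ Icc (c - δ / 4) (c + δ / 4) → g t = 0) → (∀ t, ‖g t‖ ≤ K) →
      (∀ s t, |s - t| ≤ 1 → ‖g s - g t‖ ≤ K * |s - t| ^ α) → (∀ t, γ.toFun t = z → g t = 0) →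
      ‖γ.cauchyIntegral g z‖ ≤ B * K := by
  have hp := h.pos
  obtain ⟨B, hB⟩ := h.exists_norm_logKernel_le
  have hI : 0 ≤ ∫ u in -δ..δ, |u| ^ (α - 1) :=
    intervalIntegral.integral_nonneg (by linarith) fun u _ => by positivity
  -- If `z` is at distance at least `δ / 10` from the arc of length `δ / 2`, the integral is at most
  -- `(10 / δ)(δ / 2) K = 5 K`. Otherwise `z` has a foot so close to the arc that the whole support
  -- is within `δ` of it. The far part then vanishes, and the other two terms bound the near part
  -- and the logarithm.
  refine ⟨5 + 10 / 9 * (∫ u in -δ..δ, |u| ^ (α - 1)) + |B|, by positivity,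
    fun g c K z hg hK hsupp hsup hloc hz => ?_⟩
  by_cases hfar : ∀ t ∈ Icc (c - δ / 4) (c + δ / 4), δ / 10 ≤ ‖z - γ.toFun t‖
  · rw [cauchyIntegral, ← setIntegral_eq_integral_of_forall_compl_eq_zero
      (s := Icc (c - δ / 4) (c + δ / 4)) fun t ht => by rw [hsupp t ht]; simp]
    have := norm_setIntegral_le_of_norm_le_const (μ := volume) (C := (δ / 10)⁻¹ * K)
      (s := Icc (c - δ / 4) (c + δ / 4))
      (f := fun t => deriv γ.toFun t * ((γ.toFun t - z)⁻¹ * g t))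
      (by simp) (fun t ht => by
        rw [norm_mul, γ.unit_speed, one_mul, norm_mul, norm_inv, norm_sub_rev]
        have h1 := hfar t ht
        have h2 := hsup t
        gcongr)
    refine this.trans ?_
    rw [measureReal_def, Real.volume_Icc, ENNReal.toReal_ofReal (by linarith)]
    have e : (δ / 10)⁻¹ * K * (c + δ / 4 - (c - δ / 4)) = 5 * K := by field_simp; ring
    rw [e]
    gcongr
    have := abs_nonneg B
    linarith
  · push Not at hfar
    obtain ⟨t, ht, htz⟩ := hfar
    obtain ⟨s, ε, rfl, h1, h2⟩ := h.exists_eq_normalPoint (t := t) (z := z) (by linarith)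
    have hst : |s - t| ≤ δ / 9 := by linarith
    have hε1 : |ε| ≤ 1 := by linarith [h.le_one]
    have hno : ∀ t' ∈ Icc (c - δ / 4) (c + δ / 4), ¬ δ < |t' - s| := fun t' ht' hlt => by
      have h3 := abs_le.1 hst
      refine absurd (abs_le.2 ⟨?_, ?_⟩ : |t' - s| ≤ δ) (not_le.2 hlt) <;>
      linarith [ht'.1, ht'.2, ht.1, ht.2]
    have hloc' : ∀ u : ℝ, |u| ≤ δ → ‖g (s + u) - g s‖ ≤ K * |u| ^ α := fun u hu => by
      have := hloc (s + u) s (by simpa using hu.trans h.le_one)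
      simpa using this
    have hε : ε ≠ 0 ∨ g s = 0 := by
      rw [or_iff_not_imp_left, not_not]
      rintro rfl
      exact hz s (by simp)
    rw [h.cauchyIntegral_eq hg hsupp one_pos (fun t' ht' hlt => absurd hlt (hno t' ht')) hα hK
      hloc' hε]
    have e1 : γ.farPart g δ (s, ε) = 0 := by
      rw [farPart]
      refine integral_eq_zero_of_ae (Eventually.of_forall fun t' => ?_)
      by_cases hmem : t' ∈ Icc (c - δ / 4) (c + δ / 4)
      · exact indicator_of_notMem (s := {t | δ < |t - s|}) (hno t' hmem) _
      · simp [indicator_apply, hsupp t' hmem]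
    have e2 : ‖γ.nearPart g δ (s, ε)‖ ≤ 10 / 9 * K * ∫ u in -δ..δ, |u| ^ (α - 1) := by
      rw [← intervalIntegral.integral_const_mul]
      refine intervalIntegral.norm_integral_le_of_norm_le (by linarith)
        (Eventually.of_forall fun u hu => ?_)
        ((intervalIntegrable_abs_rpow (by linarith) δ).const_mul _)
      have hu' : |u| ≤ δ := abs_le.2 ⟨hu.1.le, hu.2⟩
      exact h.norm_near_integrand_le hK hu' (hloc' u hu') ε
    have e3 : ‖g s * γ.logKernel δ s ε‖ ≤ K * |B| := by
      rw [norm_mul]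
      rcases hε with hε | hε
      · have h4 := hsup s
        have h5 := (hB s ε hε hε1).trans (le_abs_self B)
        gcongr
      · rw [hε, norm_zero, zero_mul]
        positivity
    rw [e1, add_zero]
    refine (norm_add_le _ _).trans ?_
    nlinarith

end SmoothCurve

/-! ### Rapid decrease from Hölder continuity and finite moments. -/

/-- Functions on the line that are, with a Hölder modulus at unit scale, rapidly decreasing. -/
def DecayHolder (g : ℝ → ℂ) : Prop :=
  ∃ α : ℝ, 0 < α ∧ α ≤ 1 ∧ ∀ M : ℕ, ∃ C ≥ 0, ∀ t : ℝ, (1 + |t|) ^ M * ‖g t‖ ≤ C ∧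
    ∀ s, |s - t| ≤ 1 → (1 + |t|) ^ M * ‖g s - g t‖ ≤ C * |s - t| ^ α

namespace DecayHolder

theorem add {f g : ℝ → ℂ} (hf : DecayHolder f) (hg : DecayHolder g) :
    DecayHolder fun t => f t + g t := by
  obtain ⟨α, hα, hα1, hf⟩ := hf
  obtain ⟨β, hβ, hβ1, hg⟩ := hg
  refine ⟨min α β, lt_min hα hβ, (min_le_left _ _).trans hα1, fun M => ?_⟩
  obtain ⟨C, hC, hf⟩ := hf M
  obtain ⟨C', hC', hg⟩ := hg M
  refine ⟨C + C', by positivity, fun t => ⟨?_, fun s hs => ?_⟩⟩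
  · calc _ ≤ (1 + |t|) ^ M * (‖f t‖ + ‖g t‖) := by gcongr; exact norm_add_le _ _
      _ ≤ _ := by rw [mul_add]; exact add_le_add (hf t).1 (hg t).1
  · have h1 : |s - t| ^ α ≤ |s - t| ^ min α β :=
      Real.rpow_le_rpow_of_exponent_ge_of_imp (abs_nonneg _) hs (min_le_left _ _)
        fun _ h0 => absurd h0 hα.ne'
    have h2 : |s - t| ^ β ≤ |s - t| ^ min α β :=
      Real.rpow_le_rpow_of_exponent_ge_of_imp (abs_nonneg _) hs (min_le_right _ _)
        fun _ h0 => absurd h0 hβ.ne'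
    calc _ = (1 + |t|) ^ M * ‖(f s - f t) + (g s - g t)‖ := by congr 2; ring
      _ ≤ (1 + |t|) ^ M * (‖f s - f t‖ + ‖g s - g t‖) := by gcongr; exact norm_add_le _ _
      _ ≤ C * |s - t| ^ α + C' * |s - t| ^ β := by
        rw [mul_add]; exact add_le_add ((hf t).2 s hs) ((hg t).2 s hs)
      _ ≤ C * |s - t| ^ min α β + C' * |s - t| ^ min α β := by gcongr
      _ = _ := by ring

theorem const_mul {f : ℝ → ℂ} (hf : DecayHolder f) (a : ℂ) : DecayHolder fun t => a * f t := by
  obtain ⟨α, hα, hα1, hf⟩ := hf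
  refine ⟨α, hα, hα1, fun M => ?_⟩
  obtain ⟨C, hC, hf⟩ := hf M
  refine ⟨‖a‖ * C, by positivity, fun t => ⟨?_, fun s hs => ?_⟩⟩
  · rw [norm_mul, mul_left_comm]
    have := (hf t).1
    gcongr
  · rw [← mul_sub, norm_mul, mul_left_comm, mul_assoc]
    have := (hf t).2 s hs
    gcongr

theorem toFun_mul {f : ℝ → ℂ} (hf : DecayHolder f) (γ : SmoothCurve) :
    DecayHolder fun t => γ.toFun t * f t := by
  obtain ⟨α, hα, hα1, hf⟩ := hf
  refine ⟨α, hα, hα1, fun M => ?_⟩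
  obtain ⟨C, hC, hf⟩ := hf (M + 1)
  set A := 2 + ‖γ.toFun 0‖ with hA
  have hA0 : 0 ≤ A := by positivity
  have hb : ∀ s t, |s - t| ≤ 1 → ‖γ.toFun s‖ ≤ A * (1 + |t|) := fun s t hst => by
    have h1 := γ.norm_toFun_sub_le s 0
    have h2 := norm_sub_norm_le (γ.toFun s) (γ.toFun 0)
    have h3 := abs_sub_abs_le_abs_sub s t
    rw [sub_zero] at h1
    have h4 := norm_nonneg (γ.toFun 0)
    have h5 := abs_nonneg t
    nlinarith
  have hone : ∀ t : ℝ, 1 ≤ 1 + |t| := fun t => by linarith [abs_nonneg t]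
  refine ⟨A * C + C, by positivity, fun t => ⟨?_, fun s hs => ?_⟩⟩
  · rw [norm_mul]
    have h1 := hb t t (by simp)
    calc _ ≤ (1 + |t|) ^ M * (A * (1 + |t|) * ‖f t‖) := by gcongr
      _ = A * ((1 + |t|) ^ (M + 1) * ‖f t‖) := by ring
      _ ≤ A * C := by gcongr; exact (hf t).1
      _ ≤ _ := by linarith
  · have h1 := hb s t hs
    have h2 : ‖γ.toFun s - γ.toFun t‖ ≤ |s - t| ^ α :=
      (γ.norm_toFun_sub_le s t).trans (Real.self_le_rpow_of_le_one (abs_nonneg _) hs hα1)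
    have h3 : (1 + |t|) ^ M * ‖f t‖ ≤ C := by
      refine le_trans ?_ (hf t).1
      gcongr
      · exact hone t
      · omega
    calc _ = (1 + |t|) ^ M * ‖γ.toFun s * (f s - f t) + (γ.toFun s - γ.toFun t) * f t‖ := by
          congr 2; ring
      _ ≤ (1 + |t|) ^ M * (A * (1 + |t|) * ‖f s - f t‖ + |s - t| ^ α * ‖f t‖) := by
          gcongr
          refine (norm_add_le _ _).trans ?_
          rw [norm_mul, norm_mul]
          gcongr
      _ = A * ((1 + |t|) ^ (M + 1) * ‖f s - f t‖) + |s - t| ^ α * ((1 + |t|) ^ M * ‖f t‖) := by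
          ring
      _ ≤ A * (C * |s - t| ^ α) + |s - t| ^ α * C :=
          add_le_add (mul_le_mul_of_nonneg_left ((hf t).2 s hs) hA0) (by gcongr)
      _ = _ := by ring

/-- A Hölder continuous function all of whose moments are finite decreases rapidly. -/
theorem of_integrable {w : ℝ → ℂ} {K α : ℝ} (hα : 0 < α) (hα1 : α ≤ 1) (hK : 0 ≤ K)
    (hw : ∀ s t, ‖w s - w t‖ ≤ K * |s - t| ^ α)
    (hint : ∀ M : ℕ, Integrable fun t => (1 + |t|) ^ M * ‖w t‖) : DecayHolder w := by
  have hone : ∀ t : ℝ, 1 ≤ 1 + |t| := fun t => by linarith [abs_nonneg t]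
  have hdecay : ∀ M : ℕ, ∃ C ≥ 0, ∀ t : ℝ, (1 + |t|) ^ M * ‖w t‖ ≤ C := fun M => by
    -- On a window of length `r = (1 + |t|)^{-j}` the function changes by at most `K r^α`, and `j α
    -- ≥ M` makes `(1 + |t|)^M r^α ≤ 1`. Averaging over the window costs `1 / r = (1 + |t|)^j`,
    -- which is paid for by the moment of order `M + j`.
    obtain ⟨j, hj⟩ := exists_nat_ge (M / α)
    rw [div_le_iff₀ hα] at hj
    have hI : 0 ≤ ∫ t, (1 + |t|) ^ (M + j) * ‖w t‖ := integral_nonneg fun t => by positivity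
    refine ⟨K + 2 ^ (M + j) * ∫ t, (1 + |t|) ^ (M + j) * ‖w t‖, by positivity, fun t => ?_⟩
    have hx := hone t
    set x := 1 + |t| with hxdef
    have hx0 : 0 < x := by linarith
    set r := (x ^ j)⁻¹ with hr
    have hr0 : 0 < r := by positivity
    have hr1 : r ≤ 1 := inv_le_one_of_one_le₀ (one_le_pow₀ hx)
    have hcomp : ∀ s ∈ Icc t (t + r), x ≤ 2 * (1 + |s|) := fun s hs => by
      have h1 : |t - s| ≤ 1 := abs_le.2 ⟨by linarith [hs.2], by linarith [hs.1]⟩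
      have h2 := abs_sub_abs_le_abs_sub t s
      have := abs_nonneg s
      linarith
    have hconst : IntegrableOn (fun _ : ℝ => K) (Icc t (t + r)) :=
      integrableOn_const (by simp)
    have h1 : ∫ s in Icc t (t + r), x ^ M * ‖w t‖ ≤
        ∫ s in Icc t (t + r), (2 ^ (M + j) * r * ((1 + |s|) ^ (M + j) * ‖w s‖) + K) := by
      refine setIntegral_mono_on (integrableOn_const (by simp)) ?_ measurableSet_Icc fun s hs => ?_
      · exact (((hint (M + j)).const_mul _).integrableOn).add hconst
      have h2 : ‖w t‖ ≤ ‖w s‖ + K * r ^ α := by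
        have h3 := hw t s
        have h4 := norm_sub_norm_le (w t) (w s)
        have h5 : |t - s| ^ α ≤ r ^ α := by
          gcongr
          exact abs_le.2 ⟨by linarith [hs.2], by linarith [hs.1]⟩
        nlinarith
      have h6 : x ^ M * r ^ α ≤ 1 := by
        rw [hr, ← Real.rpow_natCast x j, ← Real.rpow_natCast x M, ← Real.rpow_neg hx0.le,
          ← Real.rpow_mul hx0.le, ← Real.rpow_add hx0]
        exact Real.rpow_le_one_of_one_le_of_nonpos hx (by linarith)
      have h7 : x ^ M ≤ 2 ^ (M + j) * r * (1 + |s|) ^ (M + j) := by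
        have : x ^ (M + j) ≤ 2 ^ (M + j) * (1 + |s|) ^ (M + j) := by
          rw [← mul_pow]
          have := hcomp s hs
          gcongr
        calc x ^ M = r * x ^ (M + j) := by rw [hr, pow_add]; field_simp
          _ ≤ r * (2 ^ (M + j) * (1 + |s|) ^ (M + j)) := by gcongr
          _ = _ := by ring
      calc x ^ M * ‖w t‖ ≤ x ^ M * (‖w s‖ + K * r ^ α) := by gcongr
        _ = x ^ M * ‖w s‖ + K * (x ^ M * r ^ α) := by ring
        _ ≤ 2 ^ (M + j) * r * (1 + |s|) ^ (M + j) * ‖w s‖ + K * 1 := by gcongr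
        _ = _ := by ring
    have h2 : ∫ s in Icc t (t + r), (2 ^ (M + j) * r * ((1 + |s|) ^ (M + j) * ‖w s‖) + K) ≤
        2 ^ (M + j) * r * (∫ s, (1 + |s|) ^ (M + j) * ‖w s‖) + r * K := by
      rw [integral_add (((hint (M + j)).const_mul _).integrableOn) hconst, setIntegral_const,
        measureReal_def, Real.volume_Icc, ENNReal.toReal_ofReal (by linarith),
        ← integral_const_mul, smul_eq_mul, add_sub_cancel_left]
      exact add_le_add (setIntegral_le_integral ((hint (M + j)).const_mul _)
        (Eventually.of_forall fun s => by simp only [Pi.zero_apply]; positivity)) le_rfl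
    rw [setIntegral_const, measureReal_def, Real.volume_Icc,
      ENNReal.toReal_ofReal (by linarith), smul_eq_mul, add_sub_cancel_left] at h1
    have h3 := h1.trans h2
    have h4 : r * (x ^ M * ‖w t‖) ≤
        r * (K + 2 ^ (M + j) * ∫ t, (1 + |t|) ^ (M + j) * ‖w t‖) := by linarith
    exact le_of_mul_le_mul_left h4 hr0
  -- Interpolation: the square of an increment is at most its decay bound of order `2 M` times its
  -- Hölder bound. Half of the exponent is given up to gain a weight of any order.
  refine ⟨α / 2, by positivity, by linarith, fun M => ?_⟩
  obtain ⟨C, hC, hd⟩ := hdecay M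
  obtain ⟨C', hC', hd'⟩ := hdecay (2 * M)
  set C₁ := 5 ^ M * (2 * C') with hC₁
  have hd2 : ∀ s t, |s - t| ≤ 1 → (1 + |t|) ^ (2 * M) * ‖w s - w t‖ ≤ 2 ^ (2 * M) * C' + C' := by
    intro s t hst
    have h1 : 1 + |t| ≤ 2 * (1 + |s|) := by
      have := abs_sub_abs_le_abs_sub t s
      rw [abs_sub_comm] at this
      have := abs_nonneg s
      linarith
    calc _ ≤ (1 + |t|) ^ (2 * M) * (‖w s‖ + ‖w t‖) := by gcongr; exact norm_sub_le _ _
      _ = (1 + |t|) ^ (2 * M) * ‖w s‖ + (1 + |t|) ^ (2 * M) * ‖w t‖ := by ring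
      _ ≤ (2 * (1 + |s|)) ^ (2 * M) * ‖w s‖ + C' := by gcongr; exact hd' t
      _ = 2 ^ (2 * M) * ((1 + |s|) ^ (2 * M) * ‖w s‖) + C' := by rw [mul_pow]; ring
      _ ≤ _ := by gcongr; exact hd' s
  set C₂ := 2 ^ (2 * M) * C' + C' with hC₂
  have hC₂0 : 0 ≤ C₂ := by positivity
  refine ⟨C + Real.sqrt (K * C₂), by positivity, fun t => ⟨(hd t).trans (by
    have := Real.sqrt_nonneg (K * C₂); linarith), fun s hs => ?_⟩⟩
  have h1 : ((1 + |t|) ^ M * ‖w s - w t‖) ^ 2 ≤ K * C₂ * |s - t| ^ α := by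
    calc _ = ((1 + |t|) ^ (2 * M) * ‖w s - w t‖) * ‖w s - w t‖ := by ring
      _ ≤ C₂ * (K * |s - t| ^ α) := by
        have := hd2 s t hs
        have := hw s t
        gcongr
      _ = _ := by ring
  have h2 : Real.sqrt (|s - t| ^ α) = |s - t| ^ (α / 2) := by
    rw [Real.sqrt_eq_rpow, ← Real.rpow_mul (abs_nonneg _)]
    congr 1; ring
  calc _ ≤ Real.sqrt (K * C₂ * |s - t| ^ α) := Real.le_sqrt_of_sq_le h1
    _ = Real.sqrt (K * C₂) * |s - t| ^ (α / 2) := by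
      rw [Real.sqrt_mul (by positivity), h2]
    _ ≤ _ := by gcongr; linarith

end DecayHolder

/-! ### Holomorphy and boundedness of Cauchy integrals off the curve. -/

namespace SmoothCurve

variable {γ : SmoothCurve} {δ : ℝ}

theorem exists_le_norm_sub_of_notMem {z : ℂ} (hz : z ∉ γ.image) :
    ∃ d > 0, ∀ w ∈ γ.image, ∀ z', ‖z' - z‖ < d → d ≤ ‖w - z'‖ := by
  obtain ⟨d, hd, hsub⟩ := Metric.isOpen_iff.1 γ.isClosed_image.isOpen_compl z hz
  refine ⟨d / 2, half_pos hd, fun w hw z' hz' => ?_⟩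
  have h1 : d ≤ ‖w - z‖ := not_lt.1 fun hlt => hsub (by rwa [Metric.mem_ball, dist_eq_norm]) hw
  have h2 := norm_sub_le_norm_sub_add_norm_sub w z' z
  linarith

theorem norm_integrand_le {g : ℝ → ℂ} (hsupp : ∀ t, g t ≠ 0 → γ.toFun t ∈ γ.image) {z : ℂ} {d : ℝ}
    (hd : 0 < d) (h : ∀ w ∈ γ.image, d ≤ ‖w - z‖) (t : ℝ) :
    ‖deriv γ.toFun t * ((γ.toFun t - z)⁻¹ * g t)‖ ≤ d⁻¹ * ‖g t‖ := by
  rw [norm_mul, γ.unit_speed, one_mul, norm_mul, norm_inv]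
  by_cases ht : g t = 0
  · simp [ht]
  · have := h _ (hsupp t ht)
    gcongr

theorem integrable_cauchy {g : ℝ → ℂ} (hg : Integrable g)
    (hsupp : ∀ t, g t ≠ 0 → γ.toFun t ∈ γ.image) {z : ℂ} (hz : z ∉ γ.image) :
    Integrable fun t => deriv γ.toFun t * ((γ.toFun t - z)⁻¹ * g t) := by
  obtain ⟨d, hd, h⟩ := exists_le_norm_sub_of_notMem hz
  refine Integrable.mono' (hg.norm.const_mul d⁻¹)
    (aestronglyMeasurable_integrand hg.aestronglyMeasurable _) (Eventually.of_forall ?_)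
  exact norm_integrand_le hsupp hd fun w hw => h w hw z (by simpa using hd)

/-- The Cauchy integral is holomorphic off the curve. -/
theorem differentiableOn_cauchyIntegral {g : ℝ → ℂ} (hg : Integrable g)
    (hsupp : ∀ t, g t ≠ 0 → γ.toFun t ∈ γ.image) :
    DifferentiableOn ℂ (γ.cauchyIntegral g) γ.imageᶜ := by
  intro z hz
  obtain ⟨d, hd, h⟩ := exists_le_norm_sub_of_notMem hz
  refine DifferentiableAt.differentiableWithinAt (HasDerivAt.differentiableAt
    (hasDerivAt_integral_of_dominated_loc_of_deriv_le (Metric.ball_mem_nhds z hd)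
      (F := fun z t => deriv γ.toFun t * ((γ.toFun t - z)⁻¹ * g t))
      (F' := fun z t => deriv γ.toFun t * (((γ.toFun t - z)⁻¹) ^ 2 * g t))
      (bound := fun t => (d⁻¹) ^ 2 * ‖g t‖) ?_ (integrable_cauchy hg hsupp hz) ?_ ?_
      (hg.norm.const_mul _) ?_).2)
  · exact Eventually.of_forall fun z' => aestronglyMeasurable_integrand hg.aestronglyMeasurable _
  · exact γ.continuous_deriv.aestronglyMeasurable.mul
      (((measurable_inv_sub z).pow_const 2).aestronglyMeasurable.mul hg.aestronglyMeasurable)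
  · refine Eventually.of_forall fun t z' hz' => ?_
    rw [norm_mul, γ.unit_speed, one_mul, norm_mul, norm_pow, norm_inv]
    by_cases ht : g t = 0
    · simp [ht]
    · have := h _ (hsupp t ht) z' (by rwa [Metric.mem_ball, dist_eq_norm] at hz')
      gcongr
  · refine Eventually.of_forall fun t z' hz' => ?_
    by_cases ht : g t = 0
    · simpa [ht] using hasDerivAt_const z' (0 : ℂ)
    · have h1 := h _ (hsupp t ht) z' (by rwa [Metric.mem_ball, dist_eq_norm] at hz')
      have h2 : γ.toFun t - z' ≠ 0 := norm_pos_iff.1 (hd.trans_le h1)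
      have h3 := (((hasDerivAt_id z').const_sub (γ.toFun t)).inv h2).mul_const (g t) |>.const_mul
        (deriv γ.toFun t)
      refine h3.congr_deriv ?_
      simp [div_eq_mul_inv]

/-- A tent of width `δ / 4`. -/
noncomputable def tent (δ x : ℝ) : ℝ := max 0 (1 - 4 / δ * |x|)

theorem continuous_tent (δ : ℝ) : Continuous (tent δ) := by
  unfold tent
  fun_prop

theorem tent_nonneg (δ x : ℝ) : 0 ≤ tent δ x := le_max_left _ _

theorem tent_le_one (hδ : 0 < δ) (x : ℝ) : tent δ x ≤ 1 :=
  max_le zero_le_one (sub_le_self _ (by positivity))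

theorem tent_eq_zero (hδ : 0 < δ) {x : ℝ} (hx : δ / 4 ≤ |x|) : tent δ x = 0 := by
  refine max_eq_left ?_
  rw [sub_nonpos]
  calc 1 = 4 / δ * (δ / 4) := by field_simp
    _ ≤ _ := by gcongr

theorem abs_tent_sub_le (hδ : 0 < δ) (x y : ℝ) : |tent δ x - tent δ y| ≤ 4 / δ * |x - y| := by
  refine (abs_max_sub_max_le_max _ _ _ _).trans ?_
  rw [sub_zero, abs_zero]
  refine max_le (by positivity) ?_
  rw [sub_sub_sub_cancel_left, ← mul_sub, abs_mul, abs_of_pos (by positivity : 0 < 4 / δ)]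
  refine mul_le_mul_of_nonneg_left ?_ (by positivity)
  rw [abs_sub_comm x]
  exact abs_abs_sub_abs_le_abs_sub y x

theorem hasCompactSupport_tent (hδ : 0 < δ) : HasCompactSupport (tent δ) := by
  refine HasCompactSupport.intro (isCompact_Icc (a := -(δ / 4)) (b := δ / 4)) fun x hx => ?_
  refine tent_eq_zero hδ ?_
  by_contra hlt
  exact hx (abs_le.1 (not_le.1 hlt).le)

theorem integral_tent_pos (hδ : 0 < δ) : 0 < ∫ x, tent δ x :=
  (continuous_tent δ).integral_pos_of_hasCompactSupport_nonneg_nonzero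
    (hasCompactSupport_tent hδ) (tent_nonneg δ) (x := 0) (by simp [tent])

theorem norm_tent_mul_le (hδ : 0 < δ) {g : ℝ → ℂ} {c K α : ℝ} (hα1 : α ≤ 1)
    (hg : ∀ t, |t - c| < δ / 4 → ‖g t‖ ≤ K ∧ ∀ s, |s - t| ≤ 1 → ‖g s - g t‖ ≤ K * |s - t| ^ α)
    {s t : ℝ} (hst : |s - t| ≤ 1) (ht : |t - c| < δ / 4) :
    ‖g s * tent δ (c - s) - g t * tent δ (c - t)‖ ≤ (1 + 4 / δ) * K * |s - t| ^ α := by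
  obtain ⟨h1, h2⟩ := hg t ht
  have h3 : g s * tent δ (c - s) - g t * tent δ (c - t) =
      (g s - g t) * tent δ (c - s) + g t * (tent δ (c - s) - tent δ (c - t) : ℝ) := by
    push_cast; ring
  have h4 : |tent δ (c - s) - tent δ (c - t)| ≤ 4 / δ * |s - t| ^ α := by
    have h5 := abs_tent_sub_le hδ (c - s) (c - t)
    rw [sub_sub_sub_cancel_left, abs_sub_comm t] at h5
    refine h5.trans ?_
    gcongr
    exact Real.self_le_rpow_of_le_one (abs_nonneg _) hst hα1
  have h5 : |tent δ (c - s)| ≤ 1 := by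
    rw [abs_of_nonneg (tent_nonneg _ _)]
    exact tent_le_one hδ _
  have h6 := h2 s hst
  have hK : 0 ≤ K := (norm_nonneg _).trans h1
  rw [h3]
  refine (norm_add_le _ _).trans ?_
  rw [norm_mul, norm_mul, norm_real, norm_real, Real.norm_eq_abs, Real.norm_eq_abs]
  calc _ ≤ (K * |s - t| ^ α) * 1 + K * (4 / δ * |s - t| ^ α) := by gcongr
    _ = _ := by ring

/-- The Cauchy integral of a rapidly decreasing Hölder density is bounded off the curve. -/
theorem exists_norm_cauchyIntegral_le {g : ℝ → ℂ} (hg : Integrable g)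
    (hsupp : ∀ t, g t ≠ 0 → γ.toFun t ∈ γ.image) (hdec : DecayHolder g) :
    ∃ B, ∀ z ∉ γ.image, ‖γ.cauchyIntegral g z‖ ≤ B := by
  obtain ⟨δ, hδ⟩ := γ.exists_isScale
  have hδ0 := hδ.pos
  obtain ⟨α, hα, hα1, hdec⟩ := hdec
  -- Two powers suffice to make the bound for the piece centred at `c` a multiple of `1 / (1 + c ^
  -- 2)`, integrable in `c`.
  obtain ⟨C, hC, hdec⟩ := hdec 2
  obtain ⟨B, hB, hpiece⟩ := hδ.exists_norm_cauchyIntegral_le hα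
  set J := ∫ x, tent δ x with hJ
  have hJ0 : 0 < J := integral_tent_pos hδ0
  set A := B * ((1 + 4 / δ) * (2 * C)) with hA
  refine ⟨J⁻¹ * ∫ c, A * (1 + c ^ 2)⁻¹, fun z hz => ?_⟩
  set F : ℝ → ℂ := fun t => deriv γ.toFun t * ((γ.toFun t - z)⁻¹ * g t) with hF
  have hFi : Integrable F := integrable_cauchy hg hsupp hz
  have hti : Integrable fun x => (tent δ x : ℂ) :=
    ((continuous_tent δ).integrable_of_hasCompactSupport (hasCompactSupport_tent hδ0)).ofReal
  -- A continuous partition of unity: the tents centred at `c`, integrated over `c`, give the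
  -- constant `J`. So `J` times the Cauchy integral is the integral over `c` of those of the
  -- localised densities, which are values of a convolution.
  have hconv := integral_convolution (μ := volume) (ν := volume)
    (ContinuousLinearMap.mul ℝ ℂ) hFi hti
  have hval : ∀ c, convolution F (fun x => (tent δ x : ℂ)) (ContinuousLinearMap.mul ℝ ℂ) volume c =
      γ.cauchyIntegral (fun t => g t * tent δ (c - t)) z := fun c => by
    rw [convolution, cauchyIntegral]
    congr 1
    ext t
    simp only [ContinuousLinearMap.mul_apply', hF]
    ring
  have hbound : ∀ c, ‖convolution F (fun x => (tent δ x : ℂ)) (ContinuousLinearMap.mul ℝ ℂ)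
      volume c‖ ≤ A * (1 + c ^ 2)⁻¹ := fun c => by
    rw [hval]
    set K := 2 * C * (1 + c ^ 2)⁻¹ with hK
    have hK0 : 0 ≤ K := by positivity
    have hloc : ∀ t, |t - c| < δ / 4 → ‖g t‖ ≤ K ∧
        ∀ s, |s - t| ≤ 1 → ‖g s - g t‖ ≤ K * |s - t| ^ α := fun t ht => by
      have h1 : 1 + c ^ 2 ≤ 2 * (1 + |t|) ^ 2 := by
        have h2 := abs_sub_abs_le_abs_sub c t
        rw [abs_sub_comm] at h2
        have h3 := hδ.le_one
        have h4 : |c| ≤ |t| + 1 / 4 := by linarith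
        have h5 := abs_nonneg c
        have h6 := abs_nonneg t
        rw [← sq_abs c]
        nlinarith
      have h2 : (0 : ℝ) < 1 + c ^ 2 := by positivity
      have key : ∀ x y : ℝ, 0 ≤ x → (1 + |t|) ^ 2 * x ≤ C * y → x ≤ K * y := fun x y hx hxy => by
        rw [hK, mul_right_comm, ← div_eq_mul_inv, le_div_iff₀ h2]
        nlinarith
      refine ⟨?_, fun s hs => key _ _ (norm_nonneg _) ((hdec t).2 s hs)⟩
      simpa using key _ 1 (norm_nonneg _) (by simpa using (hdec t).1)
    have hzero : ∀ t, δ / 4 ≤ |t - c| → g t * (tent δ (c - t) : ℂ) = 0 := fun t ht => by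
      rw [tent_eq_zero hδ0 (by rwa [abs_sub_comm]), ofReal_zero, mul_zero]
    have h4 : (0 : ℝ) ≤ 4 / δ := by positivity
    have := hpiece (fun t => g t * tent δ (c - t)) c ((1 + 4 / δ) * K) z ?_ (by positivity)
      ?_ ?_ ?_ ?_
    · refine this.trans (le_of_eq ?_)
      rw [hA, hK]; ring
    · refine hg.mul_bdd (c := 1) ?_ (Eventually.of_forall fun t => ?_)
      · have := continuous_tent δ
        exact (by fun_prop : Continuous fun t => (tent δ (c - t) : ℂ)).aestronglyMeasurable
      · rw [norm_real, Real.norm_eq_abs, abs_of_nonneg (tent_nonneg _ _)]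
        exact tent_le_one hδ0 _
    · intro t ht
      refine hzero t (le_of_not_gt fun hlt => ht ?_)
      have := abs_lt.1 hlt
      constructor <;> linarith
    · intro t
      by_cases ht : δ / 4 ≤ |t - c|
      · simp only [hzero t ht, norm_zero]; positivity
      · have h5 := (hloc t (not_le.1 ht)).1
        rw [norm_mul, norm_real, Real.norm_eq_abs, abs_of_nonneg (tent_nonneg _ _)]
        have h6 := tent_le_one hδ0 (c - t)
        calc _ ≤ K * 1 := by gcongr; exact tent_nonneg _ _
          _ ≤ _ := by nlinarith
    · intro s t hst
      by_cases ht : δ / 4 ≤ |t - c|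
      · by_cases hs : δ / 4 ≤ |s - c|
        · simp only [hzero t ht, hzero s hs, sub_self, norm_zero]; positivity
        · rw [norm_sub_rev, abs_sub_comm s t]
          exact norm_tent_mul_le hδ0 hα1 hloc (by rwa [abs_sub_comm]) (not_le.1 hs)
      · exact norm_tent_mul_le hδ0 hα1 hloc hst (not_le.1 ht)
    · intro t ht
      have : g t = 0 := by_contra fun h0 => hz (ht ▸ hsupp t h0)
      simp [this]
  have hfin : ‖∫ t, F t‖ * J ≤ ∫ c, A * (1 + c ^ 2)⁻¹ := by
    have h1 : ∫ x, (tent δ x : ℂ) = (J : ℂ) := integral_ofReal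
    rw [h1, ContinuousLinearMap.mul_apply'] at hconv
    have h2 : ‖∫ t, F t‖ * J = ‖(∫ t, F t) * (J : ℂ)‖ := by
      rw [norm_mul, norm_real, Real.norm_eq_abs, abs_of_pos hJ0]
    rw [h2, ← hconv]
    exact norm_integral_le_of_norm_le (integrable_inv_one_add_sq.const_mul A)
      (Eventually.of_forall hbound)
  rw [cauchyIntegral, inv_mul_eq_div, le_div_iff₀ hJ0]
  exact hfin

end SmoothCurve

/-! ### Holomorphic continuation of continuous functions across the curve. -/

namespace SmoothCurve

variable (γ : SmoothCurve) {δ : ℝ}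

/-- Translate of the curve by `v` in the direction normal to it at `γ(t₀)`. -/
noncomputable def shear (t₀ s v : ℝ) : ℂ := γ.toFun s + v * I * deriv γ.toFun t₀

theorem continuous_shear (t₀ : ℝ) : Continuous fun p : ℝ × ℝ => γ.shear t₀ p.1 p.2 := by
  unfold shear
  have := γ.continuous_toFun
  fun_prop

theorem hasDerivAt_shear_left (t₀ s v : ℝ) :
    HasDerivAt (fun s => γ.shear t₀ s v) (deriv γ.toFun s) s :=
  (γ.hasDerivAt s).add_const _

theorem hasDerivAt_shear_right (t₀ s v : ℝ) :
    HasDerivAt (fun v => γ.shear t₀ s v) (I * deriv γ.toFun t₀) v := by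
  have := (((HasDerivAt.ofReal_comp (hasDerivAt_id v)).mul_const I).mul_const
    (deriv γ.toFun t₀)).const_add (γ.toFun s)
  rw [ofReal_one, one_mul] at this
  exact this

theorem norm_shear_sub_le (t₀ s v s' v' : ℝ) :
    ‖γ.shear t₀ s v - γ.shear t₀ s' v'‖ ≤ |s - s'| + |v - v'| := by
  have h : γ.shear t₀ s v - γ.shear t₀ s' v' =
      (γ.toFun s - γ.toFun s') + ((v - v' : ℝ) : ℂ) * I * deriv γ.toFun t₀ := by
    unfold shear; push_cast; ring
  rw [h]
  refine (norm_add_le _ _).trans (add_le_add (γ.norm_toFun_sub_le _ _) ?_)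
  rw [norm_mul, γ.unit_speed, norm_mul, norm_I, norm_real, Real.norm_eq_abs, mul_one, mul_one]

variable {γ}

theorem IsScale.abs_le_norm_shear_sub (h : γ.IsScale δ) {t₀ s s' : ℝ} (hs : |s - t₀| ≤ δ)
    (hs' : |s' - t₀| ≤ δ) (v v' : ℝ) :
    9 / 10 * |s - s'| ≤ ‖γ.shear t₀ s v - γ.shear t₀ s' v'‖ ∧
      9 / 10 * |v - v'| ≤ ‖γ.shear t₀ s v - γ.shear t₀ s' v'‖ := by
  have h1 := h.le_norm_sub_add hs hs' (v - v')
  have h2 := norm_ofReal_add_mul_I (s - s') (v - v')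
  have h3 : γ.shear t₀ s v - γ.shear t₀ s' v' =
      (γ.toFun s - γ.toFun s') + ((v - v' : ℝ) : ℂ) * I * deriv γ.toFun t₀ := by
    unfold shear; push_cast; ring
  rw [h3]
  constructor <;> linarith [h2.1, h2.2]

/-- Differentiation of the integral along a translate of the curve. -/
theorem hasDerivAt_integral_shear {f : ℂ → ℂ} {Ω : Set ℂ} (hΩ : IsOpen Ω)
    (hf : DifferentiableOn ℂ f Ω) {t₀ a b v e : ℝ} (he : 0 < e)
    (hmem : ∀ s ∈ uIcc a b, ∀ y, |y - v| ≤ e → γ.shear t₀ s y ∈ Ω) :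
    HasDerivAt (fun y => ∫ s in a..b, f (γ.shear t₀ s y) * deriv γ.toFun s)
      (I * deriv γ.toFun t₀ * (f (γ.shear t₀ b v) - f (γ.shear t₀ a v))) v := by
  have hsh := γ.continuous_shear t₀
  have hd := γ.continuous_deriv
  have hf' : ContinuousOn (deriv f) Ω := (hf.deriv hΩ).continuousOn
  have hK : IsCompact ((uIcc a b) ×ˢ (Metric.closedBall v e)) :=
    isCompact_uIcc.prod (isCompact_closedBall v e)
  have hmaps : MapsTo (fun p : ℝ × ℝ => γ.shear t₀ p.1 p.2)
      ((uIcc a b) ×ˢ (Metric.closedBall v e)) Ω := fun p hp =>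
    hmem p.1 hp.1 p.2 (by simpa [Real.dist_eq] using hp.2)
  obtain ⟨B, hB⟩ := hK.exists_bound_of_continuousOn (hf'.comp hsh.continuousOn hmaps)
  have hslice : ∀ y, |y - v| ≤ e → MapsTo (fun s => γ.shear t₀ s y) (uIcc a b) Ω :=
    fun y hy s hs => hmem s hs y hy
  have hcs : ∀ y, Continuous fun s => γ.shear t₀ s y := fun y =>
    hsh.comp (continuous_id.prodMk continuous_const)
  have hcont : ∀ y, |y - v| ≤ e →
      ContinuousOn (fun s => f (γ.shear t₀ s y) * deriv γ.toFun s) (uIcc a b) := fun y hy =>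
    (hf.continuousOn.comp (hcs y).continuousOn (hslice y hy)).mul hd.continuousOn
  have hcont' : ContinuousOn (fun s => deriv f (γ.shear t₀ s v) * (I * deriv γ.toFun t₀) *
      deriv γ.toFun s) (uIcc a b) :=
    ((hf'.comp (hcs v).continuousOn (hslice v (by simpa using he.le))).mul
      continuousOn_const).mul hd.continuousOn
  have hball : ∀ᶠ y in 𝓝 v, |y - v| ≤ e := by
    filter_upwards [Metric.ball_mem_nhds v he] with y hy
    exact (by simpa [Real.dist_eq] using hy : |y - v| < e).le
  have key := intervalIntegral.hasDerivAt_integral_of_dominated_loc_of_deriv_le (μ := volume)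
    (a := a) (b := b) (x₀ := v) (s := Metric.ball v e) (bound := fun _ => B)
    (F := fun y s => f (γ.shear t₀ s y) * deriv γ.toFun s)
    (F' := fun y s => deriv f (γ.shear t₀ s y) * (I * deriv γ.toFun t₀) * deriv γ.toFun s)
    (Metric.ball_mem_nhds v he)
    (by
      filter_upwards [hball] with y hy
      exact ((hcont y hy).mono uIoc_subset_uIcc).aestronglyMeasurable measurableSet_uIoc)
    (hcont v (by simpa using he.le)).intervalIntegrable
    ((hcont'.mono uIoc_subset_uIcc).aestronglyMeasurable measurableSet_uIoc)
    (Eventually.of_forall fun s hs y hy => by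
      rw [norm_mul, norm_mul, norm_mul, γ.unit_speed, γ.unit_speed, norm_I]
      simpa using hB (s, y) ⟨uIoc_subset_uIcc hs, Metric.ball_subset_closedBall hy⟩)
    (intervalIntegrable_const)
    (Eventually.of_forall fun s hs y hy => by
      have hy' : |y - v| ≤ e := (by simpa [Real.dist_eq] using hy : |y - v| < e).le
      have hda : HasDerivAt f (deriv f (γ.shear t₀ s y)) (γ.shear t₀ s y) :=
        (hf.differentiableAt (hΩ.mem_nhds (hmem s (uIoc_subset_uIcc hs) y hy'))).hasDerivAt
      exact (hda.comp_of_eq y (γ.hasDerivAt_shear_right t₀ s y) rfl).mul_const _)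
  refine key.2.congr_deriv ?_
  -- The integrand of the derivative, `f' · iτ · γ'(s)` with `τ = γ'(t₀)`, is also the
  -- `s`-derivative of `iτ f` along the translate, so it integrates to the difference at the ends.
  rw [mul_sub]
  rw [← intervalIntegral.integral_eq_sub_of_hasDerivAt
    (f := fun s => I * deriv γ.toFun t₀ * f (γ.shear t₀ s v)) (fun s hs => ?_)
    hcont'.intervalIntegrable]
  have hda : HasDerivAt f (deriv f (γ.shear t₀ s v)) (γ.shear t₀ s v) :=
    (hf.differentiableAt (hΩ.mem_nhds (hmem s hs v (by simpa using he.le)))).hasDerivAt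
  refine ((hda.comp_of_eq s (γ.hasDerivAt_shear_left t₀ s v) rfl).const_mul
    (I * deriv γ.toFun t₀)).congr_deriv ?_
  ring

/-- A continuous function that is holomorphic near `γ(t₀)` off the curve is holomorphic there. -/
theorem differentiableAt_of_continuous {f : ℂ → ℂ} (hf : Continuous f) {t₀ : ℝ}
    (hd : ∀ η > 0, ∀ᶠ z in 𝓝 (γ.toFun t₀),
      z ∉ γ.toFun '' Icc (t₀ - η) (t₀ + η) → DifferentiableAt ℂ f z) :
    DifferentiableAt ℂ f (γ.toFun t₀) := by
  obtain ⟨δ, hδ⟩ := γ.exists_isScale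
  have hδ0 := hδ.pos
  obtain ⟨r, hr, hball⟩ := Metric.eventually_nhds_iff_ball.1 (hd δ hδ0)
  set τ := deriv γ.toFun t₀ with hτ
  have hsh := γ.continuous_shear t₀
  have hdc := γ.continuous_deriv
  set Ω := Metric.ball (γ.toFun t₀) r \ γ.toFun '' Icc (t₀ - δ) (t₀ + δ) with hΩdef
  have hΩ : IsOpen Ω := Metric.isOpen_ball.sdiff
    (isCompact_Icc.image γ.continuous_toFun).isClosed
  have hfΩ : DifferentiableOn ℂ f Ω := fun z hz =>
    (hball z hz.1 hz.2).differentiableWithinAt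
  have hρ0 : 0 < min δ (r / 4) := by positivity
  have hρ := hδ.mono hρ0 (min_le_left _ _)
  have hρδ : min δ (r / 4) ≤ δ := min_le_left _ _
  have hρr : min δ (r / 4) ≤ r / 4 := min_le_right _ _
  set ρ := min δ (r / 4)
  have hmemΩ : ∀ s v : ℝ, |s - t₀| ≤ ρ → |v| ≤ 2 * ρ → v ≠ 0 → γ.shear t₀ s v ∈ Ω := by
    intro s v hs hv hv0
    constructor
    · rw [Metric.mem_ball, dist_eq_norm]
      have := γ.norm_shear_sub_le t₀ s v t₀ 0
      simp only [shear, sub_zero, ofReal_zero, zero_mul, add_zero] at this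
      unfold shear
      linarith
    · rintro ⟨t, ht, hts⟩
      have h1 := (hδ.abs_le_norm_shear_sub (t₀ := t₀) (s := s) (s' := t) (hs.trans hρδ)
        (abs_le.2 ⟨by linarith [ht.1], by linarith [ht.2]⟩) v 0).2
      have h2 : γ.shear t₀ t 0 = γ.toFun t := by simp [shear]
      rw [h2, hts, sub_self, norm_zero, sub_zero] at h1
      have := abs_pos.2 hv0
      linarith
  -- Cauchy's theorem for a rectangle bent along the curve. The derivative formula holds for every
  -- height except `v = 0`, and continuity of `f` lets the fundamental theorem of calculus ignore
  -- that one height. Translating in the fixed direction `iτ`, not along the varying normals,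
  -- requires no second derivative of the curve.
  have hrect : ∀ a b V : ℝ, |a - t₀| ≤ ρ → |b - t₀| ≤ ρ → |V| ≤ ρ →
      I * τ * ∫ v in (0 : ℝ)..V, (f (γ.shear t₀ b v) - f (γ.shear t₀ a v)) =
        (∫ s in a..b, f (γ.shear t₀ s V) * deriv γ.toFun s) -
        ∫ s in a..b, f (γ.shear t₀ s 0) * deriv γ.toFun s := by
    intro a b V ha hb hV
    rw [← intervalIntegral.integral_const_mul]
    refine integral_eq_of_hasDerivAt_off_countable
      (fun V => ∫ s in a..b, f (γ.shear t₀ s V) * deriv γ.toFun s) _ (countable_singleton 0)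
      ?_ ?_ ?_
    · refine (intervalIntegral.continuous_parametric_intervalIntegral_of_continuous'
        (f := fun V s => f (γ.shear t₀ s V) * deriv γ.toFun s) ?_ a b).continuousOn
      exact (hf.comp (hsh.comp continuous_swap)).mul (hdc.comp continuous_snd)
    · intro v hv
      have hv0 : v ≠ 0 := hv.2
      have hvρ : |v| ≤ ρ := by
        have h1 : v ∈ uIcc 0 V := ⟨hv.1.1.le, hv.1.2.le⟩
        have h2 := abs_sub_left_of_mem_uIcc h1
        simp only [sub_zero] at h2
        exact h2.trans hV
      have hvp := abs_pos.2 hv0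
      refine hasDerivAt_integral_shear hΩ hfΩ (e := |v| / 2) (by positivity) fun s hs y hy => ?_
      have h3 := abs_sub_abs_le_abs_sub y v
      have h4 := abs_sub_abs_le_abs_sub v y
      rw [abs_sub_comm] at h4
      refine hmemΩ s y ?_ (by linarith) (abs_pos.1 (by linarith))
      have h5 : uIcc a b ⊆ Icc (t₀ - ρ) (t₀ + ρ) := by
        have := abs_le.1 ha
        have := abs_le.1 hb
        exact uIcc_subset_Icc ⟨by linarith, by linarith⟩ ⟨by linarith, by linarith⟩
      have := h5 hs
      exact abs_le.2 ⟨by linarith [this.1], by linarith [this.2]⟩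
    · refine Continuous.intervalIntegrable ?_ _ _
      have h1 : ∀ s, Continuous fun v => γ.shear t₀ s v := fun s =>
        hsh.comp (continuous_const.prodMk continuous_id)
      exact continuous_const.mul ((hf.comp (h1 b)).sub (hf.comp (h1 a)))
  have hcoord : ∀ z : ℂ, ∃ p : ℝ × ℝ, ‖z - γ.toFun t₀‖ < 9 / 10 * ρ →
      |p.1 - t₀| ≤ ρ ∧ |p.2| ≤ ρ ∧ z = γ.shear t₀ p.1 p.2 := by
    intro z
    by_cases hz : ‖z - γ.toFun t₀‖ < 9 / 10 * ρ
    swap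
    · exact ⟨0, fun h => absurd h hz⟩
    obtain ⟨s, v, hs, rfl⟩ := hρ.exists_eq_add_mul_I (n := fun _ => τ) continuous_const
      (fun _ => γ.unit_speed t₀) (t := t₀) (z := z)
      (by
        have h1 := hρ.norm_sub_sub_le (c := t₀) (x := t₀ + ρ) (y := t₀)
          (by simp [abs_of_pos hρ0]) (by simpa using hρ0.le)
        have h2 := abs_le.1 ((re_mul_conj_ge (t₀ + ρ - t₀) (γ.unit_speed t₀)).trans h1)
        rw [add_sub_cancel_left, abs_of_pos hρ0] at h2
        linarith [h2.1])
      (by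
        have h1 := hρ.norm_sub_sub_le (c := t₀) (x := t₀ - ρ) (y := t₀)
          (by simp [abs_of_pos hρ0]) (by simpa using hρ0.le)
        have h2 := abs_le.1 ((re_mul_conj_ge (t₀ - ρ - t₀) (γ.unit_speed t₀)).trans h1)
        rw [sub_sub_cancel_left, abs_neg, abs_of_pos hρ0] at h2
        linarith [h2.2])
    refine ⟨(s, v), fun _ => ⟨hs, ?_, rfl⟩⟩
    have h3 := (hρ.abs_le_norm_shear_sub (t₀ := t₀) (s' := t₀) hs (by simpa using hρ0.le) v 0).2
    have h4 : γ.shear t₀ t₀ 0 = γ.toFun t₀ := by simp [shear]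
    rw [h4, sub_zero] at h3
    have : 9 / 10 * |v| < 9 / 10 * ρ := lt_of_le_of_lt h3 hz
    linarith
  choose p hp using hcoord
  -- A primitive of `f`: integrate along the curve to the foot, then in the direction `iτ` to `z`.
  -- By `hrect` its increments may be taken along the translate through `z`. Then `f = G'` is
  -- holomorphic.
  set G : ℂ → ℂ := fun z => (∫ x in t₀..(p z).1, f (γ.shear t₀ x 0) * deriv γ.toFun x) +
    I * τ * ∫ y in (0 : ℝ)..(p z).2, f (γ.shear t₀ (p z).1 y) with hG
  have hi1 : ∀ v a b, IntervalIntegrable (fun x => f (γ.shear t₀ x v) * deriv γ.toFun x)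
      volume a b := fun v a b =>
    ((hf.comp (hsh.comp (continuous_id.prodMk continuous_const))).mul hdc).intervalIntegrable _ _
  have hi2 : ∀ s a b, IntervalIntegrable (fun y => f (γ.shear t₀ s y)) volume a b := fun s a b =>
    (hf.comp (hsh.comp (continuous_const.prodMk continuous_id))).intervalIntegrable _ _
  have hsq : 0 < 9 / 10 * ρ := by positivity
  have hderiv : ∀ z ∈ Metric.ball (γ.toFun t₀) (9 / 10 * ρ), HasDerivAt G (f z) z := by
    intro z hz
    rw [Metric.mem_ball, dist_eq_norm] at hz
    obtain ⟨hs, hv, hzs⟩ := hp z hz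
    rw [hasDerivAt_iff_isLittleO, Asymptotics.isLittleO_iff]
    intro ε hε
    -- Each coordinate moves by at most `10 / 9` of `‖z' - z‖`, so the path has length at most `20 /
    -- 9` of it. The factors `1 / 4` in `ε / 4` and `d / 4` absorb this.
    obtain ⟨d, hd0, hfd⟩ := Metric.continuousAt_iff.1 (hf.continuousAt (x := z)) (ε / 4)
      (by positivity)
    have hnear : ∀ᶠ z' in 𝓝 z, ‖z' - γ.toFun t₀‖ < 9 / 10 * ρ :=
      (show ContinuousAt (fun z' => ‖z' - γ.toFun t₀‖) z by fun_prop).eventually_lt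
        continuousAt_const hz
    have hnear' : ∀ᶠ z' in 𝓝 z, ‖z' - z‖ < d / 4 :=
      (show ContinuousAt (fun z' => ‖z' - z‖) z by fun_prop).eventually_lt
        continuousAt_const (by simpa using hd0)
    filter_upwards [hnear, hnear'] with z' hz' hz'd
    obtain ⟨hs', hv', hzs'⟩ := hp z' hz'
    set s := (p z).1
    set v := (p z).2
    set s' := (p z').1
    set v' := (p z').2
    have hb := hδ.abs_le_norm_shear_sub (hs'.trans hρδ) (hs.trans hρδ) v' v
    rw [← hzs, ← hzs'] at hb
    have e1 : G z' - G z = (∫ x in s..s', f (γ.shear t₀ x v) * deriv γ.toFun x) +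
        I * τ * ∫ y in v..v', f (γ.shear t₀ s' y) := by
      have r1 := hrect s s' v hs hs' hv
      rw [intervalIntegral.integral_sub (hi2 _ _ _) (hi2 _ _ _)] at r1
      have r2 := intervalIntegral.integral_add_adjacent_intervals (hi1 0 t₀ s) (hi1 0 s s')
      have r3 := intervalIntegral.integral_add_adjacent_intervals (hi2 s' 0 v) (hi2 s' v v')
      simp only [hG]
      rw [← r2, ← r3]
      linear_combination r1
    have e2 : z' - z = (∫ x in s..s', deriv γ.toFun x) + I * τ * ∫ _ in v..v', (1 : ℂ) := by
      rw [intervalIntegral.integral_eq_sub_of_hasDerivAt (fun x _ => γ.hasDerivAt x)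
        (hdc.intervalIntegrable _ _), intervalIntegral.integral_const, hzs, hzs']
      simp only [shear, real_smul]
      push_cast
      ring
    have e3 : G z' - G z - (z' - z) • f z =
        (∫ x in s..s', (f (γ.shear t₀ x v) - f z) * deriv γ.toFun x) +
        I * τ * ∫ y in v..v', (f (γ.shear t₀ s' y) - f z) := by
      simp_rw [sub_mul]
      rw [e1, e2, intervalIntegral.integral_sub (hi1 _ _ _)
        ((hdc.intervalIntegrable _ _).const_mul _), intervalIntegral.integral_const_mul,
        intervalIntegral.integral_sub (hi2 _ _ _) intervalIntegrable_const,
        smul_eq_mul, intervalIntegral.integral_const, intervalIntegral.integral_const]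
      simp only [real_smul]
      ring
    have hA : |s' - s| ≤ 10 / 9 * ‖z' - z‖ := by linarith [hb.1]
    have hB : |v' - v| ≤ 10 / 9 * ‖z' - z‖ := by linarith [hb.2]
    have n1 : ‖∫ x in s..s', (f (γ.shear t₀ x v) - f z) * deriv γ.toFun x‖ ≤
        ε / 4 * |s' - s| := by
      refine intervalIntegral.norm_integral_le_of_norm_le_const fun x hx => ?_
      rw [norm_mul, γ.unit_speed, mul_one]
      have h1 := γ.norm_shear_sub_le t₀ x v s v
      rw [← hzs, sub_self, abs_zero, add_zero] at h1
      have h2 := abs_sub_left_of_mem_uIcc (uIoc_subset_uIcc hx)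
      have h3 := hfd (x := γ.shear t₀ x v) (by rw [dist_eq_norm]; linarith)
      rw [dist_eq_norm] at h3
      exact h3.le
    have n2 : ‖∫ y in v..v', (f (γ.shear t₀ s' y) - f z)‖ ≤ ε / 4 * |v' - v| := by
      refine intervalIntegral.norm_integral_le_of_norm_le_const fun y hy => ?_
      have h1 := γ.norm_shear_sub_le t₀ s' y s v
      rw [← hzs] at h1
      have h2 := abs_sub_left_of_mem_uIcc (uIoc_subset_uIcc hy)
      have h3 := hfd (x := γ.shear t₀ s' y) (by rw [dist_eq_norm]; linarith)
      rw [dist_eq_norm] at h3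
      exact h3.le
    rw [e3]
    refine (norm_add_le _ _).trans ?_
    rw [norm_mul, norm_mul, norm_I, hτ, γ.unit_speed, one_mul, one_mul]
    have hn := norm_nonneg (z' - z)
    nlinarith
  have hGd : DifferentiableOn ℂ G (Metric.ball (γ.toFun t₀) (9 / 10 * ρ)) := fun z hz =>
    (hderiv z hz).differentiableAt.differentiableWithinAt
  have hmem := Metric.ball_mem_nhds (γ.toFun t₀) hsq
  refine ((hGd.deriv Metric.isOpen_ball).differentiableAt hmem).congr_of_eventuallyEq ?_
  filter_upwards [hmem] with z hz
  exact (hderiv z hz).deriv.symm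

end SmoothCurve

/-! ### Removing jumps, and Liouville's theorem across the curve. -/

namespace SmoothCurve

variable {γ : SmoothCurve}

/-- Equal boundary values from both sides are an unrestricted limit off the curve. -/
theorem tendsto_of_boundaryValues {E : Type*} [TopologicalSpace E] {f : ℂ → E} {t : ℝ} {V : E}
    (ht : t ∈ γ.dom) (hend : t ∉ γ.endParams) (hpos : γ.PosBoundaryValue f t V)
    (hneg : γ.NegBoundaryValue f t V) : Tendsto f (𝓝[γ.imageᶜ] (γ.toFun t)) (𝓝 V) := by
  obtain ⟨D, hD⟩ := exists_isChart ht
  intro S hS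
  suffices h : ∀ᶠ p : ℝ × ℝ in 𝓝 (t, 0), γ.normalPoint p.1 p.2 ∈ γ.imageᶜ →
      γ.normalPoint p.1 p.2 ∈ f ⁻¹' S from
    mem_nhdsWithin_iff_eventually.2 (le_map_normalPoint t h)
  have h1 : ∀ᶠ p : ℝ × ℝ in 𝓝 t ×ˢ 𝓝[≠] (0 : ℝ), γ.normalPoint p.1 p.2 ∈ f ⁻¹' S := by
    rw [← nhdsLT_sup_nhdsGT, prod_sup, eventually_sup]
    exact ⟨hneg hS, hpos hS⟩
  have h2 : ∀ᶠ p : ℝ × ℝ in 𝓝 (t, 0), p.2 ≠ 0 → γ.normalPoint p.1 p.2 ∈ f ⁻¹' S := by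
    have h3 : 𝓝 t ×ˢ 𝓝[≠] (0 : ℝ) = 𝓝[univ ×ˢ {0}ᶜ] (t, (0 : ℝ)) := by
      rw [nhdsWithin_prod_eq, nhdsWithin_univ]
    rw [h3, eventually_nhdsWithin_iff] at h1
    filter_upwards [h1] with p hp hp0
    exact hp ⟨mem_univ _, hp0⟩
  -- Away from the endpoints every foot near `t` lies in the chart, so height zero would put the
  -- point on the curve. Positive and negative heights thus exhaust the points off the curve.
  have h4 : ∀ᶠ p : ℝ × ℝ in 𝓝 (t, 0), p.1 ∈ D :=
    (continuous_fst.tendsto (t, (0 : ℝ))) (hD.nhds hend)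
  filter_upwards [h2, h4] with p hp1 hp2 hp3
  refine hp1 fun h0 => hp3 ?_
  rw [h0, normalPoint_zero, ← hD.image_eq]
  exact mem_image_of_mem _ hp2

/-- Near `γ(t)` the curve consists of a short arc only, so continuation across that arc suffices. -/
theorem eventually_notMem_image {t : ℝ} (ht : t ∈ γ.dom) {η : ℝ} (hη : 0 < η) :
    ∀ᶠ z in 𝓝 (γ.toFun t), z ∉ γ.toFun '' Icc (t - η) (t + η) → z ∉ γ.image := by
  obtain ⟨D, hD⟩ := exists_isChart ht
  obtain ⟨c, hc, h⟩ := hD.exists_le_norm_sub hη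
  filter_upwards [Metric.ball_mem_nhds _ hc] with z hz hnot hmem
  rw [← hD.image_eq] at hmem
  obtain ⟨s, hs, rfl⟩ := hmem
  rw [Metric.mem_ball, dist_eq_norm] at hz
  have h1 : |s - t| < η := by
    by_contra hlt
    exact absurd (h s hs (not_lt.1 hlt)) (not_le.2 hz)
  have := abs_lt.1 h1
  exact hnot (mem_image_of_mem _ ⟨by linarith, by linarith⟩)

/-- A function that is holomorphic off the curve, has limits at all points of the curve, and
converges at infinity, is constant. -/
theorem eq_of_tendsto {f : ℂ → ℂ} (hf : DifferentiableOn ℂ f γ.imageᶜ)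
    (hlim : ∀ t ∈ γ.dom, ∃ V, Tendsto f (𝓝[γ.imageᶜ] (γ.toFun t)) (𝓝 V)) {c : ℂ}
    (hinf : Tendsto f γ.atInfinity (𝓝 c)) {z : ℂ} (hz : z ∉ γ.image) : f z = c := by
  have hopen : IsOpen γ.imageᶜ := γ.isClosed_image.isOpen_compl
  have hdense := γ.dense_compl_image
  set F := extendFrom γ.imageᶜ f with hF
  have heq : ∀ z ∈ γ.imageᶜ, F z = f z := fun z hz =>
    extendFrom_eq (subset_closure hz) (hf.continuousOn z hz)
  have hc : Continuous F := continuous_extendFrom hdense fun x => by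
    by_cases hx : x ∈ γ.image
    · obtain ⟨t, ht, rfl⟩ := hx
      exact hlim t ht
    · exact ⟨f x, hf.continuousOn x hx⟩
  have hd0 : ∀ z ∉ γ.image, DifferentiableAt ℂ F z := fun z hz => by
    refine (hf.differentiableAt (hopen.mem_nhds hz)).congr_of_eventuallyEq ?_
    filter_upwards [hopen.mem_nhds hz] with w hw
    exact heq w hw
  have hd : Differentiable ℂ F := fun z => by
    by_cases hz : z ∈ γ.image
    · obtain ⟨t, ht, rfl⟩ := hz
      refine differentiableAt_of_continuous hc fun η hη => ?_
      filter_upwards [eventually_notMem_image ht hη] with w hw hw'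
      exact hd0 w (hw hw')
    · exact hd0 z hz
  have hFinf : Tendsto F (Filter.cocompact ℂ) (𝓝 c) := by
    rw [← Metric.cobounded_eq_cocompact, Metric.tendsto_nhds]
    intro ε hε
    have h1 : ∀ᶠ z in γ.atInfinity, dist (f z) c < ε / 2 :=
      Metric.tendsto_nhds.1 hinf (ε / 2) (half_pos hε)
    rw [atInfinity, eventually_inf_principal, ← comap_norm_atTop, eventually_comap,
      eventually_atTop] at h1
    obtain ⟨R, hR⟩ := h1
    rw [← comap_norm_atTop, eventually_comap]
    filter_upwards [eventually_gt_atTop R] with r hr z hz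
    have hzR : z ∈ {w : ℂ | R < ‖w‖} := by
      show R < ‖z‖
      rw [hz]; exact hr
    have hopenR : IsOpen {w : ℂ | R < ‖w‖} := isOpen_lt continuous_const continuous_norm
    -- The limit at infinity is known only off the curve. Density of the complement and continuity
    -- of the extension transfer it to points of the curve.
    have hcl : z ∈ closure ({w : ℂ | R < ‖w‖} ∩ γ.imageᶜ) :=
      hdense.open_subset_closure_inter hopenR hzR
    have hsub : {w : ℂ | R < ‖w‖} ∩ γ.imageᶜ ⊆ {w | dist (F w) c ≤ ε / 2} := fun w hw => by
      show dist (F w) c ≤ ε / 2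
      rw [heq w hw.2]
      exact (hR ‖w‖ (le_of_lt hw.1) w rfl hw.2).le
    have hclosed : IsClosed {w | dist (F w) c ≤ ε / 2} :=
      isClosed_le (by fun_prop) continuous_const
    have : dist (F z) c ≤ ε / 2 := closure_minimal hsub hclosed hcl
    linarith
  rw [← heq z hz]
  exact hd.apply_eq_of_tendsto_cocompact z hFinf

end SmoothCurve

/-! ### Sums and products of locally Hölder functions. -/

namespace HolderNear

theorem mono_exponent {f : ℝ → ℂ} {t₀ : ℝ} {α β C η : ℝ} (hβ : 0 < β) (hle : β ≤ α)
    (hC : 0 ≤ C) (hη : η ≤ 1 / 2)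
    (h : ∀ s t : ℝ, |s - t₀| ≤ η → |t - t₀| ≤ η → ‖f s - f t‖ ≤ C * |s - t| ^ α) :
    ∀ s t : ℝ, |s - t₀| ≤ η → |t - t₀| ≤ η → |s - t| ≤ 1 ∧ ‖f s - f t‖ ≤ C * |s - t| ^ β := by
  intro s t hs ht
  have h1 : |s - t| ≤ 1 := by
    have := abs_sub_le s t₀ t
    rw [abs_sub_comm t₀] at this
    linarith
  refine ⟨h1, (h s t hs ht).trans ?_⟩
  exact mul_le_mul_of_nonneg_left (Real.rpow_le_rpow_of_exponent_ge_of_imp (abs_nonneg _) h1 hle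
    fun _ h0 => absurd h0 (hβ.trans_le hle).ne') hC

/-- In a neighbourhood of diameter at most one, the smaller exponent serves both functions. -/
theorem common {f g : ℝ → ℂ} {t₀ : ℝ} (hf : HolderNear f t₀) (hg : HolderNear g t₀) :
    ∃ α > 0, ∃ C ≥ 0, ∃ η > 0, ∀ s t : ℝ, |s - t₀| ≤ η → |t - t₀| ≤ η → |s - t| ≤ 1 ∧
      ‖f s - f t‖ ≤ C * |s - t| ^ (α : ℝ) ∧ ‖g s - g t‖ ≤ C * |s - t| ^ (α : ℝ) := by
  obtain ⟨α, hα, C, hC, η, hη, hf⟩ := hf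
  obtain ⟨β, hβ, C', hC', η', hη', hg⟩ := hg
  refine ⟨min α β, lt_min hα hβ, C + C', by positivity, min (min η η') (1 / 2), by positivity,
    fun s t hs ht => ?_⟩
  have h1 := mono_exponent (lt_min hα hβ) (min_le_left α β) hC
    (min_le_right (min η η') (1 / 2)) (fun s t hs ht => hf s t
      (hs.trans ((min_le_left _ _).trans (min_le_left _ _)))
      (ht.trans ((min_le_left _ _).trans (min_le_left _ _)))) s t hs ht
  have h2 := mono_exponent (lt_min hα hβ) (min_le_right α β) hC'
    (min_le_right (min η η') (1 / 2)) (fun s t hs ht => hg s t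
      (hs.trans ((min_le_left _ _).trans (min_le_right _ _)))
      (ht.trans ((min_le_left _ _).trans (min_le_right _ _)))) s t hs ht
  refine ⟨h1.1, h1.2.trans ?_, h2.2.trans ?_⟩
  · gcongr; linarith
  · gcongr; linarith

theorem add {f g : ℝ → ℂ} {t₀ : ℝ} (hf : HolderNear f t₀) (hg : HolderNear g t₀) :
    HolderNear (fun t => f t + g t) t₀ := by
  obtain ⟨α, hα, C, hC, η, hη, h⟩ := common hf hg
  refine ⟨α, hα, C + C, by positivity, η, hη, fun s t hs ht => ?_⟩
  obtain ⟨-, h1, h2⟩ := h s t hs ht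
  rw [add_sub_add_comm, add_mul]
  exact (norm_add_le _ _).trans (add_le_add h1 h2)

theorem mul {f g : ℝ → ℂ} {t₀ : ℝ} (hf : HolderNear f t₀) (hg : HolderNear g t₀) :
    HolderNear (fun t => f t * g t) t₀ := by
  obtain ⟨α, hα, C, hC, η, hη, h⟩ := common hf hg
  have hη0 : |t₀ - t₀| ≤ η := by simpa using hη.le
  have hb : ∀ s, |s - t₀| ≤ η → ‖f s‖ ≤ ‖f t₀‖ + C ∧ ‖g s‖ ≤ ‖g t₀‖ + C := fun s hs => by
    obtain ⟨h0, h1, h2⟩ := h s t₀ hs hη0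
    have h3 : C * |s - t₀| ^ α ≤ C * 1 := by
      gcongr
      exact Real.rpow_le_one (abs_nonneg _) h0 hα.le
    have h4 := norm_sub_norm_le (f s) (f t₀)
    have h5 := norm_sub_norm_le (g s) (g t₀)
    constructor <;> linarith
  refine ⟨α, hα, (‖f t₀‖ + C) * C + (‖g t₀‖ + C) * C, by positivity, η, hη, fun s t hs ht => ?_⟩
  obtain ⟨-, h1, h2⟩ := h s t hs ht
  have e : f s * g s - f t * g t = f s * (g s - g t) + g t * (f s - f t) := by ring
  rw [e]
  refine (norm_add_le _ _).trans ?_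
  rw [norm_mul, norm_mul]
  calc _ ≤ (‖f t₀‖ + C) * (C * |s - t| ^ α) + (‖g t₀‖ + C) * (C * |s - t| ^ α) := by
        gcongr
        · exact (hb s hs).1
        · exact (hb t ht).2
    _ = _ := by ring

theorem const (a : ℂ) (t₀ : ℝ) : HolderNear (fun _ => a) t₀ :=
  ⟨1, one_pos, 0, le_rfl, 1, one_pos, fun s t _ _ => by simp⟩

theorem toFun (γ : SmoothCurve) (t₀ : ℝ) : HolderNear γ.toFun t₀ :=
  ⟨1, one_pos, 1, zero_le_one, 1, one_pos, fun s t _ _ => by simpa using γ.norm_toFun_sub_le s t⟩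

end HolderNear

/-! ### Admissible densities, closed under multiplication by polynomials. -/

namespace SmoothCurve

variable {γ : SmoothCurve}

/-- The densities on the curve whose Cauchy transforms are considered: finite moments, local
Hölder continuity, rapid decrease, and value zero at the endpoints. -/
structure IsAdmissible (γ : SmoothCurve) (f : ℂ → ℂ) : Prop where
  integrable : ∀ k : ℕ, IntegrableOn
    (fun t => deriv γ.toFun t * (γ.toFun t ^ k * f (γ.toFun t))) γ.dom
  holder : ∀ t D, γ.IsChart t D → HolderNear (D.indicator fun s => f (γ.toFun s)) t
  decay : InjOn γ.toFun γ.dom → DecayHolder (γ.dom.indicator fun s => f (γ.toFun s))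
  zero_at_ends : ∀ t ∈ γ.endParams, f (γ.toFun t) = 0

theorem integrableOn_of_deriv_mul {h : ℝ → ℂ} {S : Set ℝ}
    (hh : IntegrableOn (fun t => deriv γ.toFun t * h t) S) : IntegrableOn h S := by
  have h1 : Continuous fun t => (deriv γ.toFun t)⁻¹ := γ.continuous_deriv.inv₀ γ.deriv_ne_zero
  have := Integrable.bdd_mul (c := 1) hh (h1.aestronglyMeasurable)
    (Eventually.of_forall fun t => by rw [norm_inv, γ.unit_speed, inv_one])
  refine this.congr (Eventually.of_forall fun t => ?_)
  exact inv_mul_cancel_left₀ (γ.deriv_ne_zero t) _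

namespace IsAdmissible

variable {f g : ℂ → ℂ}

theorem add (hf : γ.IsAdmissible f) (hg : γ.IsAdmissible g) :
    γ.IsAdmissible fun z => f z + g z where
  integrable k := by
    refine ((hf.integrable k).add (hg.integrable k)).congr (Eventually.of_forall fun t => ?_)
    simp only [Pi.add_apply]; ring
  holder t D hD := by
    convert (hf.holder t D hD).add (hg.holder t D hD) using 1
    exact indicator_add _ _ _
  decay h := by
    convert (hf.decay h).add (hg.decay h) using 1
    exact indicator_add _ _ _
  zero_at_ends t ht := by rw [hf.zero_at_ends t ht, hg.zero_at_ends t ht, add_zero]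

theorem const_mul (hf : γ.IsAdmissible f) (a : ℂ) : γ.IsAdmissible fun z => a * f z where
  integrable k := by
    refine ((hf.integrable k).const_mul a).congr (Eventually.of_forall fun t => ?_)
    ring
  holder t D hD := by
    convert (HolderNear.const a t).mul (hf.holder t D hD) using 1
    ext s
    by_cases hs : s ∈ D <;> simp [hs]
  decay h := by
    convert (hf.decay h).const_mul a using 1
    ext s
    by_cases hs : s ∈ γ.dom <;> simp [hs]
  zero_at_ends t ht := by rw [hf.zero_at_ends t ht, mul_zero]

theorem id_mul (hf : γ.IsAdmissible f) : γ.IsAdmissible fun z => z * f z where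
  integrable k := by
    refine (hf.integrable (k + 1)).congr (Eventually.of_forall fun t => ?_)
    ring
  holder t D hD := by
    convert (HolderNear.toFun γ t).mul (hf.holder t D hD) using 1
    ext s
    by_cases hs : s ∈ D <;> simp [hs]
  decay h := by
    convert (hf.decay h).toFun_mul γ using 1
    ext s
    by_cases hs : s ∈ γ.dom <;> simp [hs]
  zero_at_ends t ht := by rw [hf.zero_at_ends t ht, mul_zero]

theorem pow_mul (hf : γ.IsAdmissible f) (k : ℕ) : γ.IsAdmissible fun z => z ^ k * f z := by
  induction k with
  | zero => simpa using hf
  | succ k ih => simpa only [pow_succ', mul_assoc] using ih.id_mul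

theorem sum {ι : Type*} (s : Finset ι) {f : ι → ℂ → ℂ} (h0 : γ.IsAdmissible g)
    (hf : ∀ i ∈ s, γ.IsAdmissible (f i)) : γ.IsAdmissible fun z => ∑ i ∈ s, f i z := by
  classical
  induction s using Finset.induction_on with
  | empty => simpa using h0.const_mul 0
  | insert a s ha ih =>
    simp only [Finset.sum_insert ha]
    exact (hf a (Finset.mem_insert_self _ _)).add
      (ih fun i hi => hf i (Finset.mem_insert_of_mem hi))

end IsAdmissible

theorem exists_mem_frontier {S : Set ℝ} {s t : ℝ} (hs : s ∈ S) (ht : t ∉ S) :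
    ∃ e ∈ frontier S, |s - e| ≤ |s - t| := by
  obtain ⟨e, he, hef⟩ := isPreconnected_closed_iff.1 (isPreconnected_uIcc (a := s) (b := t))
    (closure S) (closure Sᶜ) isClosed_closure isClosed_closure
    (fun x _ => (em (x ∈ S)).imp (fun h => subset_closure h) fun h => subset_closure h)
    ⟨s, left_mem_uIcc, subset_closure hs⟩ ⟨t, right_mem_uIcc, subset_closure ht⟩
  rw [← frontier_eq_closure_inter_closure] at hef
  refine ⟨e, hef, ?_⟩
  have := abs_sub_left_of_mem_uIcc he
  rw [abs_sub_comm s e, abs_sub_comm s t]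
  exact this

/-- The extension by zero remains Hölder with the same constant: between a parameter inside `dom`
and one outside lies an endpoint, where `f` vanishes. -/
theorem norm_indicator_sub_le (hinj : InjOn γ.toFun γ.dom) {f : ℂ → ℂ} {K α : ℝ≥0} (hα : 0 < α)
    (hf : HolderOnWith K α f γ.image) (hends : ∀ t ∈ γ.endParams, f (γ.toFun t) = 0) (s t : ℝ) :
    ‖γ.dom.indicator (fun s => f (γ.toFun s)) s - γ.dom.indicator (fun s => f (γ.toFun s)) t‖ ≤
      K * |s - t| ^ (α : ℝ) := by
  have h : ∀ s ∈ γ.dom, ∀ t ∈ γ.dom, ‖f (γ.toFun s) - f (γ.toFun t)‖ ≤ K * |s - t| ^ (α : ℝ) := by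
    intro s hs t ht
    have := hf.dist_le (mem_image_of_mem γ.toFun hs) (mem_image_of_mem γ.toFun ht)
    rw [dist_eq_norm, dist_eq_norm] at this
    refine this.trans ?_
    gcongr
    exact γ.norm_toFun_sub_le s t
  have h' : ∀ s ∈ γ.dom, ∀ t ∉ γ.dom, ‖f (γ.toFun s)‖ ≤ K * |s - t| ^ (α : ℝ) := by
    intro s hs t ht
    obtain ⟨e, he, hle⟩ := exists_mem_frontier hs ht
    have h1 := h s hs e (γ.isClosed_dom.frontier_subset he)
    rw [hends e ⟨he, hinj⟩, sub_zero] at h1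
    refine h1.trans ?_
    gcongr
  by_cases hs : s ∈ γ.dom <;> by_cases ht : t ∈ γ.dom
  · simpa [hs, ht] using h s hs t ht
  · simpa [hs, ht] using h' s hs t ht
  · simpa [hs, ht, abs_sub_comm] using h' t ht s hs
  · simp only [hs, ht, not_false_eq_true, indicator_of_notMem, sub_self, norm_zero]
    positivity

/-- Converts moments in the position `γ(t)` into moments in arc length: by the growth condition `(1
+ |t|)^M` is controlled by powers of `‖γ(t)‖` up to `m M`. -/
theorem integrable_weight {f : ℂ → ℂ} (hint : ∀ k : ℕ, IntegrableOn
    (fun t => deriv γ.toFun t * (γ.toFun t ^ k * f (γ.toFun t))) γ.dom) (M : ℕ) :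
    Integrable fun t => (1 + |t|) ^ M * ‖γ.dom.indicator (fun s => f (γ.toFun s)) t‖ := by
  obtain ⟨A, m, hg⟩ := γ.growth
  have hms := γ.isClosed_dom.measurableSet
  have h0 : IntegrableOn (fun t => f (γ.toFun t)) γ.dom := by
    simpa using integrableOn_of_deriv_mul (hint 0)
  have h1 := integrableOn_of_deriv_mul (hint (m * M))
  have key : IntegrableOn (fun t => (1 + |t|) ^ M * ‖f (γ.toFun t)‖) γ.dom := by
    refine Integrable.mono' ((h0.norm.add h1.norm).const_mul ((1 + |A|) ^ M * 2 ^ (m * M)))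
      ?_ ((ae_restrict_iff' hms).2 (Eventually.of_forall fun t ht => ?_))
    · exact (by fun_prop : Continuous fun t : ℝ => (1 + |t|) ^ M).aestronglyMeasurable.mul
        h0.norm.aestronglyMeasurable
    · simp only [Pi.add_apply]
      rw [Real.norm_of_nonneg (by positivity), norm_mul, norm_pow]
      have hx := norm_nonneg (γ.toFun t)
      have e1 : 1 + |t| ≤ (1 + |A|) * (1 + ‖γ.toFun t‖) ^ m := by
        have h2 := hg t ht
        have h3 : 1 ≤ (1 + ‖γ.toFun t‖) ^ m := one_le_pow₀ (by linarith)
        have h4 := le_abs_self A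
        nlinarith
      have e2 : (1 + ‖γ.toFun t‖) ^ (m * M) ≤
          2 ^ (m * M) * (1 + ‖γ.toFun t‖ ^ (m * M)) := by
        refine (add_pow_le zero_le_one hx _).trans ?_
        rw [one_pow]
        gcongr
        · norm_num
        · omega
      calc (1 + |t|) ^ M * ‖f (γ.toFun t)‖
          ≤ ((1 + |A|) * (1 + ‖γ.toFun t‖) ^ m) ^ M * ‖f (γ.toFun t)‖ := by gcongr
        _ = (1 + |A|) ^ M * (1 + ‖γ.toFun t‖) ^ (m * M) * ‖f (γ.toFun t)‖ := by
          rw [mul_pow, ← pow_mul]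
        _ ≤ (1 + |A|) ^ M * (2 ^ (m * M) * (1 + ‖γ.toFun t‖ ^ (m * M))) * ‖f (γ.toFun t)‖ := by
          gcongr
        _ = _ := by ring
  have := (integrable_indicator_iff hms).2 key
  refine this.congr (Eventually.of_forall fun t => ?_)
  by_cases ht : t ∈ γ.dom <;> simp [ht]

theorem isAdmissible_of_holder {f : ℂ → ℂ} {K α : ℝ≥0} (hα : 0 < α) (hα1 : α ≤ 1)
    (hf : HolderOnWith K α f γ.image) (hint : ∀ k : ℕ, IntegrableOn
      (fun t => deriv γ.toFun t * (γ.toFun t ^ k * f (γ.toFun t))) γ.dom)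
    (hends : ∀ t ∈ γ.endParams, f (γ.toFun t) = 0) : γ.IsAdmissible f where
  integrable := hint
  holder t D hD := by
    by_cases ht : t ∈ γ.endParams
    · rw [hD.eq_dom ht]
      exact ⟨α, hα, K, K.2, 1, one_pos, fun s t _ _ =>
        norm_indicator_sub_le ht.2 hα hf hends s t⟩
    · obtain ⟨r, hr, hsub⟩ := Metric.mem_nhds_iff.1 (hD.nhds ht)
      have hmem : ∀ s, |s - t| ≤ r / 2 → s ∈ D := fun s hs =>
        hsub (by rw [Metric.mem_ball, Real.dist_eq]; linarith)
      refine ⟨α, hα, K, K.2, r / 2, half_pos hr, fun s u hs hu => ?_⟩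
      have hs' := hmem s hs
      have hu' := hmem u hu
      rw [indicator_of_mem hs', indicator_of_mem hu']
      have := hf.dist_le (hD.image_eq ▸ mem_image_of_mem γ.toFun hs')
        (hD.image_eq ▸ mem_image_of_mem γ.toFun hu')
      rw [dist_eq_norm, dist_eq_norm] at this
      refine this.trans ?_
      gcongr
      exact γ.norm_toFun_sub_le s u
  decay hinj := DecayHolder.of_integrable (by exact_mod_cast hα) (by exact_mod_cast hα1) K.2
    (norm_indicator_sub_le hinj hα hf hends) (integrable_weight hint)
  zero_at_ends := hends

end SmoothCurve

/-! ### The scalar Cauchy transform and its expansion at infinity. -/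

theorem cauchyConst_mul : cauchyConst * (2 * Real.pi * I) = 1 := by
  rw [cauchyConst, one_div]
  exact inv_mul_cancel₀ two_pi_I_ne_zero

namespace SmoothCurve

variable {γ : SmoothCurve}

/-- The Cauchy transform `(1 / 2πi) ∫_γ f(ζ) / (ζ - z) dζ`. -/
noncomputable def cauchyTransform (γ : SmoothCurve) (f : ℂ → ℂ) (z : ℂ) : ℂ :=
  cauchyConst * ∫ t in γ.dom, deriv γ.toFun t * ((γ.toFun t - z)⁻¹ * f (γ.toFun t))

/-- The moment `(1 / 2πi) ∫_γ ζ^k f(ζ) dζ`. -/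
noncomputable def lineMoment (γ : SmoothCurve) (f : ℂ → ℂ) (k : ℕ) : ℂ :=
  cauchyConst * ∫ t in γ.dom, deriv γ.toFun t * (γ.toFun t ^ k * f (γ.toFun t))

theorem IsChart.cauchyTransform_eq {t : ℝ} {D : Set ℝ} (hD : γ.IsChart t D) (f : ℂ → ℂ) :
    γ.cauchyTransform f = fun z => cauchyConst *
      γ.cauchyIntegral (D.indicator fun s => f (γ.toFun s)) z := by
  ext z
  rw [cauchyTransform, hD.setIntegral_add_eq fun ζ => (ζ - z)⁻¹ * f ζ, cauchyIntegral]
  congr 3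
  ext s
  by_cases hs : s ∈ D <;> simp [hs]

theorem exists_mem_dom (γ : SmoothCurve) : ∃ t, t ∈ γ.dom :=
  let ⟨t, ht⟩ := γ.nonempty_interior_dom
  ⟨t, interior_subset ht⟩

theorem IsChart.toFun_mem_of_indicator_ne_zero {t : ℝ} {D : Set ℝ} (hD : γ.IsChart t D)
    {f : ℝ → ℂ} (s : ℝ) (hs : D.indicator f s ≠ 0) : γ.toFun s ∈ γ.image := by
  rw [← hD.image_eq]
  exact mem_image_of_mem _ (mem_of_indicator_ne_zero hs)

namespace IsAdmissible

variable {f : ℂ → ℂ}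

theorem integrable_indicator (hf : γ.IsAdmissible f) {t : ℝ} {D : Set ℝ} (hD : γ.IsChart t D) :
    Integrable (D.indicator fun s => f (γ.toFun s)) := by
  have h1 := hf.integrable 0
  simp only [pow_zero, one_mul] at h1
  exact (integrable_indicator_iff hD.isClosed.measurableSet).2
    (integrableOn_of_deriv_mul ((hD.integrableOn_iff f).1 h1))

theorem differentiableOn (hf : γ.IsAdmissible f) :
    DifferentiableOn ℂ (γ.cauchyTransform f) γ.imageᶜ := by
  obtain ⟨t, ht⟩ := γ.exists_mem_dom
  obtain ⟨D, hD⟩ := exists_isChart ht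
  rw [hD.cauchyTransform_eq]
  exact (differentiableOn_cauchyIntegral (hf.integrable_indicator hD)
    hD.toFun_mem_of_indicator_ne_zero).const_mul _

theorem exists_boundaryValue (hf : γ.IsAdmissible f) {t : ℝ} (ht : t ∈ γ.dom) :
    ∃ Vp Vm, γ.PosBoundaryValue (γ.cauchyTransform f) t Vp ∧
      γ.NegBoundaryValue (γ.cauchyTransform f) t Vm ∧ Vp = Vm + f (γ.toFun t) := by
  obtain ⟨D, hD⟩ := exists_isChart ht
  rw [hD.cauchyTransform_eq]
  obtain ⟨Vp, Vm, h1, h2, h3⟩ := hD.exists_boundaryValue (hf.integrable_indicator hD)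
    (fun s hs => indicator_of_notMem hs _) (hf.holder t D hD)
  refine ⟨cauchyConst * Vp, cauchyConst * Vm, Tendsto.const_mul _ h1, Tendsto.const_mul _ h2, ?_⟩
  rw [indicator_of_mem hD.mem] at h3
  rw [h3]
  linear_combination f (γ.toFun t) * cauchyConst_mul

theorem exists_tendsto (hf : γ.IsAdmissible f) {t : ℝ} (ht : t ∈ γ.endParams) :
    ∃ V, Tendsto (γ.cauchyTransform f) (𝓝[γ.imageᶜ] (γ.toFun t)) (𝓝 V) := by
  have hD := isChart_dom ht.2 (γ.isClosed_dom.frontier_subset ht.1)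
  rw [hD.cauchyTransform_eq]
  obtain ⟨V, hV⟩ := hD.exists_tendsto (hf.integrable_indicator hD)
    (fun s hs => indicator_of_notMem hs _) (hf.holder t _ hD)
    (by rw [indicator_of_mem hD.mem]; exact hf.zero_at_ends t ht)
  exact ⟨_, hV.const_mul cauchyConst⟩

theorem integrableOn_cauchy (hf : γ.IsAdmissible f) {z : ℂ} (hz : z ∉ γ.image) :
    IntegrableOn (fun t => deriv γ.toFun t * ((γ.toFun t - z)⁻¹ * f (γ.toFun t))) γ.dom := by
  obtain ⟨t, ht⟩ := γ.exists_mem_dom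
  obtain ⟨D, hD⟩ := exists_isChart ht
  rw [hD.integrableOn_iff fun ζ => (ζ - z)⁻¹ * f ζ,
    ← integrable_indicator_iff hD.isClosed.measurableSet]
  refine (integrable_cauchy (hf.integrable_indicator hD) hD.toFun_mem_of_indicator_ne_zero
    hz).congr (Eventually.of_forall fun s => ?_)
  by_cases hs : s ∈ D <;> simp [hs]

/-- Integrate `z / (ζ - z) = -1 + ζ / (ζ - z)` against the density. -/
theorem mul_cauchyTransform (hf : γ.IsAdmissible f) {z : ℂ} (hz : z ∉ γ.image) :
    z * γ.cauchyTransform f z =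
      -γ.lineMoment f 0 + γ.cauchyTransform (fun ζ => ζ * f ζ) z := by
  have h1 := hf.id_mul.integrableOn_cauchy hz
  have h2 := hf.integrable 0
  rw [cauchyTransform, cauchyTransform, lineMoment, mul_left_comm, ← integral_const_mul,
    ← mul_neg, ← mul_add, neg_add_eq_sub, ← integral_sub h1 h2]
  congr 1
  refine setIntegral_congr_fun γ.isClosed_dom.measurableSet fun t ht => ?_
  have h3 : γ.toFun t - z ≠ 0 := fun h0 => hz (sub_eq_zero.1 h0 ▸ mem_image_of_mem _ ht)
  field_simp
  ring

theorem lineMoment_pow_mul (f : ℂ → ℂ) (n k : ℕ) :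
    γ.lineMoment (fun ζ => ζ ^ n * f ζ) k = γ.lineMoment f (k + n) := by
  simp only [lineMoment, pow_add, mul_assoc]

/-- Each multiplication by `z` releases one moment, and the first `n` vanish. -/
theorem pow_mul_cauchyTransform (hf : γ.IsAdmissible f) {n : ℕ}
    (h0 : ∀ k < n, γ.lineMoment f k = 0) {z : ℂ} (hz : z ∉ γ.image) :
    z ^ n * γ.cauchyTransform f z = γ.cauchyTransform (fun ζ => ζ ^ n * f ζ) z := by
  induction n with
  | zero => simp
  | succ n ih =>
    rw [pow_succ', mul_assoc, ih fun k hk => h0 k (hk.trans n.lt_succ_self),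
      (hf.pow_mul n).mul_cauchyTransform hz, lineMoment_pow_mul, zero_add, h0 n n.lt_succ_self,
      neg_zero, zero_add]
    simp only [pow_succ', mul_assoc]

/-- For an injective parametrisation this is the uniform bound for rapidly decreasing densities. A
closed curve is compact, and once `z` is at distance one from it the kernel is bounded by one. -/
theorem isBounded_atInfinity (hf : γ.IsAdmissible f) :
    γ.cauchyTransform f =O[γ.atInfinity] fun _ => (1 : ℂ) := by
  rcases γ.simple with hinj | ⟨L, hL, hdom, -, -⟩
  · obtain ⟨t, ht⟩ := γ.exists_mem_dom
    have hD := isChart_dom hinj ht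
    obtain ⟨B, hB⟩ := exists_norm_cauchyIntegral_le (hf.integrable_indicator hD)
      hD.toFun_mem_of_indicator_ne_zero (hf.decay hinj)
    rw [hD.cauchyTransform_eq]
    refine Asymptotics.IsBigO.const_mul_left (Asymptotics.IsBigO.of_bound B ?_) _
    rw [atInfinity, eventually_inf_principal]
    exact Eventually.of_forall fun z hz => by simpa using hB z hz
  · have hcomp : IsCompact γ.image := by
      rw [image, hdom]
      exact isCompact_Icc.image γ.continuous_toFun
    obtain ⟨R, hR⟩ := hcomp.isBounded.exists_norm_le
    obtain ⟨t, ht⟩ := γ.exists_mem_dom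
    obtain ⟨D, hD⟩ := exists_isChart ht
    have hi := hf.integrable_indicator hD
    rw [hD.cauchyTransform_eq]
    refine Asymptotics.IsBigO.const_mul_left (Asymptotics.IsBigO.of_bound
      (∫ s, ‖D.indicator (fun s => f (γ.toFun s)) s‖) ?_) _
    refine Eventually.filter_mono (inf_le_left : γ.atInfinity ≤ Bornology.cobounded ℂ) ?_
    rw [← comap_norm_atTop, eventually_comap]
    filter_upwards [eventually_ge_atTop (R + 1)] with r hr z hz
    rw [norm_one, mul_one]
    refine (norm_integral_le_integral_norm _).trans (integral_mono_of_nonneg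
      (Eventually.of_forall fun _ => norm_nonneg _) hi.norm (Eventually.of_forall fun s => ?_))
    have := norm_integrand_le (γ := γ) (g := D.indicator fun s => f (γ.toFun s))
      hD.toFun_mem_of_indicator_ne_zero one_pos (z := z) (fun w hw => by
        have h1 := hR w hw
        have h2 := norm_sub_norm_le z w
        rw [norm_sub_rev] at h2
        linarith) s
    simpa using this

theorem isBigO_inv (hf : γ.IsAdmissible f) :
    γ.cauchyTransform f =O[γ.atInfinity] fun z => z⁻¹ := by
  have h1 : (fun z => z⁻¹ * (-γ.lineMoment f 0 + γ.cauchyTransform (fun ζ => ζ * f ζ) z))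
      =O[γ.atInfinity] fun z => z⁻¹ * 1 :=
    (Asymptotics.isBigO_refl _ _).mul
      ((Asymptotics.isBigO_const_const _ one_ne_zero _).add hf.id_mul.isBounded_atInfinity)
  simp only [mul_one] at h1
  refine h1.congr' ?_ EventuallyEq.rfl
  have h2 : ∀ᶠ z in γ.atInfinity, z ≠ 0 :=
    Eventually.filter_mono (inf_le_left : γ.atInfinity ≤ Bornology.cobounded ℂ)
      (Bornology.eventually_ne_cobounded 0)
  have h3 : ∀ᶠ z in γ.atInfinity, z ∉ γ.image := by
    rw [atInfinity, eventually_inf_principal]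
    exact Eventually.of_forall fun z hz => hz
  filter_upwards [h2, h3] with z hz0 hz
  rw [← hf.mul_cauchyTransform hz, inv_mul_cancel_left₀ hz0]

theorem isBigO_pow_mul (hf : γ.IsAdmissible f) {n : ℕ} (h0 : ∀ k < n, γ.lineMoment f k = 0) :
    (fun z => z ^ n * γ.cauchyTransform f z) =O[γ.atInfinity] fun z => z⁻¹ := by
  refine (hf.pow_mul n).isBigO_inv.congr' ?_ EventuallyEq.rfl
  rw [EventuallyEq, atInfinity, eventually_inf_principal]
  exact Eventually.of_forall fun z hz => (hf.pow_mul_cauchyTransform h0 hz).symm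

/-- One multiplication further, the `n`-th moment appears as minus the leading coefficient. For
orthogonal polynomials it is `(C n)⁻¹`, which normalises the corner block of the next fundamental
matrix. -/
theorem isBigO_pow_succ_mul (hf : γ.IsAdmissible f) {n : ℕ}
    (h0 : ∀ k < n, γ.lineMoment f k = 0) :
    (fun z => z ^ (n + 1) * γ.cauchyTransform f z + γ.lineMoment f n)
      =O[γ.atInfinity] fun z => z⁻¹ := by
  refine (hf.pow_mul (n + 1)).isBigO_inv.congr' ?_ EventuallyEq.rfl
  rw [EventuallyEq, atInfinity, eventually_inf_principal]
  refine Eventually.of_forall fun z hz => ?_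
  have h1 := (hf.pow_mul n).mul_cauchyTransform hz
  rw [lineMoment_pow_mul, zero_add, ← hf.pow_mul_cauchyTransform h0 hz] at h1
  rw [pow_succ', mul_assoc, h1]
  simp only [pow_succ', mul_assoc]
  ring

end IsAdmissible

end SmoothCurve

/-! ### Matrix polynomials and matrix functions of order `1 / z`. -/

variable {N : ℕ}

theorem evalAt_eq_sum (P : (Matrix (Fin N) (Fin N) ℂ)[X]) {n : ℕ} (hn : P.natDegree < n) (z : ℂ) :
    evalAt P z = ∑ k ∈ Finset.range n, z ^ k • P.coeff k := by
  rw [evalAt, Polynomial.eval_eq_sum_range' hn]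
  refine Finset.sum_congr rfl fun k _ => ?_
  rw [smul_pow, one_pow, mul_smul_comm, mul_one]

theorem evalAt_apply (P : (Matrix (Fin N) (Fin N) ℂ)[X]) {n : ℕ} (hn : P.natDegree < n) (z : ℂ)
    (i j : Fin N) : evalAt P z i j = ∑ k ∈ Finset.range n, z ^ k * P.coeff k i j := by
  rw [evalAt_eq_sum P hn, Matrix.sum_apply]
  rfl

theorem differentiable_evalAt (P : (Matrix (Fin N) (Fin N) ℂ)[X]) (i j : Fin N) :
    Differentiable ℂ fun z => evalAt P z i j := by
  simp_rw [evalAt_apply P (Nat.lt_succ_self _)]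
  fun_prop

theorem isAdmissible_weight {γ : SmoothCurve} {W : ℂ → Matrix (Fin N) (Fin N) ℂ}
    (hW : IsHolderWeight γ W) (i j : Fin N) : γ.IsAdmissible fun z => W z i j := by
  obtain ⟨K, α, hα, hα1, h⟩ := hW.holder i j
  refine SmoothCurve.isAdmissible_of_holder hα hα1 h (fun k => hW.integrable k i j) fun t ht => ?_
  rw [hW.zero_at_ends t ht]
  rfl

theorem isAdmissible_left {γ : SmoothCurve} {W : ℂ → Matrix (Fin N) (Fin N) ℂ}
    (hW : IsHolderWeight γ W) (P : (Matrix (Fin N) (Fin N) ℂ)[X]) (i j : Fin N) :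
    γ.IsAdmissible fun z => (evalAt P z * W z) i j := by
  simp_rw [Matrix.mul_apply, evalAt_apply P (Nat.lt_succ_self _), Finset.sum_mul]
  refine SmoothCurve.IsAdmissible.sum _ (isAdmissible_weight hW i j) fun l _ =>
    SmoothCurve.IsAdmissible.sum _ (isAdmissible_weight hW i j) fun k _ => ?_
  convert ((isAdmissible_weight hW l j).pow_mul k).const_mul (P.coeff k i l) using 2
  ring

theorem isAdmissible_right {γ : SmoothCurve} {W : ℂ → Matrix (Fin N) (Fin N) ℂ}
    (hW : IsHolderWeight γ W) (P : (Matrix (Fin N) (Fin N) ℂ)[X]) (i j : Fin N) :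
    γ.IsAdmissible fun z => (W z * evalAt P z) i j := by
  simp_rw [Matrix.mul_apply, evalAt_apply P (Nat.lt_succ_self _), Finset.mul_sum]
  refine SmoothCurve.IsAdmissible.sum _ (isAdmissible_weight hW i j) fun l _ =>
    SmoothCurve.IsAdmissible.sum _ (isAdmissible_weight hW i j) fun k _ => ?_
  convert ((isAdmissible_weight hW i l).pow_mul k).const_mul (P.coeff k l j) using 2
  ring

/-- Matrix functions all of whose entries are `O(1 / z)` at infinity off the curve. -/
def IsBigOInv {n : Type*} (γ : SmoothCurve) (X : ℂ → Matrix n n ℂ) : Prop :=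
  ∀ i j, (fun z => X z i j) =O[γ.atInfinity] fun z => z⁻¹

namespace SmoothCurve

variable (γ : SmoothCurve)

theorem eventually_ne_zero : ∀ᶠ z in γ.atInfinity, z ≠ 0 :=
  Eventually.filter_mono (inf_le_left : γ.atInfinity ≤ Bornology.cobounded ℂ)
    (Bornology.eventually_ne_cobounded 0)

theorem tendsto_inv_atInfinity : Tendsto (fun z : ℂ => z⁻¹) γ.atInfinity (𝓝 0) :=
  tendsto_inv₀_cobounded.mono_left inf_le_left

end SmoothCurve

namespace IsBigOInv

variable {γ : SmoothCurve} {n : Type*} {X Y : ℂ → Matrix n n ℂ}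

theorem tendsto (h : IsBigOInv γ X) : Tendsto X γ.atInfinity (𝓝 0) :=
  tendsto_pi_nhds.2 fun i => tendsto_pi_nhds.2 fun j =>
    (h i j).trans_tendsto γ.tendsto_inv_atInfinity

theorem neg (h : IsBigOInv γ X) : IsBigOInv γ fun z => -X z := fun i j => (h i j).neg_left

theorem zero : IsBigOInv γ fun _ => (0 : Matrix n n ℂ) := fun _ _ => Asymptotics.isBigO_zero _ _

theorem const_mul [Fintype n] (h : IsBigOInv γ X) (A : Matrix n n ℂ) :
    IsBigOInv γ fun z => A * X z := fun i j => by
  simp_rw [Matrix.mul_apply]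
  exact Asymptotics.IsBigO.fun_sum fun l _ => (h l j).const_mul_left _

theorem mul_const [Fintype n] (h : IsBigOInv γ X) (A : Matrix n n ℂ) :
    IsBigOInv γ fun z => X z * A := fun i j => by
  simp_rw [Matrix.mul_apply, mul_comm (X _ _ _)]
  exact Asymptotics.IsBigO.fun_sum fun l _ => (h i l).const_mul_left _

theorem congr' (h : IsBigOInv γ X) (hXY : ∀ᶠ z in γ.atInfinity, X z = Y z) : IsBigOInv γ Y :=
  fun i j => (h i j).congr' (hXY.mono fun _ hz => congrFun (congrFun hz i) j) EventuallyEq.rfl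

theorem fromBlocks {m : Type*} {A B C D : ℂ → Matrix m m ℂ} (hA : IsBigOInv γ A)
    (hB : IsBigOInv γ B) (hC : IsBigOInv γ C) (hD : IsBigOInv γ D) :
    IsBigOInv γ fun z => Matrix.fromBlocks (A z) (B z) (C z) (D z) := by
  rintro (i | i) (j | j)
  · exact hA i j
  · exact hB i j
  · exact hC i j
  · exact hD i j

end IsBigOInv

theorem isBigOInv_evalAt (γ : SmoothCurve) (P : (Matrix (Fin N) (Fin N) ℂ)[X]) {n : ℕ}
    (hP : P.natDegree ≤ n) :
    IsBigOInv γ fun z => (z ^ n)⁻¹ • evalAt P z - P.coeff n := fun i j => by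
  have h1 : ∀ k ∈ Finset.range n, (fun z : ℂ => z ^ k * (z ^ n)⁻¹ * P.coeff k i j)
      =O[γ.atInfinity] fun z => z⁻¹ := by
    intro k hk
    rw [Finset.mem_range] at hk
    obtain ⟨m, rfl⟩ := Nat.exists_eq_add_of_lt hk
    have h2 : (fun z : ℂ => z⁻¹ * ((z⁻¹) ^ m * P.coeff k i j)) =O[γ.atInfinity]
        fun z => z⁻¹ * 1 := by
      refine (Asymptotics.isBigO_refl _ _).mul ?_
      exact ((γ.tendsto_inv_atInfinity.pow m).mul_const _).isBigO_one ℂ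
    simp only [mul_one] at h2
    refine h2.congr' ?_ EventuallyEq.rfl
    filter_upwards [γ.eventually_ne_zero] with z hz
    rw [inv_pow]
    field_simp
    ring
  refine (Asymptotics.IsBigO.fun_sum h1).congr' ?_ EventuallyEq.rfl
  filter_upwards [γ.eventually_ne_zero] with z hz
  rw [Matrix.sub_apply, Matrix.smul_apply, evalAt_apply P (Nat.lt_succ_of_le hP),
    Finset.sum_range_succ, smul_eq_mul, mul_add, inv_mul_cancel_left₀ (pow_ne_zero n hz),
    add_sub_cancel_right, Finset.mul_sum]
  exact Finset.sum_congr rfl fun k _ => by ring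

/-! ### Entrywise Cauchy transforms of matrix densities. -/

section MatrixTransform

variable {γ : SmoothCurve} {F : ℂ → Matrix (Fin N) (Fin N) ℂ}

/-- The Cauchy transform of a matrix-valued density. -/
noncomputable def matrixTransform (γ : SmoothCurve) (F : ℂ → Matrix (Fin N) (Fin N) ℂ) (z : ℂ) :
    Matrix (Fin N) (Fin N) ℂ :=
  cauchyConst • γ.integral fun ζ => (ζ - z)⁻¹ • F ζ

/-- The moments of a matrix-valued density. -/
noncomputable def matrixMoment (γ : SmoothCurve) (F : ℂ → Matrix (Fin N) (Fin N) ℂ) (k : ℕ) :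
    Matrix (Fin N) (Fin N) ℂ :=
  cauchyConst • γ.integral fun ζ => ζ ^ k • F ζ

theorem matrixMoment_apply (k : ℕ) (i j : Fin N) :
    matrixMoment γ F k i j = γ.lineMoment (fun ζ => F ζ i j) k := rfl

theorem exists_boundaryValue_matrixTransform (hF : ∀ i j, γ.IsAdmissible fun z => F z i j) {t : ℝ}
    (ht : t ∈ γ.dom) :
    ∃ Vp Vm, γ.PosBoundaryValue (matrixTransform γ F) t Vp ∧
      γ.NegBoundaryValue (matrixTransform γ F) t Vm ∧ Vp = Vm + F (γ.toFun t) := by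
  choose Vp Vm h1 h2 h3 using fun i j => (hF i j).exists_boundaryValue ht
  refine ⟨Matrix.of Vp, Matrix.of Vm, ?_, ?_, ?_⟩
  · exact tendsto_pi_nhds.2 fun i => tendsto_pi_nhds.2 fun j => h1 i j
  · exact tendsto_pi_nhds.2 fun i => tendsto_pi_nhds.2 fun j => h2 i j
  · ext i j
    exact h3 i j

theorem exists_tendsto_matrixTransform (hF : ∀ i j, γ.IsAdmissible fun z => F z i j) {t : ℝ}
    (ht : t ∈ γ.endParams) :
    ∃ V, Tendsto (matrixTransform γ F) (𝓝[γ.imageᶜ] (γ.toFun t)) (𝓝 V) := by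
  choose V h using fun i j => (hF i j).exists_tendsto ht
  exact ⟨Matrix.of V, tendsto_pi_nhds.2 fun i => tendsto_pi_nhds.2 fun j => h i j⟩

theorem isBigOInv_pow_smul (hF : ∀ i j, γ.IsAdmissible fun z => F z i j) {n : ℕ}
    (h0 : ∀ k < n, matrixMoment γ F k = 0) :
    IsBigOInv γ fun z => z ^ n • matrixTransform γ F z := fun i j =>
  (hF i j).isBigO_pow_mul fun k hk => by rw [← matrixMoment_apply, h0 k hk]; rfl

theorem isBigOInv_pow_succ_smul (hF : ∀ i j, γ.IsAdmissible fun z => F z i j) {n : ℕ}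
    (h0 : ∀ k < n, matrixMoment γ F k = 0) :
    IsBigOInv γ fun z => z ^ (n + 1) • matrixTransform γ F z + matrixMoment γ F n := fun i j =>
  (hF i j).isBigO_pow_succ_mul fun k hk => by rw [← matrixMoment_apply, h0 k hk]; rfl

end MatrixTransform

/-! ### Assembling block matrices. -/

section Blocks

variable {γ : SmoothCurve} {m : Type*}

theorem tendsto_fromBlocks {ι : Type*} {l : Filter ι} {A B C D : ι → Matrix m m ℂ}
    {a b c d : Matrix m m ℂ} (hA : Tendsto A l (𝓝 a)) (hB : Tendsto B l (𝓝 b))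
    (hC : Tendsto C l (𝓝 c)) (hD : Tendsto D l (𝓝 d)) :
    Tendsto (fun x => Matrix.fromBlocks (A x) (B x) (C x) (D x)) l
      (𝓝 (Matrix.fromBlocks a b c d)) := by
  have h : ∀ {X : ι → Matrix m m ℂ} {x : Matrix m m ℂ}, Tendsto X l (𝓝 x) → ∀ i j,
      Tendsto (fun y => X y i j) l (𝓝 (x i j)) := fun hX i j =>
    tendsto_pi_nhds.1 (tendsto_pi_nhds.1 hX i) j
  refine tendsto_pi_nhds.2 fun i => tendsto_pi_nhds.2 fun j => ?_
  rcases i with i | i <;> rcases j with j | j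
  · exact h hA i j
  · exact h hB i j
  · exact h hC i j
  · exact h hD i j

theorem differentiableOn_fromBlocks {S : Set ℂ} {A B C D : ℂ → Matrix m m ℂ}
    (hA : ∀ i j, DifferentiableOn ℂ (fun z => A z i j) S)
    (hB : ∀ i j, DifferentiableOn ℂ (fun z => B z i j) S)
    (hC : ∀ i j, DifferentiableOn ℂ (fun z => C z i j) S)
    (hD : ∀ i j, DifferentiableOn ℂ (fun z => D z i j) S) :
    ∀ i j, DifferentiableOn ℂ (fun z => Matrix.fromBlocks (A z) (B z) (C z) (D z) i j) S := by
  rintro (i | i) (j | j)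
  · exact hA i j
  · exact hB i j
  · exact hC i j
  · exact hD i j

theorem differentiableOn_mul_entry [Fintype m] {S : Set ℂ} {A B : ℂ → Matrix m m ℂ}
    (hA : ∀ i j, DifferentiableOn ℂ (fun z => A z i j) S)
    (hB : ∀ i j, DifferentiableOn ℂ (fun z => B z i j) S) (i j : m) :
    DifferentiableOn ℂ (fun z => (A z * B z) i j) S := by
  simp_rw [Matrix.mul_apply]
  exact DifferentiableOn.fun_sum fun l _ => (hA i l).mul (hB l j)

theorem tendsto_normalPoint_pos (γ : SmoothCurve) (t : ℝ) :
    Tendsto (fun p : ℝ × ℝ => γ.normalPoint p.1 p.2) (𝓝 t ×ˢ 𝓝[>] 0) (𝓝 (γ.toFun t)) := by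
  have := (γ.continuous_normalPoint.tendsto (t, 0)).mono_left
    (show 𝓝 t ×ˢ 𝓝[>] (0 : ℝ) ≤ 𝓝 (t, 0) by
      rw [nhds_prod_eq]; exact prod_mono le_rfl nhdsWithin_le_nhds)
  simpa using this

theorem tendsto_normalPoint_neg (γ : SmoothCurve) (t : ℝ) :
    Tendsto (fun p : ℝ × ℝ => γ.normalPoint p.1 p.2) (𝓝 t ×ˢ 𝓝[<] 0) (𝓝 (γ.toFun t)) := by
  have := (γ.continuous_normalPoint.tendsto (t, 0)).mono_left
    (show 𝓝 t ×ˢ 𝓝[<] (0 : ℝ) ≤ 𝓝 (t, 0) by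
      rw [nhds_prod_eq]; exact prod_mono le_rfl nhdsWithin_le_nhds)
  simpa using this

theorem posBoundaryValue_of_continuous {E : Type*} [TopologicalSpace E] {f : ℂ → E}
    (hf : Continuous f) (t : ℝ) : γ.PosBoundaryValue f t (f (γ.toFun t)) :=
  (hf.tendsto _).comp (tendsto_normalPoint_pos γ t)

theorem negBoundaryValue_of_continuous {E : Type*} [TopologicalSpace E] {f : ℂ → E}
    (hf : Continuous f) (t : ℝ) : γ.NegBoundaryValue f t (f (γ.toFun t)) :=
  (hf.tendsto _).comp (tendsto_normalPoint_neg γ t)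

/-- Right multiplication by `diagPow` scales the block columns, so the four estimates are exactly
the blocks of the error `E`. On the right-hand problem the block rows are scaled. -/
theorem exists_asymptotics_left {n : ℕ} {A B Q R : ℂ → Matrix (Fin N) (Fin N) ℂ}
    (hA : IsBigOInv γ fun z => (z ^ n)⁻¹ • A z - 1) (hB : IsBigOInv γ fun z => (z ^ n)⁻¹ • B z)
    (hQ : IsBigOInv γ fun z => z ^ n • Q z) (hR : IsBigOInv γ fun z => z ^ n • R z - 1) :
    ∃ E : ℂ → Matrix (Fin N ⊕ Fin N) (Fin N ⊕ Fin N) ℂ,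
      (∀ i j, (fun z => E z i j) =O[γ.atInfinity] fun z => z⁻¹) ∧
      ∀ᶠ z in γ.atInfinity, Matrix.fromBlocks (A z) (Q z) (B z) (R z) = (1 + E z) * diagPow n z := by
  refine ⟨_, hA.fromBlocks hQ hB hR, ?_⟩
  filter_upwards [γ.eventually_ne_zero] with z hz
  have hz' := pow_ne_zero n hz
  rw [← Matrix.fromBlocks_one, Matrix.fromBlocks_add, diagPow, Matrix.fromBlocks_multiply]
  simp [smul_smul, hz']

theorem exists_asymptotics_right {n : ℕ} {A B Q R : ℂ → Matrix (Fin N) (Fin N) ℂ}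
    (hA : IsBigOInv γ fun z => (z ^ n)⁻¹ • A z - 1) (hB : IsBigOInv γ fun z => (z ^ n)⁻¹ • B z)
    (hQ : IsBigOInv γ fun z => z ^ n • Q z) (hR : IsBigOInv γ fun z => z ^ n • R z - 1) :
    ∃ E : ℂ → Matrix (Fin N ⊕ Fin N) (Fin N ⊕ Fin N) ℂ,
      (∀ i j, (fun z => E z i j) =O[γ.atInfinity] fun z => z⁻¹) ∧
      ∀ᶠ z in γ.atInfinity, Matrix.fromBlocks (A z) (B z) (Q z) (R z) = diagPow n z * (1 + E z) := by
  refine ⟨_, hA.fromBlocks hB hQ hR, ?_⟩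
  filter_upwards [γ.eventually_ne_zero] with z hz
  have hz' := pow_ne_zero n hz
  rw [← Matrix.fromBlocks_one, Matrix.fromBlocks_add, diagPow, Matrix.fromBlocks_multiply]
  simp [smul_smul, hz']

end Blocks

/-! ### Additive jumps. -/

/-- `R` is holomorphic off the curve, with limits at the endpoints, and jumps by `G`. -/
structure HasJump (γ : SmoothCurve) (G R : ℂ → Matrix (Fin N) (Fin N) ℂ) : Prop where
  holomorphic : ∀ i j, DifferentiableOn ℂ (fun z => R z i j) γ.imageᶜ
  jump : ∀ t ∈ γ.dom, ∃ Rp Rm, γ.PosBoundaryValue R t Rp ∧ γ.NegBoundaryValue R t Rm ∧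
    Rp = Rm + G (γ.toFun t)
  endpoint : ∀ t ∈ γ.endParams, ∃ V, Tendsto R (𝓝[γ.imageᶜ] (γ.toFun t)) (𝓝 V)

namespace HasJump

variable {γ : SmoothCurve} {G R : ℂ → Matrix (Fin N) (Fin N) ℂ}

theorem matrixTransform {F : ℂ → Matrix (Fin N) (Fin N) ℂ}
    (hF : ∀ i j, γ.IsAdmissible fun z => F z i j) : HasJump γ F (matrixTransform γ F) where
  holomorphic i j := (hF i j).differentiableOn
  jump _ ht := exists_boundaryValue_matrixTransform hF ht
  endpoint _ ht := exists_tendsto_matrixTransform hF ht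

theorem const (A : Matrix (Fin N) (Fin N) ℂ) : HasJump γ (fun _ => 0) fun _ => A where
  holomorphic _ _ := differentiableOn_const _
  jump _ _ := ⟨A, A, tendsto_const_nhds, tendsto_const_nhds, (add_zero A).symm⟩
  endpoint _ _ := ⟨A, tendsto_const_nhds⟩

theorem neg_const_mul (h : HasJump γ G R) (A : Matrix (Fin N) (Fin N) ℂ) :
    HasJump γ (fun z => -(A * G z)) fun z => -(A * R z) where
  holomorphic i j := (differentiableOn_mul_entry (A := fun _ => A)
    (fun _ _ => differentiableOn_const _) h.holomorphic i j).neg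
  jump t ht := by
    obtain ⟨Rp, Rm, h1, h2, h3⟩ := h.jump t ht
    refine ⟨-(A * Rp), -(A * Rm), (tendsto_const_nhds.mul h1).neg,
      (tendsto_const_nhds.mul h2).neg, ?_⟩
    rw [h3, mul_add, neg_add]
  endpoint t ht := by
    obtain ⟨V, hV⟩ := h.endpoint t ht
    exact ⟨_, (tendsto_const_nhds.mul hV).neg⟩

theorem neg_mul_const (h : HasJump γ G R) (A : Matrix (Fin N) (Fin N) ℂ) :
    HasJump γ (fun z => -(G z * A)) fun z => -(R z * A) where
  holomorphic i j := (differentiableOn_mul_entry (B := fun _ => A) h.holomorphic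
    (fun _ _ => differentiableOn_const _) i j).neg
  jump t ht := by
    obtain ⟨Rp, Rm, h1, h2, h3⟩ := h.jump t ht
    refine ⟨-(Rp * A), -(Rm * A), (h1.mul tendsto_const_nhds).neg,
      (h2.mul tendsto_const_nhds).neg, ?_⟩
    rw [h3, add_mul, neg_add]
  endpoint t ht := by
    obtain ⟨V, hV⟩ := h.endpoint t ht
    exact ⟨_, (hV.mul tendsto_const_nhds).neg⟩

end HasJump

/-! ### The fundamental matrices solve the Riemann–Hilbert problems. -/

section Solutions

variable {γ : SmoothCurve} {W : ℂ → Matrix (Fin N) (Fin N) ℂ}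
  {A B Q R : ℂ → Matrix (Fin N) (Fin N) ℂ}

theorem continuous_of_differentiable_entries
    (hA : ∀ i j, Differentiable ℂ fun z => A z i j) : Continuous A :=
  continuous_matrix fun i j => (hA i j).continuous

/-- The jump matrix adds the first block column times `W` to the second. With an entire first
column, the multiplicative jump is just the additive jump of the second kind blocks. -/
theorem solvesLeftRHP_fromBlocks {n : ℕ} (hA : ∀ i j, Differentiable ℂ fun z => A z i j)
    (hB : ∀ i j, Differentiable ℂ fun z => B z i j) (hQ : HasJump γ (fun z => A z * W z) Q)
    (hR : HasJump γ (fun z => B z * W z) R)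
    (hA' : IsBigOInv γ fun z => (z ^ n)⁻¹ • A z - 1) (hB' : IsBigOInv γ fun z => (z ^ n)⁻¹ • B z)
    (hQ' : IsBigOInv γ fun z => z ^ n • Q z) (hR' : IsBigOInv γ fun z => z ^ n • R z - 1) :
    SolvesLeftRHP γ W n fun z => Matrix.fromBlocks (A z) (Q z) (B z) (R z) where
  holomorphic := differentiableOn_fromBlocks (fun i j => (hA i j).differentiableOn) hQ.holomorphic
    (fun i j => (hB i j).differentiableOn) hR.holomorphic
  asymptotics := exists_asymptotics_left hA' hB' hQ' hR'
  jump t ht _ := by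
    obtain ⟨Qp, Qm, hQp, hQm, hQe⟩ := hQ.jump t ht
    obtain ⟨Rp, Rm, hRp, hRm, hRe⟩ := hR.jump t ht
    have cA := continuous_of_differentiable_entries hA
    have cB := continuous_of_differentiable_entries hB
    refine ⟨_, _, tendsto_fromBlocks (posBoundaryValue_of_continuous cA t) hQp
      (posBoundaryValue_of_continuous cB t) hRp, tendsto_fromBlocks
      (negBoundaryValue_of_continuous cA t) hQm (negBoundaryValue_of_continuous cB t) hRm, ?_⟩
    rw [Matrix.fromBlocks_multiply, hQe, hRe]
    simp [add_comm]
  endpoint t ht := by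
    obtain ⟨V, hV⟩ := hQ.endpoint t ht
    obtain ⟨V', hV'⟩ := hR.endpoint t ht
    exact ⟨_, tendsto_fromBlocks
      ((continuous_of_differentiable_entries hA).continuousWithinAt) hV
      ((continuous_of_differentiable_entries hB).continuousWithinAt) hV'⟩

theorem solvesRightRHP_fromBlocks {n : ℕ} (hA : ∀ i j, Differentiable ℂ fun z => A z i j)
    (hB : ∀ i j, Differentiable ℂ fun z => B z i j) (hQ : HasJump γ (fun z => W z * A z) Q)
    (hR : HasJump γ (fun z => W z * B z) R)
    (hA' : IsBigOInv γ fun z => (z ^ n)⁻¹ • A z - 1) (hB' : IsBigOInv γ fun z => (z ^ n)⁻¹ • B z)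
    (hQ' : IsBigOInv γ fun z => z ^ n • Q z) (hR' : IsBigOInv γ fun z => z ^ n • R z - 1) :
    SolvesRightRHP γ W n fun z => Matrix.fromBlocks (A z) (B z) (Q z) (R z) where
  holomorphic := differentiableOn_fromBlocks (fun i j => (hA i j).differentiableOn)
    (fun i j => (hB i j).differentiableOn) hQ.holomorphic hR.holomorphic
  asymptotics := exists_asymptotics_right hA' hB' hQ' hR'
  jump t ht _ := by
    obtain ⟨Qp, Qm, hQp, hQm, hQe⟩ := hQ.jump t ht
    obtain ⟨Rp, Rm, hRp, hRm, hRe⟩ := hR.jump t ht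
    have cA := continuous_of_differentiable_entries hA
    have cB := continuous_of_differentiable_entries hB
    refine ⟨_, _, tendsto_fromBlocks (posBoundaryValue_of_continuous cA t)
      (posBoundaryValue_of_continuous cB t) hQp hRp, tendsto_fromBlocks
      (negBoundaryValue_of_continuous cA t) (negBoundaryValue_of_continuous cB t) hQm hRm, ?_⟩
    rw [Matrix.fromBlocks_multiply, hQe, hRe]
    simp [add_comm]
  endpoint t ht := by
    obtain ⟨V, hV⟩ := hQ.endpoint t ht
    obtain ⟨V', hV'⟩ := hR.endpoint t ht
    exact ⟨_, tendsto_fromBlocks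
      ((continuous_of_differentiable_entries hA).continuousWithinAt)
      ((continuous_of_differentiable_entries hB).continuousWithinAt) hV hV'⟩

variable {PL PR : ℕ → (Matrix (Fin N) (Fin N) ℂ)[X]} {C : ℕ → Matrix (Fin N) (Fin N) ℂ}

theorem isBigOInv_monic {P : (Matrix (Fin N) (Fin N) ℂ)[X]} {n : ℕ} (hP : IsMonicOfDegree P n) :
    IsBigOInv γ fun z => (z ^ n)⁻¹ • evalAt P z - 1 := by
  have := isBigOInv_evalAt γ P hP.1
  rwa [hP.2] at this

theorem isBigOInv_monic_succ {P : (Matrix (Fin N) (Fin N) ℂ)[X]} {n : ℕ}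
    (hP : IsMonicOfDegree P n) : IsBigOInv γ fun z => (z ^ (n + 1))⁻¹ • evalAt P z := by
  have := isBigOInv_evalAt γ P (hP.1.trans n.le_succ)
  rwa [Polynomial.coeff_eq_zero_of_natDegree_lt (Nat.lt_succ_of_le hP.1), funext fun z =>
    sub_zero ((z ^ n.succ)⁻¹ • evalAt P z)] at this

theorem inv_mul_self_of_isUnit {A : Matrix (Fin N) (Fin N) ℂ} (hA : IsUnit A) : A * A⁻¹ = 1 ∧
    A⁻¹ * A = 1 := by
  have := (Matrix.isUnit_iff_isUnit_det A).1 hA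
  exact ⟨Matrix.mul_nonsing_inv A this, Matrix.nonsing_inv_mul A this⟩

theorem solvesLeftRHP_leftY (hW : IsHolderWeight γ W) (h : IsOrthogonalSystem γ W PL PR C) (n : ℕ) :
    SolvesLeftRHP γ W n (leftY γ W PL C n) := by
  have hadm := fun n => isAdmissible_left hW (PL n)
  have hJ : ∀ n, HasJump γ (fun z => evalAt (PL n) z * W z) (secondKindLeft γ W (PL n)) :=
    fun n => HasJump.matrixTransform (hadm n)
  have hm : ∀ n, ∀ k ≤ n, matrixMoment γ (fun z => evalAt (PL n) z * W z) k =
      if n = k then (C n)⁻¹ else 0 := h.orthogonal_left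
  have hm0 : ∀ n, ∀ k < n, matrixMoment γ (fun z => evalAt (PL n) z * W z) k = 0 :=
    fun n k hk => by rw [hm n k hk.le, if_neg hk.ne']
  have hQ : ∀ n, IsBigOInv γ fun z => z ^ n • secondKindLeft γ W (PL n) z := fun n =>
    isBigOInv_pow_smul (hadm n) (hm0 n)
  have hA := fun n => differentiable_evalAt (PL n)
  cases n with
  | zero =>
    -- The conventional row `[0, I]` fits the general scheme, a constant having jump `0 * W`.
    refine solvesLeftRHP_fromBlocks (hA 0) (B := fun _ => 0) (R := fun _ => 1)
      (fun _ _ => differentiable_const _) (hJ 0) ?_ (isBigOInv_monic (h.monic_left 0)) ?_ (hQ 0) ?_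
    · simpa using HasJump.const (γ := γ) (1 : Matrix (Fin N) (Fin N) ℂ)
    · simpa using IsBigOInv.zero
    · simpa using IsBigOInv.zero
  | succ n =>
    refine solvesLeftRHP_fromBlocks (hA (n + 1)) (B := fun z => -(C n * evalAt (PL n) z))
      (R := fun z => -(C n * secondKindLeft γ W (PL n) z)) ?_ (hJ (n + 1)) ?_
      (isBigOInv_monic (h.monic_left (n + 1))) ?_ (hQ (n + 1)) ?_
    · intro i j
      have := differentiableOn_mul_entry (S := univ) (A := fun _ => C n)
        (fun _ _ => differentiableOn_const _) (fun i j => (hA n i j).differentiableOn) i j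
      exact (differentiableOn_univ.1 this).neg
    · simpa only [neg_mul, mul_assoc] using (hJ n).neg_const_mul (C n)
    · simpa only [smul_neg, mul_smul_comm] using
        ((isBigOInv_monic_succ (h.monic_left n)).const_mul (C n)).neg
    -- With `Q` the second kind function of `PL n`, the corner error is `-C n z^{n+1} Q - 1 = -C n
    -- (z^{n+1} Q + (C n)⁻¹)`, where `(C n)⁻¹` is the moment of order `n`.
    · have h1 := ((isBigOInv_pow_succ_smul (hadm n) (hm0 n)).const_mul (C n)).neg
      rw [hm n n le_rfl, if_pos rfl] at h1
      refine h1.congr' (Eventually.of_forall fun z => ?_)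
      rw [mul_add, (inv_mul_self_of_isUnit (h.nonsingular n)).1, mul_smul_comm, smul_neg, neg_add]
      rfl

theorem solvesRightRHP_rightY (hW : IsHolderWeight γ W) (h : IsOrthogonalSystem γ W PL PR C)
    (n : ℕ) : SolvesRightRHP γ W n (rightY γ W PR C n) := by
  have hadm := fun n => isAdmissible_right hW (PR n)
  have hJ : ∀ n, HasJump γ (fun z => W z * evalAt (PR n) z) (secondKindRight γ W (PR n)) :=
    fun n => HasJump.matrixTransform (hadm n)
  have hm : ∀ n, ∀ k ≤ n, matrixMoment γ (fun z => W z * evalAt (PR n) z) k =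
      if n = k then (C n)⁻¹ else 0 := h.orthogonal_right
  have hm0 : ∀ n, ∀ k < n, matrixMoment γ (fun z => W z * evalAt (PR n) z) k = 0 :=
    fun n k hk => by rw [hm n k hk.le, if_neg hk.ne']
  have hQ : ∀ n, IsBigOInv γ fun z => z ^ n • secondKindRight γ W (PR n) z := fun n =>
    isBigOInv_pow_smul (hadm n) (hm0 n)
  have hA := fun n => differentiable_evalAt (PR n)
  cases n with
  | zero =>
    refine solvesRightRHP_fromBlocks (hA 0) (B := fun _ => 0) (R := fun _ => 1)
      (fun _ _ => differentiable_const _) (hJ 0) ?_ (isBigOInv_monic (h.monic_right 0)) ?_ (hQ 0) ?_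
    · simpa using HasJump.const (γ := γ) (1 : Matrix (Fin N) (Fin N) ℂ)
    · simpa using IsBigOInv.zero
    · simpa using IsBigOInv.zero
  | succ n =>
    refine solvesRightRHP_fromBlocks (hA (n + 1)) (B := fun z => -(evalAt (PR n) z * C n))
      (R := fun z => -(secondKindRight γ W (PR n) z * C n)) ?_ (hJ (n + 1)) ?_
      (isBigOInv_monic (h.monic_right (n + 1))) ?_ (hQ (n + 1)) ?_
    · intro i j
      have := differentiableOn_mul_entry (S := univ) (B := fun _ => C n)
        (fun i j => (hA n i j).differentiableOn) (fun _ _ => differentiableOn_const _) i j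
      exact (differentiableOn_univ.1 this).neg
    · simpa only [mul_neg, mul_assoc] using (hJ n).neg_mul_const (C n)
    · simpa only [smul_neg, smul_mul_assoc] using
        ((isBigOInv_monic_succ (h.monic_right n)).mul_const (C n)).neg
    · have h1 := ((isBigOInv_pow_succ_smul (hadm n) (hm0 n)).mul_const (C n)).neg
      rw [hm n n le_rfl, if_pos rfl] at h1
      refine h1.congr' (Eventually.of_forall fun z => ?_)
      rw [add_mul, (inv_mul_self_of_isUnit (h.nonsingular n)).2, smul_mul_assoc, smul_neg, neg_add]
      rfl

end Solutions

/-! ### Uniqueness by pairing the left problem with the right one. -/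

section Uniqueness

variable {γ : SmoothCurve} {W : ℂ → Matrix (Fin N) (Fin N) ℂ}

/-- The block matrix `[0, 1; -1, 0]` that intertwines the left and the right problem. -/
def symplectic (N : ℕ) : Matrix (Fin N ⊕ Fin N) (Fin N ⊕ Fin N) ℂ :=
  Matrix.fromBlocks 0 1 (-1) 0

theorem symplectic_mul_neg : symplectic N * -symplectic N = 1 := by
  rw [symplectic, Matrix.fromBlocks_neg, Matrix.fromBlocks_multiply, ← Matrix.fromBlocks_one]
  simp

theorem jump_symplectic_jump (A : Matrix (Fin N) (Fin N) ℂ) :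
    Matrix.fromBlocks 1 A 0 1 * (symplectic N * Matrix.fromBlocks 1 0 A 1) = symplectic N := by
  simp [symplectic, Matrix.fromBlocks_multiply]

theorem diagPow_symplectic_diagPow (n : ℕ) {z : ℂ} (hz : z ≠ 0) :
    diagPow n z * (symplectic N * diagPow n z) = symplectic N := by
  have := pow_ne_zero n hz
  simp [symplectic, diagPow, Matrix.fromBlocks_multiply, smul_smul, this]

/-- A solution of the left problem is inverse to a transform of any solution of the right one. -/
theorem mul_symplectic_mul_eq_one {n : ℕ}
    {Y Z : ℂ → Matrix (Fin N ⊕ Fin N) (Fin N ⊕ Fin N) ℂ} (hZ : SolvesLeftRHP γ W n Z)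
    (hY : SolvesRightRHP γ W n Y) {z : ℂ} (hz : z ∉ γ.image) :
    Z z * (symplectic N * Y z * -symplectic N) = 1 := by
  set X := fun z => Z z * (symplectic N * Y z * -symplectic N) with hX
  have hlim : ∀ t ∈ γ.dom, ∃ V, Tendsto X (𝓝[γ.imageᶜ] (γ.toFun t)) (𝓝 V) := by
    intro t ht
    by_cases hend : t ∈ γ.endParams
    · obtain ⟨V, hV⟩ := hZ.endpoint t hend
      obtain ⟨V', hV'⟩ := hY.endpoint t hend
      exact ⟨_, hV.mul ((tendsto_const_nhds.mul hV').mul tendsto_const_nhds)⟩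
    · obtain ⟨Zp, Zm, hZp, hZm, hZe⟩ := hZ.jump t ht hend
      obtain ⟨Yp, Ym, hYp, hYm, hYe⟩ := hY.jump t ht hend
      have hp : γ.PosBoundaryValue X t (Zp * (symplectic N * Yp * -symplectic N)) :=
        hZp.mul ((tendsto_const_nhds.mul hYp).mul tendsto_const_nhds)
      have hm : γ.NegBoundaryValue X t (Zm * (symplectic N * Ym * -symplectic N)) :=
        hZm.mul ((tendsto_const_nhds.mul hYm).mul tendsto_const_nhds)
      have he : Zp * (symplectic N * Yp * -symplectic N) =
          Zm * (symplectic N * Ym * -symplectic N) := by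
        have h1 := jump_symplectic_jump (W (γ.toFun t))
        rw [hZe, hYe]
        calc _ = Zm * ((Matrix.fromBlocks 1 (W (γ.toFun t)) 0 1 *
              (symplectic N * Matrix.fromBlocks 1 0 (W (γ.toFun t)) 1)) * Ym *
              -symplectic N) := by simp only [mul_assoc]
          _ = _ := by rw [h1]
      rw [he] at hp
      exact ⟨_, SmoothCurve.tendsto_of_boundaryValues ht hend hp hm⟩
  have hinf : Tendsto X γ.atInfinity (𝓝 1) := by
    obtain ⟨E, hE, hZE⟩ := hZ.asymptotics
    obtain ⟨E', hE', hYE⟩ := hY.asymptotics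
    have h1 : Tendsto E γ.atInfinity (𝓝 0) := IsBigOInv.tendsto hE
    have h2 : Tendsto E' γ.atInfinity (𝓝 0) := IsBigOInv.tendsto hE'
    have h3 : Tendsto (fun z => (1 + E z) * (symplectic N * (1 + E' z) * -symplectic N))
        γ.atInfinity (𝓝 ((1 + 0) * (symplectic N * (1 + 0) * -symplectic N))) :=
      (tendsto_const_nhds.add h1).mul ((tendsto_const_nhds.mul
        (tendsto_const_nhds.add h2)).mul tendsto_const_nhds)
    rw [add_zero, mul_one, one_mul, symplectic_mul_neg] at h3
    refine h3.congr' ?_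
    filter_upwards [hZE, hYE, γ.eventually_ne_zero] with z hz1 hz2 hz0
    have h4 := diagPow_symplectic_diagPow (N := N) n hz0
    simp only [hX]
    rw [hz1, hz2]
    calc _ = (1 + E z) * ((diagPow n z * (symplectic N * diagPow n z)) * (1 + E' z) *
          -symplectic N) := by rw [h4]
      _ = _ := by simp only [mul_assoc]
  have hhol : ∀ i j, DifferentiableOn ℂ (fun z => X z i j) γ.imageᶜ :=
    differentiableOn_mul_entry hZ.holomorphic (differentiableOn_mul_entry
      (differentiableOn_mul_entry (fun _ _ => differentiableOn_const _) hY.holomorphic)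
      (fun _ _ => differentiableOn_const _))
  ext i j
  refine SmoothCurve.eq_of_tendsto (hhol i j) (fun t ht => ?_) ?_ hz
  · obtain ⟨V, hV⟩ := hlim t ht
    exact ⟨V i j, tendsto_pi_nhds.1 (tendsto_pi_nhds.1 hV i) j⟩
  · exact tendsto_pi_nhds.1 (tendsto_pi_nhds.1 hinf i) j

/-- Both are inverse to the same transform of the right solution `Y`. -/
theorem SolvesLeftRHP.eqOn {n : ℕ} {Y Z Z' : ℂ → Matrix (Fin N ⊕ Fin N) (Fin N ⊕ Fin N) ℂ}
    (hZ : SolvesLeftRHP γ W n Z) (hZ' : SolvesLeftRHP γ W n Z') (hY : SolvesRightRHP γ W n Y) :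
    EqOn Z Z' γ.imageᶜ := fun _ hz =>
  left_inv_eq_right_inv (mul_symplectic_mul_eq_one hZ hY hz)
    (mul_eq_one_comm.1 (mul_symplectic_mul_eq_one hZ' hY hz))

theorem SolvesRightRHP.eqOn {n : ℕ} {Y Z Z' : ℂ → Matrix (Fin N ⊕ Fin N) (Fin N ⊕ Fin N) ℂ}
    (hZ : SolvesRightRHP γ W n Z) (hZ' : SolvesRightRHP γ W n Z') (hY : SolvesLeftRHP γ W n Y) :
    EqOn Z Z' γ.imageᶜ := fun z hz => by
  have h1 : symplectic N * Z z * -symplectic N = symplectic N * Z' z * -symplectic N :=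
    left_inv_eq_right_inv (mul_eq_one_comm.1 (mul_symplectic_mul_eq_one hY hZ hz))
      (mul_symplectic_mul_eq_one hY hZ' hz)
  have h2 : -symplectic N * symplectic N = 1 := mul_eq_one_comm.1 symplectic_mul_neg
  have h3 : ∀ A : Matrix (Fin N ⊕ Fin N) (Fin N ⊕ Fin N) ℂ,
      -symplectic N * (symplectic N * A * -symplectic N) * symplectic N = A := fun A => by
    calc _ = (-symplectic N * symplectic N) * A * (-symplectic N * symplectic N) := by
          simp only [mul_assoc]
      _ = A := by rw [h2, one_mul, mul_one]
  rw [← h3 (Z z), h1, h3]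

end Uniqueness

/-! ### Linear algebra of block Hankel systems. -/

section BlockHankel

/-- The block Hankel matrix of size `n` of a sequence of matrices. -/
def blockHankel (M : ℕ → Matrix (Fin N) (Fin N) ℂ) (n : ℕ) :
    Matrix (Fin n × Fin N) (Fin n × Fin N) ℂ :=
  Matrix.of fun p q => M ((p.1 : ℕ) + (q.1 : ℕ)) p.2 q.2

/-- The index shifts by one: `hankel γ W n` has `n + 1` block rows. The empty determinant is `1`. -/
theorem det_blockHankel_ne_zero {γ : SmoothCurve} {W : ℂ → Matrix (Fin N) (Fin N) ℂ}
    (h : IsRegular γ W) : ∀ n, (blockHankel (moment γ W) n).det ≠ 0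
  | 0 => by simp
  | n + 1 => h n

/-- The coefficients of a monic left orthogonal polynomial of degree `n`. -/
def IsLeftOrthogonal (M : ℕ → Matrix (Fin N) (Fin N) ℂ) (n : ℕ)
    (p : ℕ → Matrix (Fin N) (Fin N) ℂ) : Prop :=
  p n = 1 ∧ ∀ k < n, ∑ j ∈ Finset.range (n + 1), p j * M (j + k) = 0

/-- The coefficients of a monic right orthogonal polynomial of degree `n`. -/
def IsRightOrthogonal (M : ℕ → Matrix (Fin N) (Fin N) ℂ) (n : ℕ)
    (p : ℕ → Matrix (Fin N) (Fin N) ℂ) : Prop :=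
  p n = 1 ∧ ∀ k < n, ∑ j ∈ Finset.range (n + 1), M (j + k) * p j = 0

variable {M : ℕ → Matrix (Fin N) (Fin N) ℂ}

/-- Transposition exchanges the two sides. The Hankel matrix of the transposed moments is the
transpose of the original, so regularity is inherited. -/
theorem isRightOrthogonal_iff {n : ℕ} {p : ℕ → Matrix (Fin N) (Fin N) ℂ} :
    IsRightOrthogonal M n p ↔ IsLeftOrthogonal (fun k => (M k).transpose) n
      fun k => (p k).transpose := by
  unfold IsRightOrthogonal IsLeftOrthogonal
  refine and_congr ?_ (forall₂_congr fun k _ => ?_)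
  · exact Matrix.transpose_eq_one.symm
  · simp_rw [← Matrix.transpose_mul, ← Matrix.transpose_sum]
    exact Matrix.transpose_eq_zero.symm

theorem det_blockHankel_transpose (n : ℕ) :
    (blockHankel (fun k => (M k).transpose) n).det = (blockHankel M n).det := by
  rw [← Matrix.det_transpose]
  congr 1
  ext p q
  simp [blockHankel, add_comm]

/-- The conditions say that the block row `[x 0, …, x (n - 1)]` is annihilated by the Hankel matrix.
-/
theorem eq_zero_of_sum_mul_eq_zero {n : ℕ} (hM : (blockHankel M n).det ≠ 0)
    {x : ℕ → Matrix (Fin N) (Fin N) ℂ}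
    (hx : ∀ k < n, ∑ j ∈ Finset.range n, x j * M (j + k) = 0) : ∀ j < n, x j = 0 := by
  set X : Matrix (Fin N) (Fin n × Fin N) ℂ := Matrix.of fun i p => x p.1 i p.2 with hX
  have h1 : X * blockHankel M n = 0 := by
    ext i ⟨k, l⟩
    have h2 := congrFun (congrFun (hx k k.2) i) l
    rw [Matrix.sum_apply, Finset.sum_range] at h2
    rw [Matrix.mul_apply, Fintype.sum_prod_type]
    simpa [Matrix.mul_apply, hX, blockHankel] using h2
  have h3 : X = 0 := by
    rw [← Matrix.mul_nonsing_inv_cancel_right _ X (isUnit_iff_ne_zero.2 hM), h1, Matrix.zero_mul]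
  intro j hj
  ext i l
  exact congrFun (congrFun h3 i) (⟨j, hj⟩, l)

theorem exists_sum_mul_eq {n : ℕ} (hM : (blockHankel M n).det ≠ 0)
    (b : ℕ → Matrix (Fin N) (Fin N) ℂ) : ∃ x : ℕ → Matrix (Fin N) (Fin N) ℂ,
      ∀ k < n, ∑ j ∈ Finset.range n, x j * M (j + k) = b k := by
  set B : Matrix (Fin N) (Fin n × Fin N) ℂ := Matrix.of fun i p => b p.1 i p.2 with hB
  set X := B * (blockHankel M n)⁻¹ with hX
  refine ⟨fun j => if hj : j < n then Matrix.of fun i l => X i (⟨j, hj⟩, l) else 0,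
    fun k hk => ?_⟩
  have h1 : X * blockHankel M n = B := Matrix.nonsing_inv_mul_cancel_right _ _
    (isUnit_iff_ne_zero.2 hM)
  ext i l
  have h2 := congrFun (congrFun h1 i) (⟨k, hk⟩, l)
  rw [Matrix.mul_apply, Fintype.sum_prod_type] at h2
  rw [Matrix.sum_apply, Finset.sum_range]
  simpa [Matrix.mul_apply, hB, blockHankel] using h2

theorem exists_isLeftOrthogonal {n : ℕ} (hM : (blockHankel M n).det ≠ 0) :
    ∃ p, IsLeftOrthogonal M n p := by
  -- The leading term `M (n + k)` of a monic polynomial is moved to the other side.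
  obtain ⟨x, hx⟩ := exists_sum_mul_eq hM fun k => -M (n + k)
  refine ⟨Function.update x n 1, by simp, fun k hk => ?_⟩
  rw [Finset.sum_range_succ, Function.update_self, one_mul, ← eq_neg_iff_add_eq_zero, ← hx k hk]
  refine Finset.sum_congr rfl fun j hj => ?_
  rw [Function.update_of_ne (Finset.mem_range.1 hj).ne]

theorem IsLeftOrthogonal.eq {n : ℕ} (hM : (blockHankel M n).det ≠ 0)
    {p q : ℕ → Matrix (Fin N) (Fin N) ℂ} (hp : IsLeftOrthogonal M n p)
    (hq : IsLeftOrthogonal M n q) : ∀ j ≤ n, p j = q j := by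
  have h1 := eq_zero_of_sum_mul_eq_zero hM (x := fun j => p j - q j) fun k hk => by
    have h2 := hp.2 k hk
    have h3 := hq.2 k hk
    rw [Finset.sum_range_succ, hp.1] at h2
    rw [Finset.sum_range_succ, hq.1] at h3
    simp_rw [sub_mul, Finset.sum_sub_distrib]
    rw [eq_neg_of_add_eq_zero_left h2, eq_neg_of_add_eq_zero_left h3, sub_self]
  intro j hj
  rcases hj.lt_or_eq with hj | rfl
  · exact sub_eq_zero.1 (h1 j hj)
  · rw [hp.1, hq.1]

theorem exists_isRightOrthogonal {n : ℕ} (hM : (blockHankel M n).det ≠ 0) :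
    ∃ p, IsRightOrthogonal M n p := by
  obtain ⟨p, hp⟩ := exists_isLeftOrthogonal (M := fun k => (M k).transpose)
    (by rwa [det_blockHankel_transpose])
  exact ⟨fun k => (p k).transpose, isRightOrthogonal_iff.2 (by simpa using hp)⟩

theorem IsRightOrthogonal.eq {n : ℕ} (hM : (blockHankel M n).det ≠ 0)
    {p q : ℕ → Matrix (Fin N) (Fin N) ℂ} (hp : IsRightOrthogonal M n p)
    (hq : IsRightOrthogonal M n q) : ∀ j ≤ n, p j = q j := fun j hj =>
  Matrix.transpose_injective (IsLeftOrthogonal.eq (by rwa [det_blockHankel_transpose])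
    (isRightOrthogonal_iff.1 hp) (isRightOrthogonal_iff.1 hq) j hj)

/-- The double sum of `p j * M (j + k) * q k` is evaluated in both orders. Orthogonality on either
side leaves only the term with leading coefficient `1`. -/
theorem IsLeftOrthogonal.sum_eq {n : ℕ} {p q : ℕ → Matrix (Fin N) (Fin N) ℂ}
    (hp : IsLeftOrthogonal M n p) (hq : IsRightOrthogonal M n q) :
    ∑ j ∈ Finset.range (n + 1), p j * M (j + n) = ∑ j ∈ Finset.range (n + 1), M (j + n) * q j := by
  have h1 : ∑ k ∈ Finset.range (n + 1), (∑ j ∈ Finset.range (n + 1), p j * M (j + k)) * q k =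
      ∑ j ∈ Finset.range (n + 1), p j * M (j + n) := by
    rw [Finset.sum_range_succ, hq.1, mul_one, Finset.sum_eq_zero, zero_add]
    intro k hk
    rw [hp.2 k (Finset.mem_range.1 hk), zero_mul]
  have h2 : ∑ j ∈ Finset.range (n + 1), p j * (∑ k ∈ Finset.range (n + 1), M (k + j) * q k) =
      ∑ j ∈ Finset.range (n + 1), M (j + n) * q j := by
    rw [Finset.sum_range_succ, hp.1, one_mul, Finset.sum_eq_zero, zero_add]
    intro k hk
    rw [hq.2 k (Finset.mem_range.1 hk), mul_zero]
  rw [← h1, ← h2]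
  simp_rw [Finset.sum_mul, Finset.mul_sum]
  rw [Finset.sum_comm]
  refine Finset.sum_congr rfl fun j _ => Finset.sum_congr rfl fun k _ => ?_
  rw [mul_assoc, add_comm]

/-- If a row vector `v` kills the norm, the coefficients `v p j` are orthogonal to all degrees up to
`n`. The larger Hankel matrix forces them to vanish, and the leading one is `v` itself. -/
theorem IsLeftOrthogonal.isUnit {n : ℕ} (hM : (blockHankel M (n + 1)).det ≠ 0)
    {p : ℕ → Matrix (Fin N) (Fin N) ℂ} (hp : IsLeftOrthogonal M n p) :
    IsUnit (∑ j ∈ Finset.range (n + 1), p j * M (j + n)) := by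
  rw [Matrix.isUnit_iff_isUnit_det, isUnit_iff_ne_zero]
  intro hdet
  obtain ⟨v, hv0, hv⟩ := Matrix.exists_vecMul_eq_zero_iff.2 hdet
  -- The vector is repeated in every row so that the statement about square matrices applies.
  set V : Matrix (Fin N) (Fin N) ℂ := Matrix.of fun _ => v with hV
  have hVm : V * ∑ j ∈ Finset.range (n + 1), p j * M (j + n) = 0 := by
    ext i j
    exact congrFun hv j
  have h1 := eq_zero_of_sum_mul_eq_zero hM (x := fun j => V * p j) (fun k hk => by
    simp_rw [mul_assoc]
    rw [← Finset.mul_sum]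
    rcases (Nat.lt_succ_iff.1 hk).lt_or_eq with hk | rfl
    · rw [hp.2 k hk, mul_zero]
    · exact hVm) n n.lt_succ_self
  rw [hp.1, mul_one] at h1
  refine hv0 (funext fun j => ?_)
  exact congrFun (congrFun h1 j) j

end BlockHankel

/-! ### From Hankel systems to the orthogonal polynomials. -/

section Polynomials

variable {γ : SmoothCurve} {W : ℂ → Matrix (Fin N) (Fin N) ℂ}

theorem lineMoment_sum {ι : Type*} (s : Finset ι) (a : ι → ℂ) (e : ι → ℕ) {f : ι → ℂ → ℂ}
    (hf : ∀ i, γ.IsAdmissible (f i)) (k : ℕ) :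
    γ.lineMoment (fun z => ∑ i ∈ s, a i * (z ^ e i * f i z)) k =
      ∑ i ∈ s, a i * γ.lineMoment (f i) (e i + k) := by
  have h1 : ∀ t, deriv γ.toFun t * (γ.toFun t ^ k * ∑ i ∈ s, a i *
      (γ.toFun t ^ e i * f i (γ.toFun t))) = ∑ i ∈ s, a i * (deriv γ.toFun t *
      (γ.toFun t ^ (e i + k) * f i (γ.toFun t))) := fun t => by
    rw [Finset.mul_sum, Finset.mul_sum]
    refine Finset.sum_congr rfl fun i _ => ?_
    ring
  simp_rw [SmoothCurve.lineMoment, h1]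
  rw [integral_finsetSum _ fun i _ => ((hf i).integrable _).const_mul _, Finset.mul_sum]
  refine Finset.sum_congr rfl fun i _ => ?_
  rw [integral_const_mul]
  ring

/-- Expresses orthogonality, an integral condition, as a linear system in the coefficients. -/
theorem matrixMoment_left (hW : IsHolderWeight γ W) (P : (Matrix (Fin N) (Fin N) ℂ)[X]) {n : ℕ}
    (hP : P.natDegree < n) (k : ℕ) :
    matrixMoment γ (fun z => evalAt P z * W z) k =
      ∑ j ∈ Finset.range n, P.coeff j * moment γ W (j + k) := by
  ext i l
  have h1 : ∀ z, (evalAt P z * W z) i l = ∑ q ∈ Finset.range n ×ˢ (Finset.univ : Finset (Fin N)),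
      P.coeff q.1 i q.2 * (z ^ q.1 * W z q.2 l) := fun z => by
    rw [Finset.sum_product_right, Matrix.mul_apply]
    refine Finset.sum_congr rfl fun m _ => ?_
    rw [evalAt_apply P hP, Finset.sum_mul]
    exact Finset.sum_congr rfl fun j _ => by ring
  rw [matrixMoment_apply]
  simp_rw [h1]
  refine (lineMoment_sum _ (fun q : ℕ × Fin N => P.coeff q.1 i q.2) (fun q => q.1)
    (f := fun q z => W z q.2 l) (fun q => isAdmissible_weight hW q.2 l) k).trans ?_
  rw [Finset.sum_product, Matrix.sum_apply]
  rfl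

theorem matrixMoment_right (hW : IsHolderWeight γ W) (P : (Matrix (Fin N) (Fin N) ℂ)[X]) {n : ℕ}
    (hP : P.natDegree < n) (k : ℕ) :
    matrixMoment γ (fun z => W z * evalAt P z) k =
      ∑ j ∈ Finset.range n, moment γ W (j + k) * P.coeff j := by
  ext i l
  have h1 : ∀ z, (W z * evalAt P z) i l = ∑ q ∈ Finset.range n ×ˢ (Finset.univ : Finset (Fin N)),
      P.coeff q.1 q.2 l * (z ^ q.1 * W z i q.2) := fun z => by
    rw [Finset.sum_product_right, Matrix.mul_apply]
    refine Finset.sum_congr rfl fun m _ => ?_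
    rw [evalAt_apply P hP, Finset.mul_sum]
    exact Finset.sum_congr rfl fun j _ => by ring
  rw [matrixMoment_apply]
  simp_rw [h1]
  refine (lineMoment_sum _ (fun q : ℕ × Fin N => P.coeff q.1 q.2 l) (fun q => q.1)
    (f := fun q z => W z i q.2) (fun q => isAdmissible_weight hW i q.2) k).trans ?_
  rw [Finset.sum_product, Matrix.sum_apply]
  refine Finset.sum_congr rfl fun j _ => ?_
  rw [Matrix.mul_apply]
  exact Finset.sum_congr rfl fun m _ => mul_comm _ _

/-- The polynomial of degree at most `n` with prescribed coefficients. -/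
noncomputable def polyOfCoeff (n : ℕ) (p : ℕ → Matrix (Fin N) (Fin N) ℂ) :
    (Matrix (Fin N) (Fin N) ℂ)[X] :=
  ∑ j ∈ Finset.range (n + 1), Polynomial.monomial j (p j)

theorem coeff_polyOfCoeff (n : ℕ) (p : ℕ → Matrix (Fin N) (Fin N) ℂ) (j : ℕ) :
    (polyOfCoeff n p).coeff j = if j ≤ n then p j else 0 := by
  simp [polyOfCoeff, Polynomial.coeff_monomial]

theorem isMonicOfDegree_polyOfCoeff {n : ℕ} {p : ℕ → Matrix (Fin N) (Fin N) ℂ} (hp : p n = 1) :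
    IsMonicOfDegree (polyOfCoeff n p) n := by
  refine ⟨Polynomial.natDegree_le_iff_coeff_eq_zero.2 fun j hj => ?_, ?_⟩
  · rw [coeff_polyOfCoeff, if_neg (not_le.2 hj)]
  · rw [coeff_polyOfCoeff, if_pos le_rfl, hp]

theorem sum_coeff_polyOfCoeff {A : Type*} [AddCommMonoid A] (n : ℕ)
    (p : ℕ → Matrix (Fin N) (Fin N) ℂ) (F : ℕ → Matrix (Fin N) (Fin N) ℂ → A) :
    ∑ j ∈ Finset.range (n + 1), F j ((polyOfCoeff n p).coeff j) =
      ∑ j ∈ Finset.range (n + 1), F j (p j) :=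
  Finset.sum_congr rfl fun j hj => by
    rw [coeff_polyOfCoeff, if_pos (Nat.lt_succ_iff.1 (Finset.mem_range.1 hj))]

theorem exists_isOrthogonalSystem (hW : IsHolderWeight γ W) (hreg : IsRegular γ W) :
    ∃ PL PR C, IsOrthogonalSystem γ W PL PR C := by
  have hM := det_blockHankel_ne_zero hreg
  choose p hp using fun n => exists_isLeftOrthogonal (hM n)
  choose q hq using fun n => exists_isRightOrthogonal (hM n)
  have hu := fun n => (hp n).isUnit (hM (n + 1))
  have hinv : ∀ n, ((∑ j ∈ Finset.range (n + 1), p n j * moment γ W (j + n))⁻¹)⁻¹ =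
      ∑ j ∈ Finset.range (n + 1), p n j * moment γ W (j + n) := fun n =>
    Matrix.nonsing_inv_nonsing_inv _ ((Matrix.isUnit_iff_isUnit_det _).1 (hu n))
  have hL := fun n => isMonicOfDegree_polyOfCoeff (hp n).1
  have hR := fun n => isMonicOfDegree_polyOfCoeff (hq n).1
  refine ⟨fun n => polyOfCoeff n (p n), fun n => polyOfCoeff n (q n),
    fun n => (∑ j ∈ Finset.range (n + 1), p n j * moment γ W (j + n))⁻¹,
    fun n => Matrix.isUnit_nonsing_inv_iff.2 (hu n), hL, hR, fun n k hk => ?_, fun n k hk => ?_⟩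
  · rw [hinv]
    refine (matrixMoment_left hW _ (Nat.lt_succ_of_le (hL n).1) k).trans ?_
    rw [sum_coeff_polyOfCoeff n (p n) fun j A => A * moment γ W (j + k)]
    split_ifs with h
    · rw [h]
    · exact (hp n).2 k (lt_of_le_of_ne hk (Ne.symm h))
  · rw [hinv]
    refine (matrixMoment_right hW _ (Nat.lt_succ_of_le (hR n).1) k).trans ?_
    rw [sum_coeff_polyOfCoeff n (q n) fun j A => moment γ W (j + k) * A]
    split_ifs with h
    -- `C n` was defined from the left polynomials. Equality of the two norms makes it serve the
    -- right ones.
    · rw [(hp n).sum_eq (hq n), h]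
    · exact (hq n).2 k (lt_of_le_of_ne hk (Ne.symm h))

variable {PL PR PL' PR' : ℕ → (Matrix (Fin N) (Fin N) ℂ)[X]}
  {C C' : ℕ → Matrix (Fin N) (Fin N) ℂ}

theorem IsOrthogonalSystem.isLeftOrthogonal (hW : IsHolderWeight γ W)
    (h : IsOrthogonalSystem γ W PL PR C) (n : ℕ) :
    IsLeftOrthogonal (moment γ W) n (PL n).coeff := by
  refine ⟨(h.monic_left n).2, fun k hk => ?_⟩
  rw [← matrixMoment_left hW _ (Nat.lt_succ_of_le (h.monic_left n).1)]
  exact (h.orthogonal_left n k hk.le).trans (if_neg hk.ne')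

theorem IsOrthogonalSystem.isRightOrthogonal (hW : IsHolderWeight γ W)
    (h : IsOrthogonalSystem γ W PL PR C) (n : ℕ) :
    IsRightOrthogonal (moment γ W) n (PR n).coeff := by
  refine ⟨(h.monic_right n).2, fun k hk => ?_⟩
  rw [← matrixMoment_right hW _ (Nat.lt_succ_of_le (h.monic_right n).1)]
  exact (h.orthogonal_right n k hk.le).trans (if_neg hk.ne')

theorem eq_of_coeff_eq {P Q : (Matrix (Fin N) (Fin N) ℂ)[X]} {n : ℕ} (hP : IsMonicOfDegree P n)
    (hQ : IsMonicOfDegree Q n) (h : ∀ j ≤ n, P.coeff j = Q.coeff j) : P = Q := by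
  ext1 j
  rcases le_or_gt j n with hj | hj
  · exact h j hj
  · rw [Polynomial.coeff_eq_zero_of_natDegree_lt (hP.1.trans_lt hj),
      Polynomial.coeff_eq_zero_of_natDegree_lt (hQ.1.trans_lt hj)]

theorem IsOrthogonalSystem.eq (hW : IsHolderWeight γ W) (hreg : IsRegular γ W)
    (h : IsOrthogonalSystem γ W PL PR C) (h' : IsOrthogonalSystem γ W PL' PR' C') :
    PL = PL' ∧ PR = PR' ∧ C = C' := by
  have hM := det_blockHankel_ne_zero hreg
  have hL : PL = PL' := funext fun n => eq_of_coeff_eq (h.monic_left n) (h'.monic_left n)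
    ((h.isLeftOrthogonal hW n).eq (hM n) (h'.isLeftOrthogonal hW n))
  have hR : PR = PR' := funext fun n => eq_of_coeff_eq (h.monic_right n) (h'.monic_right n)
    ((h.isRightOrthogonal hW n).eq (hM n) (h'.isRightOrthogonal hW n))
  refine ⟨hL, hR, funext fun n => ?_⟩
  have h1 := h.orthogonal_left n n le_rfl
  rw [hL, h'.orthogonal_left n n le_rfl, if_pos rfl, if_pos rfl] at h1
  rw [← Matrix.nonsing_inv_nonsing_inv (C n)
    ((Matrix.isUnit_iff_isUnit_det _).1 (h.nonsingular n)), ← h1, Matrix.nonsing_inv_nonsing_inv _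
    ((Matrix.isUnit_iff_isUnit_det _).1 (h'.nonsingular n))]

end Polynomials

end MatrixRHP

theorem mainTheorem1 (N : ℕ) (γ : MatrixRHP.SmoothCurve)
    (W : ℂ → Matrix (Fin N) (Fin N) ℂ)
    (hW : MatrixRHP.IsHolderWeight γ W) (hreg : MatrixRHP.IsRegular γ W) :
    (∃! S : (ℕ → Polynomial (Matrix (Fin N) (Fin N) ℂ)) ×
        (ℕ → Polynomial (Matrix (Fin N) (Fin N) ℂ)) × (ℕ → Matrix (Fin N) (Fin N) ℂ),
      MatrixRHP.IsOrthogonalSystem γ W S.1 S.2.1 S.2.2) ∧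
    ∀ (PL PR : ℕ → Polynomial (Matrix (Fin N) (Fin N) ℂ))
      (C : ℕ → Matrix (Fin N) (Fin N) ℂ),
      MatrixRHP.IsOrthogonalSystem γ W PL PR C →
      ∀ n : ℕ,
        (MatrixRHP.SolvesLeftRHP γ W n (MatrixRHP.leftY γ W PL C n) ∧
          ∀ Z : ℂ → Matrix (Fin N ⊕ Fin N) (Fin N ⊕ Fin N) ℂ,
            MatrixRHP.SolvesLeftRHP γ W n Z →
              Set.EqOn Z (MatrixRHP.leftY γ W PL C n) γ.imageᶜ) ∧
        (MatrixRHP.SolvesRightRHP γ W n (MatrixRHP.rightY γ W PR C n) ∧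
          ∀ Z : ℂ → Matrix (Fin N ⊕ Fin N) (Fin N ⊕ Fin N) ℂ,
            MatrixRHP.SolvesRightRHP γ W n Z →
              Set.EqOn Z (MatrixRHP.rightY γ W PR C n) γ.imageᶜ) := by
  refine ⟨?_, fun PL PR C h n => ?_⟩
  · obtain ⟨PL, PR, C, h⟩ := MatrixRHP.exists_isOrthogonalSystem hW hreg
    refine ⟨(PL, PR, C), h, fun S hS => ?_⟩
    obtain ⟨h1, h2, h3⟩ := MatrixRHP.IsOrthogonalSystem.eq hW hreg hS h
    exact Prod.ext h1 (Prod.ext h2 h3)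
  · have hL := MatrixRHP.solvesLeftRHP_leftY hW h n
    have hR := MatrixRHP.solvesRightRHP_rightY hW h n
    exact ⟨⟨hL, fun Z hZ => hZ.eqOn hL hR⟩, hR, fun Z hZ => hZ.eqOn hR hL⟩
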